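/- **Setting.** Let $\Sigma$ be a $C^\infty$ two-dimensional closed orientable manifold, $\Omega$ a $C^\infty$ volume (area) form on $\Sigma$, and let $\mathrm{Diff}^\infty_\Omega(\Sigma)$ be the set of $C^\infty$ diffeomorphisms of $\Sigma$ that preserve $\Omega$. Let $\Delta$ be a closed unit disk of finite dimension $d$. A *$C^\infty$ family in $\mathrm{Diff}^\infty_\Omega(\Sigma)$* is a family $(f_\mu)_{\mu\in\Delta}$ of elements of $\mathrm{Diff}^\infty_\Omega(\Sigma)$ such that $(x,\mu)\mapsto f_\mu(x)$ is a $C^\infty$ map $\Sigma\times\Delta\to\Sigma$; the set of these families carries the $C^\infty$ topology of maps $\Sigma\times\Delta\to\Sigma$. Let $S^1=\mathbb R/\mathbb Z$ and let $P_x:S^1\times[-1,1]\to S^1$ be the projection to the first coordinate. The family $(f_\mu)_{\mu\in\Delta}$ *admits a family of KAM circles* if there are a real number $\theta$ and a $C^\infty$ family $(\psi_\mu)_{\mu\in\Delta}$ of embeddings of $S^1\times[-1,1]$ into $\Sigma$ such that, for all $\mu\in\Delta$ and $x\in S^1$, $$f_\mu(\psi_\mu(x,0))=\psi_\mu(x+\theta,0)\qquad\text{and}\qquad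 \frac{\partial}{\partial y}\Big[P_x\circ(\psi_\mu^{-1}\circ f_\mu\circ\psi_\mu)\Big](x,0)>0 .$$ For a diffeomorphism $f$ of $\Sigma$ and $n\ge1$, let $\mathrm{Per}_h(f,n)$ (resp. $\mathrm{Per}_e(f,n)$) be the set of periodic points $p$ of $f$ of least period $n$ that are hyperbolic, i.e. no eigenvalue of $D(f^n)_p$ has modulus $1$ (resp. elliptic, i.e. the eigenvalues of $D(f^n)_p$ are non-real and of modulus $1$). **Proposition.** Let $(f_\mu)_{\mu\in\Delta}$ be a $C^\infty$ family in $\mathrm{Diff}^\infty_\Omega(\Sigma)$ which admits a family of KAM circles. Then for any neighborhood $\mathcal V$ of $(f_\mu)_{\mu\in\Delta}$ in the space of $C^\infty$ families in $\mathrm{Diff}^\infty_\Omega(\Sigma)$, any sequence $(\gamma_n)_{n\ge1}$ of positive integers and any $n_0\ge1$, there exist a family $(\hat f_\mu)_{\mu\in\Delta}$ in $\mathcal V$ and an integer $\hat n\ge n_0$ such that $$\min\{\#\mathrm{Per}_h(\hat f_\mu,\hat n),\ \#\mathrm{Per}_e(\hat f_\mu,\hat n)\}\ \ge\ \hat n\cdot\gamma_{\hat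 n}\qquad\text{for all }\mu\in\Delta .$$ -/

import Mathlib

open Set Filter Topology
open scoped Manifold ContDiff

noncomputable section

namespace KAMGrowth

/-- The Euclidean plane, on which surfaces are modelled. -/
abbrev Plane : Type := EuclideanSpace ℝ (Fin 2)

/-- The Euclidean space that contains the `d`-dimensional parameter disk. -/
abbrev Param (d : ℕ) : Type := EuclideanSpace ℝ (Fin d)

/-- The `d`-dimensional closed unit disk. -/
abbrev disk (d : ℕ) : Set (Param d) := Metric.closedBall (0 : Param d) 1

section Surface

variable (S : Type*) [TopologicalSpace S] [ChartedSpace Plane S] [IsManifold (𝓡 2) ∞ S]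

/-- A `C^∞` volume form on a surface: a `C^∞` section of the bundle of bilinear forms on the tangent
spaces which is alternating and vanishes nowhere. -/
structure AreaForm where
  /-- The bilinear form on each tangent space. -/
  form (p : S) : TangentSpace (𝓡 2) p →L[ℝ] TangentSpace (𝓡 2) p →L[ℝ] ℝ
  alternating (p : S) (v : TangentSpace (𝓡 2) p) : form p v v = 0
  nonvanishing (p : S) : form p ≠ 0
  contMDiff : ContMDiff (𝓡 2) ((𝓡 2).prod 𝓘(ℝ, Plane →L[ℝ] Plane →L[ℝ] ℝ)) ∞
    (fun p ↦ Bundle.TotalSpace.mk' (Plane →L[ℝ] Plane →L[ℝ] ℝ)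
      (E := fun p : S ↦ TangentSpace (𝓡 2) p →L[ℝ] TangentSpace (𝓡 2) p →L[ℝ] ℝ) p (form p))

variable {S}

/-- The diffeomorphism `f` preserves the area form `Ω`, i.e. the pull-back of `Ω` by `f` is `Ω`. -/
def Preserves (Ω : AreaForm S) (f : S ≃ₘ⟮𝓡 2, 𝓡 2⟯ S) : Prop :=
  ∀ (p : S) (v w : TangentSpace (𝓡 2) p),
    Ω.form (f p) (mfderiv (𝓡 2) (𝓡 2) f p v) (mfderiv (𝓡 2) (𝓡 2) f p w) = Ω.form p v w

/-- The map `(p, μ) ↦ f_μ(p)` of a family of self-maps of `S` parametrized by the closed unit disk.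
The value at `(p, μ)` with `μ` outside the disk is a dummy: it is never used. -/
def total {d : ℕ} (f : disk d → S → S) : S × Param d → S := by
  classical
  exact fun q ↦ if h : q.2 ∈ disk d then f ⟨q.2, h⟩ q.1 else q.1

/-- `C^∞` families, with parameter set the `d`-dimensional closed unit disk, of `C^∞`
diffeomorphisms of `S` that preserve `Ω`. -/
structure Family (Ω : AreaForm S) (d : ℕ) where
  /-- The members of the family. -/
  map : disk d → (S ≃ₘ⟮𝓡 2, 𝓡 2⟯ S)
  preserves (μ : disk d) : Preserves Ω (map μ)
  smooth : ContMDiffOn ((𝓡 2).prod 𝓘(ℝ, Param d)) (𝓡 2) ∞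
    (total fun μ p ↦ map μ p) (univ ×ˢ disk d)

/-- The map `(p, μ) ↦ f_μ(p)`. -/
def Family.eval {Ω : AreaForm S} {d : ℕ} (f : Family Ω d) : S × Param d → S :=
  total fun μ p ↦ f.map μ p

/-- The map `(p, μ) ↦ f_μ(p)` read in the chart `e` of the source surface and the chart `e'` of the
target surface (the parameter is not changed). -/
def Family.coord {Ω : AreaForm S} {d : ℕ} (f : Family Ω d)
    (e e' : OpenPartialHomeomorph S Plane) : Plane × Param d → Plane :=
  fun z ↦ e' (f.eval (e.symm z.1, z.2))

/-- The basic neighbourhood of `f` given by the charts `e`, `e'`, the compact set `K`, the order `r`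
and the size `ε`: families `g` that map `K` into the domain of `e'` and whose partial derivatives of
order at most `r`, in these charts, are `ε`-close on `K` to those of `f`. -/
def Family.basicNhd {Ω : AreaForm S} {d : ℕ} (f : Family Ω d)
    (e e' : OpenPartialHomeomorph S Plane) (K : Set (S × Param d)) (r : ℕ) (ε : ℝ) :
    Set (Family Ω d) :=
  {g | ∀ q ∈ K, g.eval q ∈ e'.source ∧ ∀ k ≤ r,
    ‖iteratedFDerivWithin ℝ k (g.coord e e') (e.target ×ˢ disk d) (e q.1, q.2) -
      iteratedFDerivWithin ℝ k (f.coord e e') (e.target ×ˢ disk d) (e q.1, q.2)‖ < ε}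

/-- The `C^∞` topology on the set of families: the topology of uniform convergence on compact
subsets of charts of the maps `(p, μ) ↦ f_μ(p)` together with all their partial derivatives. -/
instance Family.instTopologicalSpace (Ω : AreaForm S) (d : ℕ) : TopologicalSpace (Family Ω d) :=
  TopologicalSpace.generateFrom
    {U | ∃ (f : Family Ω d) (e e' : OpenPartialHomeomorph S Plane) (K : Set (S × Param d))
        (r : ℕ) (ε : ℝ),
      e ∈ IsManifold.maximalAtlas (𝓡 2) ∞ S ∧ e' ∈ IsManifold.maximalAtlas (𝓡 2) ∞ S ∧
      IsCompact K ∧ K ⊆ e.source ×ˢ disk d ∧ (∀ q ∈ K, f.eval q ∈ e'.source) ∧ 0 < ε ∧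
      U = f.basicNhd e e' K r ε}

/-- `ψ` is a family of KAM circles of `f` with rotation number `θ`. The circle `S¹ = ℝ/ℤ` is
`AddCircle 1`, and smoothness on `S¹ × [-1,1]` is expressed on the universal cover `ℝ × [-1,1]`.
Only the values `ψ μ x y` with `μ` in the closed unit disk and `y ∈ [-1,1]` play a role. -/
structure IsKAMCircleFamily {Ω : AreaForm S} {d : ℕ} (f : Family Ω d) (θ : ℝ)
    (ψ : Param d → AddCircle (1 : ℝ) → ℝ → S) : Prop where
  /-- The family is `C^∞`: the map `(x, y, μ) ↦ ψ_μ(x, y)` is `C^∞` on `S¹ × [-1,1] × Δ`. -/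
  smooth : ContMDiffOn 𝓘(ℝ, (ℝ × ℝ) × Param d) (𝓡 2) ∞
    (fun z : (ℝ × ℝ) × Param d ↦ ψ z.2 (z.1.1 : AddCircle (1 : ℝ)) z.1.2)
    ((univ ×ˢ Icc (-1) 1) ×ˢ disk d)
  /-- Each `ψ_μ` is injective on `S¹ × [-1,1]`. -/
  injective : ∀ μ ∈ disk d,
    InjOn (fun z : AddCircle (1 : ℝ) × ℝ ↦ ψ μ z.1 z.2) (univ ×ˢ Icc (-1) 1)
  /-- Each `ψ_μ` is an immersion of `S¹ × [-1,1]`. -/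
  immersion : ∀ μ ∈ disk d, ∀ x : ℝ, ∀ y ∈ Icc (-1 : ℝ) 1,
    Function.Injective (mfderivWithin 𝓘(ℝ, ℝ × ℝ) (𝓡 2)
      (fun z : ℝ × ℝ ↦ ψ μ (z.1 : AddCircle (1 : ℝ)) z.2) (univ ×ˢ Icc (-1) 1) (x, y))
  /-- On the circle `y = 0`, the map `f_μ` is conjugate to the rotation by `θ`. -/
  rotation : ∀ (μ : disk d) (x : AddCircle (1 : ℝ)),
    f.map μ (ψ μ x 0) = ψ μ (x + (θ : AddCircle (1 : ℝ))) 0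
  /-- The derivative at `y = 0` of the first coordinate of `(ψ_μ⁻¹ ∘ f_μ ∘ ψ_μ)(x, y)` with respect
  to `y` is positive. Here `(X y mod 1, Y y)` is `(ψ_μ⁻¹ ∘ f_μ ∘ ψ_μ)(x, y)` for small `y`, so `X` is
  a real lift of the circle-valued first coordinate; its derivative does not depend on the lift. -/
  twist : ∀ (μ : disk d) (x : AddCircle (1 : ℝ)), ∃ (X Y : ℝ → ℝ) (c : ℝ),
    (∀ᶠ y in 𝓝 (0 : ℝ), Y y ∈ Icc (-1 : ℝ) 1 ∧
      f.map μ (ψ μ x y) = ψ μ (X y : AddCircle (1 : ℝ)) (Y y)) ∧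
    HasDerivAt X c 0 ∧ 0 < c

/-- The derivative of `f^n` at `p`. When `f^n(p) = p`, this is an endomorphism of the tangent space
at `p`, which Mathlib realizes as the plane. -/
def iterDeriv (f : S → S) (n : ℕ) (p : S) : Plane →L[ℝ] Plane :=
  mfderiv (𝓡 2) (𝓡 2) (f^[n]) p

/-- `z` is a complex eigenvalue of the real linear map `A`. -/
def IsComplexEigenvalue (A : Plane →L[ℝ] Plane) (z : ℂ) : Prop :=
  Polynomial.aeval z (LinearMap.charpoly (A : Plane →ₗ[ℝ] Plane)) = 0

/-- The hyperbolic periodic points of `f` of least period `n`: no eigenvalue of the derivative of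
`f^n` lies on the unit circle. -/
def hypPer (f : S → S) (n : ℕ) : Set S :=
  {p | p ∈ Function.periodicPts f ∧ Function.minimalPeriod f p = n ∧
    ∀ z : ℂ, IsComplexEigenvalue (iterDeriv f n p) z → ‖z‖ ≠ 1}

/-- The elliptic periodic points of `f` of least period `n`: the eigenvalues of the derivative of
`f^n` are non-real and lie on the unit circle. -/
def ellPer (f : S → S) (n : ℕ) : Set S :=
  {p | p ∈ Function.periodicPts f ∧ Function.minimalPeriod f p = n ∧
    ∀ z : ℂ, IsComplexEigenvalue (iterDeriv f n p) z → ‖z‖ = 1 ∧ z.im ≠ 0}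

end Surface

end KAMGrowth

end

/-! The circles persist while the rotation number is made rational, and then every point of them is
periodic. Small local rotations, placed at many of these points, break the degenerate periodic
points into hyperbolic and elliptic ones. Everything is done for all parameters at once.

Coordinates: replacing the vertical coordinate of the given annuli by the integral of the area
density along vertical segments makes the area form a constant multiple of `dx ∧ dy` and fixes the
core circle pointwise (`exists_isAreaAnnulus`). Since `f_μ` preserves area and rotates the core, its
derivative there is a shear `(v₁, v₂) ↦ (v₁ + a v₂, v₂)`. The twist condition gives `a > 0`, and
compactness of the disk bounds `a` above and away from `0` (`exists_isTwistAnnulus`).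

Perturbations: an area-preserving flow of the strip that commutes with integer translations and is
supported inside the strip is carried to the surface by the annuli. Composing `f` with it yields a
smooth path of families, hence a continuous path in the `C^∞` topology (`eventually_perturb_mem`),
so small times stay in the given neighbourhood. A twist which is rigid near the core changes `θ`
into `p / n` with `n` a large prime and `n ∤ p` (`exists_rational_near`, `perturb_twistFlow`).

Now cut the circle into `2Ln` cells. The rotation by `p / n` moves each cell by `2Lp` places, so the
orbit of a centre of one of the first `2L` cells meets these cells once per period. Rotate around
the centres by `s` in the first `L` cells and by `-s` in the next `L`. At those centres the
derivative of the `n`-th iterate is a rotation followed by a shear whose coefficient `A` is a sum of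
`n` positive ones: determinant `1`, trace `2 cos s ± A sin s` (`trace_orbit`). For small `s > 0` the
plus sign gives trace above `2` (hyperbolic) and the minus sign gives modulus below `2` (elliptic),
uniformly in `μ`. Taking `L = n γ_n` finishes. -/

section RelativeInverse

/-! ### Inverse functions depending on a parameter in a set with boundary. -/

variable {E E' P : Type} [NormedAddCommGroup E] [NormedSpace ℝ E] [NormedAddCommGroup E']
  [NormedSpace ℝ E'] [NormedAddCommGroup P] [NormedSpace ℝ P]

/-- Bootstrapping: the derivative of `G` at `b` is the inverse of that of `F` at `G b`, so it is as
smooth as `G`, and each step gains one order. Working within `A` and `B` allows boundary points. -/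
theorem contDiffOn_of_rightInvOn [CompleteSpace E] {F : E → E'} {G : E' → E} {A : Set E}
    {B : Set E'} (hF : ContDiffOn ℝ ∞ F A) (hA : UniqueDiffOn ℝ A) (hB : UniqueDiffOn ℝ B)
    (hG : ContinuousOn G B) (hm : MapsTo G B A) (hFG : ∀ b ∈ B, F (G b) = b)
    (hinv : ∀ b ∈ B, (fderivWithin ℝ F A (G b)).IsInvertible) : ContDiffOn ℝ ∞ G B := by
  rw [contDiffOn_infty]
  intro n
  induction n with
  | zero => exact contDiffOn_zero.2 hG
  | succ n ih =>
    rw [show ((n + 1 : ℕ) : ℕ∞ω) = (n : ℕ∞ω) + 1 by push_cast; rfl]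
    rw [contDiffOn_succ_iff_hasFDerivWithinAt_of_uniqueDiffOn hB]
    refine ⟨by simp, fun b => (fderivWithin ℝ F A (G b)).inverse, ?_, ?_⟩
    · intro b hb
      have h1 : ContDiffOn ℝ n (fun b => fderivWithin ℝ F A (G b)) B :=
        (hF.fderivWithin (m := n) hA (by exact_mod_cast le_top)).comp ih hm
      exact (hinv b hb).contDiffAt_map_inverse.comp_contDiffWithinAt b (h1 b hb)
    · intro b hb
      obtain ⟨M, hM⟩ := hinv b hb
      have h2 : HasFDerivWithinAt F (M : E →L[ℝ] E') A (G b) := by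
        rw [hM]
        exact ((hF.differentiableOn (by simp)) _ (hm hb)).hasFDerivWithinAt
      have h3 := h2.of_local_left_inverse (g := G) (s := B) (a := b)
        ((hG b hb).tendsto_nhdsWithin hm) hb
        (eventually_of_mem self_mem_nhdsWithin hFG)
      have h4 : (fderivWithin ℝ F A (G b)).inverse = (M.symm : E' →L[ℝ] E) := by
        rw [← hM, ContinuousLinearMap.inverse_equiv]
      change HasFDerivWithinAt G (fderivWithin ℝ F A (G b)).inverse B b
      rw [h4]
      exact h3

/-- Block-triangular with identity in the parameter block. It is applied to the derivative of `(u,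
μ) ↦ (F (u, μ), μ)`. -/
theorem isInvertible_prod_snd {T : E × P →L[ℝ] E'}
    (hT : (T.comp (ContinuousLinearMap.inl ℝ E P)).IsInvertible) :
    (T.prod (ContinuousLinearMap.snd ℝ E P)).IsInvertible := by
  obtain ⟨M, hM⟩ := hT
  have hM' : ∀ u : E, T (u, 0) = M u := fun u => by
    have := congrArg (fun A : E →L[ℝ] E' => A u) hM
    simpa using this.symm
  have hT' : ∀ w : E × P, T w = M w.1 + T (0, w.2) := fun w => by
    rw [← hM', ← map_add]; simp
  refine ContinuousLinearMap.IsInvertible.of_inverse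
    (g := ((M.symm : E' →L[ℝ] E).comp (ContinuousLinearMap.fst ℝ E' P -
      (T.comp (ContinuousLinearMap.inr ℝ E P)).comp (ContinuousLinearMap.snd ℝ E' P))).prod
      (ContinuousLinearMap.snd ℝ E' P)) ?_ ?_
  · refine ContinuousLinearMap.ext fun w => ?_
    have h := hT' (M.symm (w.1 - T (0, w.2)), w.2)
    simp only [M.apply_symm_apply] at h
    exact Prod.ext (by simpa using h) (by simp)
  · refine ContinuousLinearMap.ext fun w => ?_
    have h := hT' w
    exact Prod.ext (by simp [h]) (by simp)

/-- The parameter set may have boundary, so the inverse function theorem on open subsets of `E × P`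
does not apply. Instead `F (·, μ)` is inverted for each `μ` with the quantitative theorem, on a ball
and with constants that do not depend on `μ` near `μ₀`. Continuity of the solution comes from the
antilipschitz bound, smoothness from `contDiffOn_of_rightInvOn`. -/
theorem exists_local_inverse_within [CompleteSpace E] [CompleteSpace P] [Nontrivial E] {D : Set P}
    (hD : UniqueDiffOn ℝ D) {F : E × P → E'} {u₀ : E} {μ₀ : P} (hμ : μ₀ ∈ D)
    {O : Set (E × P)} (hO : IsOpen O) (h₀ : (u₀, μ₀) ∈ O)
    (hF : ContDiffOn ℝ ∞ F (O ∩ univ ×ˢ D)) (L : E ≃L[ℝ] E')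
    (hL : HasFDerivAt (fun u => F (u, μ₀)) (L : E →L[ℝ] E') u₀) :
    ∃ J : E' × P → E, J (F (u₀, μ₀), μ₀) = u₀ ∧
      ContDiffWithinAt ℝ ∞ J (univ ×ˢ D) (F (u₀, μ₀), μ₀) ∧
      ∀ᶠ q in 𝓝[univ ×ˢ D] (F (u₀, μ₀), μ₀), F (J q, q.2) = q.1 := by
  classical
  set A := O ∩ univ ×ˢ D with hAdef
  have hA : UniqueDiffOn ℝ A := by
    rw [hAdef, inter_comm]
    exact (uniqueDiffOn_univ.prod hD).inter hO
  have h₀A : (u₀, μ₀) ∈ A := ⟨h₀, trivial, hμ⟩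
  set Φ : E × P → (E →L[ℝ] E') :=
    fun w => (fderivWithin ℝ F A w).comp (ContinuousLinearMap.inl ℝ E P) with hΦ
  have hΦd : ∀ w ∈ A, HasFDerivAt (fun u => F (u, w.2)) (Φ w) w.1 := by
    intro w hw
    have h1 := ((hF.differentiableOn (by simp)) _ hw).hasFDerivWithinAt
    have h2 : HasFDerivAt (fun u : E => (u, w.2)) (ContinuousLinearMap.inl ℝ E P) w.1 :=
      (hasFDerivAt_id _).prodMk (hasFDerivAt_const _ _)
    have h3 : ∀ᶠ u in 𝓝 w.1, (u, w.2) ∈ A := by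
      have : Tendsto (fun u : E => (u, w.2)) (𝓝 w.1) (𝓝 w) :=
        (Continuous.prodMk_left w.2).tendsto' _ _ rfl
      filter_upwards [this.eventually (hO.mem_nhds hw.1)] with u hu
      exact ⟨hu, trivial, hw.2.2⟩
    have h4 : HasFDerivWithinAt F (fderivWithin ℝ F A w) A ((fun u : E => (u, w.2)) w.1) := h1
    have h5 := h4.comp (s := {u | (u, w.2) ∈ A}) w.1 h2.hasFDerivWithinAt (fun u hu => hu)
    exact h5.hasFDerivAt h3
  have hΦc : ContinuousOn Φ A := by
    have : ContinuousOn (fderivWithin ℝ F A) A := hF.continuousOn_fderivWithin hA (by simp)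
    exact this.clm_comp continuousOn_const
  have hΦ0 : Φ (u₀, μ₀) = L := (hΦd _ h₀A).unique hL
  have hNpos : 0 < ‖(L.symm : E' →L[ℝ] E)‖₊ := L.nnnorm_symm_pos
  set N := ‖(L.symm : E' →L[ℝ] E)‖₊ with hN
  have hNi : 0 < N⁻¹ := inv_pos.2 hNpos
  -- Any error below `N⁻¹ = ‖L⁻¹‖⁻¹` keeps a map approximated by `L` injective and open.
  set c := N⁻¹ / 2 with hc
  have hcN : c < N⁻¹ := NNReal.half_lt_self hNi.ne'
  have hcpos : 0 < c := half_pos hNi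
  have hev : ∀ᶠ w in 𝓝[A] (u₀, μ₀), ‖Φ w - L‖ < c ∧ (Φ w).IsInvertible := by
    have h1 : Tendsto Φ (𝓝[A] (u₀, μ₀)) (𝓝 (L : E →L[ℝ] E')) := by
      have := hΦc _ h₀A
      rwa [ContinuousWithinAt, hΦ0] at this
    exact ((tendsto_iff_norm_sub_tendsto_zero.1 h1).eventually
      (gt_mem_nhds (show (0 : ℝ) < c from hcpos))).and
      (h1.eventually (ContinuousLinearEquiv.nhds L))
  have hev2 : ∀ᶠ w in 𝓝 (u₀, μ₀), w.2 ∈ D → w ∈ A ∧ ‖Φ w - L‖ < c ∧ (Φ w).IsInvertible := by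
    filter_upwards [eventually_nhdsWithin_iff.1 hev, hO.mem_nhds h₀] with w hw hwO hwD
    have : w ∈ A := ⟨hwO, trivial, hwD⟩
    exact ⟨this, hw this⟩
  obtain ⟨r, hr, hball⟩ := Metric.eventually_nhds_iff_ball.1 hev2
  have hprod : ∀ u ∈ Metric.ball u₀ r, ∀ μ ∈ D ∩ Metric.ball μ₀ r,
      (u, μ) ∈ A ∧ ‖Φ (u, μ) - L‖ < c ∧ (Φ (u, μ)).IsInvertible := by
    intro u hu μ hm
    refine hball (u, μ) ?_ hm.1
    rw [← ball_prod_same]; exact ⟨hu, hm.2⟩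
  set ρ := r / 2 with hρ
  have hρ0 : 0 < ρ := half_pos hr
  have hρr : Metric.closedBall u₀ ρ ⊆ Metric.ball u₀ r :=
    Metric.closedBall_subset_ball (half_lt_self hr)
  have happ : ∀ μ ∈ D ∩ Metric.ball μ₀ r,
      ApproximatesLinearOn (fun u => F (u, μ)) (L : E →L[ℝ] E') (Metric.closedBall u₀ ρ) c := by
    intro μ hm x hx y hy
    exact (convex_closedBall u₀ ρ).norm_image_sub_le_of_norm_hasFDerivWithin_le'
      (f := fun u => F (u, μ)) (f' := fun u => Φ (u, μ))
      (fun u hu => (hΦd (u, μ) (hprod u (hρr hu) μ hm).1).hasFDerivWithinAt)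
      (fun u hu => (hprod u (hρr hu) μ hm).2.1.le) hy hx
  set κ : ℝ := (N : ℝ)⁻¹ - c with hκ
  have hκ0 : 0 < κ := sub_pos.2 (by exact_mod_cast hcN)
  -- The image of the `ρ`-ball under `F (·, μ)` covers the `κρ`-ball around `F (u₀, μ)`. Half of it
  -- pays for the displacement of this centre from `v₀`, half for the range of `v`.
  set η := κ * ρ / 2 with hη
  have hη0 : 0 < η := by positivity
  have hFμ : ∀ᶠ μ in 𝓝[D] μ₀, dist (F (u₀, μ)) (F (u₀, μ₀)) < η := by
    have h1 : ContinuousWithinAt (fun μ => F (u₀, μ)) (D ∩ Metric.ball μ₀ r) μ₀ := by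
      refine ContinuousWithinAt.comp (f := fun μ => (u₀, μ)) (t := A)
        (hF.continuousOn _ h₀A) (by fun_prop) fun μ hm => ?_
      exact (hprod u₀ (Metric.mem_ball_self hr) μ hm).1
    rw [ContinuousWithinAt, nhdsWithin_inter_of_mem' (mem_nhdsWithin_of_mem_nhds
      (Metric.ball_mem_nhds _ hr))] at h1
    exact h1.eventually (Metric.ball_mem_nhds _ hη0)
  obtain ⟨r', hr', hball'⟩ := Metric.eventually_nhds_iff_ball.1 (eventually_nhdsWithin_iff.1 hFμ)
  set R := min r r' with hR
  have hR0 : 0 < R := lt_min hr hr'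
  have hRr : D ∩ Metric.ball μ₀ R ⊆ D ∩ Metric.ball μ₀ r :=
    inter_subset_inter_right _ (Metric.ball_subset_ball (min_le_left _ _))
  set v₀ := F (u₀, μ₀) with hv₀
  set B : Set (E' × P) := Metric.ball v₀ η ×ˢ (D ∩ Metric.ball μ₀ R) with hB
  have hBnhds : B ∈ 𝓝[univ ×ˢ D] (v₀, μ₀) := by
    have : Metric.ball v₀ η ×ˢ Metric.ball μ₀ R ∈ 𝓝 (v₀, μ₀) :=
      prod_mem_nhds (Metric.ball_mem_nhds _ hη0) (Metric.ball_mem_nhds _ hR0)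
    refine mem_of_superset (inter_mem self_mem_nhdsWithin (mem_nhdsWithin_of_mem_nhds this)) ?_
    rintro ⟨v, μ⟩ ⟨⟨_, h1⟩, h2, h3⟩
    exact ⟨h2, h1, h3⟩
  have hex : ∀ q ∈ B, ∃ u ∈ Metric.closedBall u₀ ρ, F (u, q.2) = q.1 := by
    rintro ⟨v, μ⟩ ⟨h1, h2⟩
    have h3 := (happ μ (hRr h2)).surjOn_closedBall_of_nonlinearRightInverse
      L.toNonlinearRightInverse hρ0.le Subset.rfl
    refine h3 ?_
    rw [Metric.mem_closedBall]
    have h4 : dist (F (u₀, μ)) v₀ < η :=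
      hball' μ (Metric.ball_subset_ball (min_le_right _ _) h2.2) h2.1
    have h5 : dist v v₀ < η := h1
    have h6 : dist v (F (u₀, μ)) ≤ dist v v₀ + dist (F (u₀, μ)) v₀ := dist_triangle_right _ _ _
    have h7 : (((L.toNonlinearRightInverse.nnnorm : ℝ))⁻¹ - c) * ρ = κ * ρ := rfl
    dsimp only
    rw [h7]
    linarith [show η + η = κ * ρ by rw [hη]; ring]
  have hanti : ∀ μ ∈ D ∩ Metric.ball μ₀ r, ∀ u ∈ Metric.closedBall u₀ ρ,
      ∀ u' ∈ Metric.closedBall u₀ ρ,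
      dist u u' ≤ ((N⁻¹ - c)⁻¹ : NNReal) * dist (F (u, μ)) (F (u', μ)) := by
    intro μ hm u hu u' hu'
    exact ((happ μ hm).antilipschitz (Or.inr hcN)).le_mul_dist ⟨u, hu⟩ ⟨u', hu'⟩
  -- The solution in the ball is unique by `hanti`, so the choice is harmless; the value `u₀` is a
  -- dummy used where no solution exists.
  set J : E' × P → E := fun q =>
    if h : ∃ u ∈ Metric.closedBall u₀ ρ, F (u, q.2) = q.1 then h.choose else u₀ with hJ
  have hJmem : ∀ q ∈ B, J q ∈ Metric.closedBall u₀ ρ := fun q hq => by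
    rw [hJ]; dsimp only; rw [dif_pos (hex q hq)]; exact (hex q hq).choose_spec.1
  have hJF : ∀ q ∈ B, F (J q, q.2) = q.1 := fun q hq => by
    rw [hJ]; dsimp only; rw [dif_pos (hex q hq)]; exact (hex q hq).choose_spec.2
  have h0B : (v₀, μ₀) ∈ B :=
    ⟨Metric.mem_ball_self hη0, hμ, Metric.mem_ball_self hR0⟩
  have hJ0 : J (v₀, μ₀) = u₀ := by
    have := hanti μ₀ (hRr h0B.2) _ (hJmem _ h0B) u₀ (Metric.mem_closedBall_self hρ0.le)
    rw [hJF _ h0B, dist_self, mul_zero] at this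
    exact dist_le_zero.1 this
  have hJc : ContinuousOn J B := by
    intro q₁ hq₁
    have h1 : ContinuousWithinAt (fun q : E' × P => F (J q₁, q.2)) B q₁ := by
      have hmem : ∀ q ∈ B, (J q₁, q.2) ∈ A := fun q hq =>
        (hprod _ (hρr (hJmem _ hq₁)) _ (hRr hq.2)).1
      exact ContinuousWithinAt.comp (f := fun q : E' × P => (J q₁, q.2)) (t := A)
        (hF.continuousOn _ (hmem _ hq₁)) (by fun_prop) hmem
    have h2 : Tendsto (fun q : E' × P =>
        ((N⁻¹ - c)⁻¹ : NNReal) * dist q.1 (F (J q₁, q.2))) (𝓝[B] q₁) (𝓝 0) := by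
      have h3 : ContinuousWithinAt (fun q : E' × P =>
        ((N⁻¹ - c)⁻¹ : NNReal) * dist q.1 (F (J q₁, q.2))) B q₁ :=
        continuousWithinAt_const.mul (continuousWithinAt_fst.dist h1)
      rw [ContinuousWithinAt, hJF _ hq₁, dist_self, mul_zero] at h3
      exact h3
    refine tendsto_iff_dist_tendsto_zero.2
        (squeeze_zero' (Eventually.of_forall fun _ => dist_nonneg)
      (eventually_of_mem self_mem_nhdsWithin fun q hq => ?_) h2)
    have := hanti q.2 (hRr hq.2) _ (hJmem _ hq) _ (hJmem _ hq₁)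
    rwa [hJF _ hq] at this
  set A' : Set (E × P) := Metric.ball u₀ r ×ˢ (D ∩ Metric.ball μ₀ r) with hA'
  have hA'A : A' ⊆ A := fun w hw => (hprod w.1 hw.1 w.2 hw.2).1
  have hA'u : UniqueDiffOn ℝ A' :=
    Metric.isOpen_ball.uniqueDiffOn.prod (hD.inter Metric.isOpen_ball)
  have hBu : UniqueDiffOn ℝ B := Metric.isOpen_ball.uniqueDiffOn.prod (hD.inter Metric.isOpen_ball)
  have key : ContDiffOn ℝ ∞ J B := by
    have hFhat : ContDiffOn ℝ ∞ (fun w : E × P => (F w, w.2)) A' :=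
      (hF.mono hA'A).prodMk contDiffOn_snd
    refine (contDiffOn_of_rightInvOn (G := fun q => (J q, q.2)) hFhat hA'u hBu
      (hJc.prodMk continuousOn_snd) (fun q hq => ⟨hρr (hJmem q hq), hRr hq.2⟩)
      (fun q hq => Prod.ext (hJF q hq) rfl) fun q hq => ?_).fst
    have hw : (J q, q.2) ∈ A' := ⟨hρr (hJmem q hq), hRr hq.2⟩
    have hd : DifferentiableWithinAt ℝ F A (J q, q.2) := hF.differentiableOn (by simp) _ (hA'A hw)
    have h1 : HasFDerivWithinAt (fun w : E × P => (F w, w.2))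
        ((fderivWithin ℝ F A (J q, q.2)).prod (ContinuousLinearMap.snd ℝ E P)) A' (J q, q.2) :=
      (hd.hasFDerivWithinAt.mono hA'A).prodMk hasFDerivWithinAt_snd
    rw [h1.fderivWithin (hA'u _ hw)]
    exact isInvertible_prod_snd (hprod _ hw.1 _ hw.2).2.2
  exact ⟨J, hJ0, (key _ h0B).mono_of_mem_nhdsWithin hBnhds,
    mem_of_superset hBnhds fun q hq => hJF q hq⟩

end RelativeInverse

/-! ### Smooth dependence of integrals on parameters. -/

section ParametricIntegral

variable {X : Type} [NormedAddCommGroup X] [NormedSpace ℝ X]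

theorem norm_integral_zero_one_le {G : Type} [NormedAddCommGroup G] [NormedSpace ℝ G] {f : ℝ → G}
    {C : ℝ} (h : ∀ t ∈ Icc (0 : ℝ) 1, ‖f t‖ ≤ C) : ‖∫ t in (0 : ℝ)..1, f t‖ ≤ C := by
  have := intervalIntegral.norm_integral_le_of_norm_le_const (a := (0 : ℝ)) (b := 1) (f := f)
    (C := C) fun t ht => h t (Ioc_subset_Icc_self (by rwa [uIoc_of_le zero_le_one] at ht))
  simpa using this

/-- Differentiation under the integral sign, within a convex set that need not be open. The target
space is quantified inside the induction because the derivative takes values in `X →L[ℝ] G`. -/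
theorem contDiffOn_nat_integral_zero_one {s : Set X} (hs : Convex ℝ s) (hsu : UniqueDiffOn ℝ s)
    (n : ℕ) : ∀ {G : Type} [NormedAddCommGroup G] [NormedSpace ℝ G] [CompleteSpace G]
      {F : X × ℝ → G}, ContDiffOn ℝ n F (s ×ˢ Icc (0 : ℝ) 1) →
      ContDiffOn ℝ n (fun x => ∫ t in (0 : ℝ)..1, F (x, t)) s := by
  have hint : ∀ {G : Type} [NormedAddCommGroup G] [NormedSpace ℝ G]
      {F : X × ℝ → G}, ContinuousOn F (s ×ˢ Icc (0 : ℝ) 1) → ∀ x ∈ s,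
      IntervalIntegrable (fun t => F (x, t)) MeasureTheory.volume 0 1 := by
    intro G _ _ F hF x hx
    refine ContinuousOn.intervalIntegrable ?_
    rw [uIcc_of_le zero_le_one]
    exact hF.comp (by fun_prop) fun t ht => ⟨hx, ht⟩
  have hunif : ∀ {G : Type} [NormedAddCommGroup G] [NormedSpace ℝ G]
      {F : X × ℝ → G}, ContinuousOn F (s ×ˢ Icc (0 : ℝ) 1) → ∀ x₀ ∈ s, ∀ ε > 0,
      ∀ᶠ x in 𝓝[s] x₀, ∀ t ∈ Icc (0 : ℝ) 1, ‖F (x, t) - F (x₀, t)‖ ≤ ε := by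
    intro G _ _ F hF x₀ hx₀ ε hε
    obtain ⟨v, hv, hv'⟩ := isCompact_Icc.mem_uniformity_of_prod (f := fun x t => F (x, t))
      (s := s) (k := Icc (0 : ℝ) 1) hF hx₀ (Metric.dist_mem_uniformity hε)
    filter_upwards [hv] with x hx t ht
    have := hv' x hx t ht
    rw [mem_ofPred_eq, dist_eq_norm] at this
    exact this.le
  induction n with
  | zero =>
    intro G _ _ _ F hF
    rw [CharP.cast_eq_zero, contDiffOn_zero] at hF ⊢
    intro x₀ hx₀
    rw [ContinuousWithinAt, Metric.tendsto_nhds]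
    intro ε hε
    filter_upwards [hunif hF x₀ hx₀ (ε / 2) (half_pos hε), self_mem_nhdsWithin] with x hx hxs
    rw [dist_eq_norm, ← intervalIntegral.integral_sub (hint hF x hxs) (hint hF x₀ hx₀)]
    exact (norm_integral_zero_one_le hx).trans_lt (half_lt_self hε)
  | succ n ih =>
    intro G _ _ _ F hF
    have hu : UniqueDiffOn ℝ (s ×ˢ Icc (0 : ℝ) 1) := hsu.prod (uniqueDiffOn_Icc zero_lt_one)
    rw [show ((n + 1 : ℕ) : ℕ∞ω) = (n : ℕ∞ω) + 1 by push_cast; rfl] at hF ⊢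
    rw [contDiffOn_succ_iff_hasFDerivWithinAt_of_uniqueDiffOn hsu]
    set F' : X × ℝ → X →L[ℝ] G := fun w =>
      (fderivWithin ℝ F (s ×ˢ Icc (0 : ℝ) 1) w).comp (ContinuousLinearMap.inl ℝ X ℝ) with hF'
    have hF'n : ContDiffOn ℝ n F' (s ×ˢ Icc (0 : ℝ) 1) :=
      (hF.fderivWithin hu le_rfl).clm_comp contDiffOn_const
    have hF'd : ∀ x ∈ s, ∀ t ∈ Icc (0 : ℝ) 1,
        HasFDerivWithinAt (fun x => F (x, t)) (F' (x, t)) s x := by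
      intro x hx t ht
      have h1 : HasFDerivWithinAt F (fderivWithin ℝ F (s ×ˢ Icc (0 : ℝ) 1) (x, t))
          (s ×ˢ Icc (0 : ℝ) 1) ((fun x : X => (x, t)) x) :=
        (hF.differentiableOn (by simp) (x, t) ⟨hx, ht⟩).hasFDerivWithinAt
      have h2 : HasFDerivWithinAt (fun x : X => (x, t)) (ContinuousLinearMap.inl ℝ X ℝ) s x :=
        ((hasFDerivAt_id x).prodMk (hasFDerivAt_const t x)).hasFDerivWithinAt
      have h3 : MapsTo (fun x : X => (x, t)) s (s ×ˢ Icc (0 : ℝ) 1) := fun y hy => ⟨hy, ht⟩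
      exact h1.comp x h2 h3
    refine ⟨by simp, fun x => ∫ t in (0 : ℝ)..1, F' (x, t), ih hF'n, fun x₀ hx₀ => ?_⟩
    refine .of_isLittleO (Asymptotics.isLittleO_iff.2 fun c hc => ?_)
    -- Near `x₀` the partial derivative is `c`-close to its value at `x₀` uniformly in `t`. The mean
    -- value inequality on `s` intersected with a ball then bounds the integrand by `c ‖x - x₀‖`.
    have h2 := hunif hF'n.continuousOn x₀ hx₀ c hc
    obtain ⟨r, hr, hball⟩ := Metric.eventually_nhds_iff_ball.1 (eventually_nhdsWithin_iff.1 h2)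
    filter_upwards [self_mem_nhdsWithin, mem_nhdsWithin_of_mem_nhds (Metric.ball_mem_nhds x₀ hr)]
      with x hxs hxr
    have h3 : (∫ t in (0 : ℝ)..1, F' (x₀, t)) (x - x₀) =
        ∫ t in (0 : ℝ)..1, F' (x₀, t) (x - x₀) :=
      ContinuousLinearMap.intervalIntegral_apply (hint hF'n.continuousOn x₀ hx₀) _
    have h4 : IntervalIntegrable (fun t => F' (x₀, t) (x - x₀)) MeasureTheory.volume 0 1 :=
      hint (F := fun w => F' w (x - x₀)) (hF'n.continuousOn.clm_apply continuousOn_const) x₀ hx₀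
    rw [h3, ← intervalIntegral.integral_sub (hint hF.continuousOn x hxs)
      (hint hF.continuousOn x₀ hx₀), ← intervalIntegral.integral_sub
      ((hint hF.continuousOn x hxs).sub (hint hF.continuousOn x₀ hx₀)) h4]
    refine norm_integral_zero_one_le fun t ht => ?_
    exact (hs.inter (convex_ball x₀ r)).norm_image_sub_le_of_norm_hasFDerivWithin_le'
      (f := fun x => F (x, t)) (f' := fun x => F' (x, t))
      (fun y hy => (hF'd y hy.1 t ht).mono inter_subset_left)
      (fun y hy => hball y hy.2 hy.1 t ht) ⟨hx₀, Metric.mem_ball_self hr⟩ ⟨hxs, hxr⟩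

theorem contDiffOn_integral_zero_one {s : Set X} (hs : Convex ℝ s) (hsu : UniqueDiffOn ℝ s)
    {G : Type} [NormedAddCommGroup G] [NormedSpace ℝ G] [CompleteSpace G] {F : X × ℝ → G}
    (hF : ContDiffOn ℝ ∞ F (s ×ˢ Icc (0 : ℝ) 1)) :
    ContDiffOn ℝ ∞ (fun x => ∫ t in (0 : ℝ)..1, F (x, t)) s :=
  contDiffOn_infty.2 fun n => contDiffOn_nat_integral_zero_one hs hsu n (contDiffOn_infty.1 hF n)

end ParametricIntegral

/-! ### Local inverses of families of annuli in a surface. -/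

namespace KAMGrowth

theorem uniqueDiffOn_disk (d : ℕ) : UniqueDiffOn ℝ (disk d) :=
  uniqueDiffOn_convex (convex_closedBall _ _) (by
    rw [interior_closedBall _ one_ne_zero]; exact Metric.nonempty_ball.2 one_pos)

variable {S : Type*} [TopologicalSpace S] [ChartedSpace Plane S]

theorem contMDiffOn_slice [IsManifold (𝓡 2) ∞ S] {d : ℕ}
    {Ψ : (ℝ × ℝ) × Param d → S} {U : Set (ℝ × ℝ)}
    (hΨ : ContMDiffOn 𝓘(ℝ, (ℝ × ℝ) × Param d) (𝓡 2) ∞ Ψ (U ×ˢ disk d))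
    {μ : Param d} (hμ : μ ∈ disk d) :
    ContMDiffOn 𝓘(ℝ, ℝ × ℝ) (𝓡 2) ∞ (fun z => Ψ (z, μ)) U := by
  have h : ContMDiffOn 𝓘(ℝ, ℝ × ℝ) 𝓘(ℝ, (ℝ × ℝ) × Param d) ∞
      (fun z : ℝ × ℝ => (z, μ)) U :=
    ((contDiff_id.prodMk contDiff_const).contMDiff).contMDiffOn
  exact hΨ.comp h fun z hz => ⟨hz, hμ⟩

/-- In a chart around the image point this is `exists_local_inverse_within`: an injective derivative
between two planes is an isomorphism. -/
theorem exists_local_inverse [IsManifold (𝓡 2) ∞ S] {d : ℕ}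
    {Ψ : (ℝ × ℝ) × Param d → S} {U : Set (ℝ × ℝ)} (hU : IsOpen U)
    (hΨ : ContMDiffOn 𝓘(ℝ, (ℝ × ℝ) × Param d) (𝓡 2) ∞ Ψ (U ×ˢ disk d))
    {z₀ : ℝ × ℝ} (hz₀ : z₀ ∈ U) {μ₀ : Param d} (hμ₀ : μ₀ ∈ disk d)
    (hinj : Function.Injective (mfderiv 𝓘(ℝ, ℝ × ℝ) (𝓡 2) (fun z => Ψ (z, μ₀)) z₀)) :
    ∃ J : S × Param d → ℝ × ℝ, J (Ψ (z₀, μ₀), μ₀) = z₀ ∧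
      ContMDiffWithinAt ((𝓡 2).prod 𝓘(ℝ, Param d)) 𝓘(ℝ, ℝ × ℝ) ∞ J (univ ×ˢ disk d)
        (Ψ (z₀, μ₀), μ₀) ∧
      ∀ᶠ q in 𝓝[univ ×ˢ disk d] (Ψ (z₀, μ₀), μ₀), Ψ (J q, q.2) = q.1 := by
  set p₀ := Ψ (z₀, μ₀) with hp₀
  set e := extChartAt (𝓡 2) p₀ with he
  obtain ⟨O, hO, hOe⟩ := (continuousOn_iff'.1 hΨ.continuousOn) _
      (isOpen_extChartAt_source (I := 𝓡 2) p₀)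
  set O' : Set ((ℝ × ℝ) × Param d) := O ∩ U ×ˢ univ with hO'
  have hO'o : IsOpen O' := hO.inter (hU.prod isOpen_univ)
  have hO'U : O' ∩ univ ×ˢ disk d ⊆ U ×ˢ disk d := fun w hw => ⟨hw.1.2.1, hw.2.2⟩
  have hO'e : ∀ w ∈ O' ∩ univ ×ˢ disk d, Ψ w ∈ e.source := fun w hw => by
    have : w ∈ O ∩ U ×ˢ disk d := ⟨hw.1.1, hO'U hw⟩
    rw [← hOe] at this; exact this.1
  have hw₀ : (z₀, μ₀) ∈ O' ∩ univ ×ˢ disk d := by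
    have : (z₀, μ₀) ∈ Ψ ⁻¹' e.source ∩ U ×ˢ disk d := ⟨mem_extChartAt_source p₀, hz₀, hμ₀⟩
    rw [hOe] at this
    exact ⟨⟨this.1, hz₀, trivial⟩, trivial, hμ₀⟩
  set F : (ℝ × ℝ) × Param d → Plane := fun w => e (Ψ w) with hF
  have hFs : ContDiffOn ℝ ∞ F (O' ∩ univ ×ˢ disk d) := by
    rw [← contMDiffOn_iff_contDiffOn]
    refine (contMDiffOn_extChartAt (I := 𝓡 2) (x := p₀)).comp (hΨ.mono hO'U) fun w hw => ?_
    have := hO'e w hw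
    rwa [he, extChartAt_source] at this
  have hΨd : MDifferentiableAt 𝓘(ℝ, ℝ × ℝ) (𝓡 2) (fun z => Ψ (z, μ₀)) z₀ :=
    (((contMDiffOn_slice hΨ hμ₀) z₀ hz₀).contMDiffAt (hU.mem_nhds hz₀)).mdifferentiableAt
      (by simp)
  have hed : MDifferentiableAt (𝓡 2) 𝓘(ℝ, Plane) e (Ψ (z₀, μ₀)) :=
    mdifferentiableAt_extChartAt (mem_chart_source _ p₀)
  have hcomp := hed.hasMFDerivAt.comp z₀ hΨd.hasMFDerivAt
  have hcd := hcomp.hasFDerivAt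
  set T : (ℝ × ℝ) →L[ℝ] Plane := (mfderiv (𝓡 2) 𝓘(ℝ, Plane) e (Ψ (z₀, μ₀))).comp
    (mfderiv 𝓘(ℝ, ℝ × ℝ) (𝓡 2) (fun z => Ψ (z, μ₀)) z₀) with hT
  have hTinj : Function.Injective T := by
    obtain ⟨M, hM⟩ := isInvertible_mfderiv_extChartAt (I := 𝓡 2) (mem_extChartAt_source p₀)
    have h1 : Function.Injective (mfderiv (𝓡 2) 𝓘(ℝ, Plane) e (Ψ (z₀, μ₀))) := by
      rw [← hM]; exact M.injective
    exact h1.comp hinj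
  have hrank : Module.finrank ℝ (ℝ × ℝ) = Module.finrank ℝ Plane := by simp
  set L : (ℝ × ℝ) ≃L[ℝ] Plane :=
    (LinearEquiv.ofInjectiveOfFinrankEq (T : (ℝ × ℝ) →ₗ[ℝ] Plane) hTinj
        hrank).toContinuousLinearEquiv
    with hL
  have hLT : (L : (ℝ × ℝ) →L[ℝ] Plane) = T := by
    ext <;> rfl
  obtain ⟨J, hJ0, hJs, hJF⟩ := exists_local_inverse_within (uniqueDiffOn_disk d) (F := F)
    hμ₀ hO'o hw₀.1 hFs L (by rw [hLT]; exact hcd)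
  have hmap : ContMDiffWithinAt ((𝓡 2).prod 𝓘(ℝ, Param d)) 𝓘(ℝ, Plane × Param d) ∞
      (fun q : S × Param d => (e q.1, q.2)) (univ ×ˢ disk d) (p₀, μ₀) := by
    have h1 : ContMDiffAt (𝓡 2) 𝓘(ℝ, Plane) ∞ e p₀ := contMDiffAt_extChartAt
    have h2 : ContMDiffAt ((𝓡 2).prod 𝓘(ℝ, Param d)) 𝓘(ℝ, Plane) ∞
      (fun q : S × Param d => e q.1) (p₀, μ₀) := h1.comp (p₀, μ₀) contMDiffAt_fst
    exact (h2.prodMk_space contMDiffAt_snd).contMDiffWithinAt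
  have hmapsto : MapsTo (fun q : S × Param d => (e q.1, q.2)) (univ ×ˢ disk d)
      (univ ×ˢ disk d) := fun q hq => ⟨trivial, hq.2⟩
  have hJS : ContMDiffWithinAt ((𝓡 2).prod 𝓘(ℝ, Param d)) 𝓘(ℝ, ℝ × ℝ) ∞
      (fun q : S × Param d => J (e q.1, q.2)) (univ ×ˢ disk d) (p₀, μ₀) :=
    ContMDiffWithinAt.comp (g := J) (p₀, μ₀) hJs.contMDiffWithinAt hmap hmapsto
  refine ⟨fun q => J (e q.1, q.2), hJ0, hJS, ?_⟩
  have htend := hmap.continuousWithinAt.tendsto_nhdsWithin hmapsto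
  have hJt : Tendsto (fun q : S × Param d => (J (e q.1, q.2), q.2)) (𝓝[univ ×ˢ disk d] (p₀, μ₀))
      (𝓝 (z₀, μ₀)) := by
    have := hJS.continuousWithinAt.prodMk
        (continuousWithinAt_snd (s := univ ×ˢ disk d) (p := (p₀, μ₀)))
    rw [ContinuousWithinAt] at this
    convert this using 2
    exact Prod.ext hJ0.symm rfl
  have hsrc : ∀ᶠ q in 𝓝[univ ×ˢ disk d] (p₀, μ₀), q.1 ∈ e.source :=
    (continuousWithinAt_fst (s := univ ×ˢ disk d) (p := (p₀, μ₀))).eventually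
      ((isOpen_extChartAt_source p₀).mem_nhds (mem_extChartAt_source p₀))
  filter_upwards [htend.eventually hJF, hJt.eventually (hO'o.mem_nhds hw₀.1), hsrc,
    self_mem_nhdsWithin] with q h1 h2 h3 h4
  -- The identity was obtained in the chart; it lifts to the surface because both points lie in the
  -- chart domain.
  exact e.injOn (hO'e _ ⟨h2, trivial, h4.2⟩) h3 h1

end KAMGrowth

/-! ### Smooth paths of families are continuous in the `C^∞` topology. -/

theorem contDiffWithinAt_iteratedFDerivWithin_param {X Y : Type} [NormedAddCommGroup X]
    [NormedSpace ℝ X] [NormedAddCommGroup Y] [NormedSpace ℝ Y] {A : Set X}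
    (hA : UniqueDiffOn ℝ A) {G : X × ℝ → Y} {z₀ : X} (hz₀ : z₀ ∈ A) {ε₀ : ℝ}
    (hG : ContDiffWithinAt ℝ ∞ G (A ×ˢ univ) (z₀, ε₀)) (k : ℕ) :
    ContDiffWithinAt ℝ ∞
      (fun w : X × ℝ => iteratedFDerivWithin ℝ k (fun z => G (z, w.2)) A w.1)
      (A ×ˢ univ) (z₀, ε₀) := by
  induction k with
  | zero =>
    simp only [iteratedFDerivWithin_zero_eq_comp]
    exact (continuousMultilinearCurryFin0 ℝ X Y).symm.contDiff.contDiffAt.comp_contDiffWithinAt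
      (z₀, ε₀) hG
  | succ k ih =>
    simp only [iteratedFDerivWithin_succ_eq_comp_left]
    have hI : ContDiff ℝ ∞
        ((continuousMultilinearCurryLeftEquiv ℝ (fun _ : Fin (k + 1) => X) Y).symm :
          (X →L[ℝ] X [×k]→L[ℝ] Y) → (X [×(k + 1)]→L[ℝ] Y)) :=
      LinearIsometryEquiv.contDiff (E := X →L[ℝ] X [×k]→L[ℝ] Y) (F := X [×(k + 1)]→L[ℝ] Y) _
    refine hI.contDiffAt.comp_contDiffWithinAt (z₀, ε₀) ?_
    -- Only `z` is differentiated, with `ε` carried as a parameter; the joint smoothness at the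
    -- previous order is what makes the induction run.
    refine ContDiffWithinAt.fderivWithin (n := ∞) (t := A)
      (f := fun (w : X × ℝ) z => iteratedFDerivWithin ℝ k (fun z => G (z, w.2)) A z)
      (g := Prod.fst) ?_ contDiffWithinAt_fst hA (by simp) ⟨hz₀, trivial⟩ fun w hw => hw.1
    have h : ContDiffWithinAt ℝ ∞ (fun q : (X × ℝ) × X => (q.2, q.1.2))
        ((A ×ˢ univ) ×ˢ A) ((z₀, ε₀), z₀) := by fun_prop
    have hm : MapsTo (fun q : (X × ℝ) × X => (q.2, q.1.2)) ((A ×ˢ univ) ×ˢ A)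
        (A ×ˢ (univ : Set ℝ)) := fun q hq => ⟨hq.2, trivial⟩
    exact ContDiffWithinAt.comp (x := ((z₀, ε₀), z₀)) ih h hm

namespace KAMGrowth

variable {S : Type*} [TopologicalSpace S] [ChartedSpace Plane S] [IsManifold (𝓡 2) ∞ S]
  {Ω : AreaForm S} {d : ℕ}

/-- The map `((p, μ), ε) ↦ F_{ε,μ}(p)` is smooth. -/
def IsSmoothPath (F : ℝ → Family Ω d) : Prop :=
  ContMDiffOn (((𝓡 2).prod 𝓘(ℝ, Param d)).prod 𝓘(ℝ, ℝ)) (𝓡 2) ∞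
    (fun q : (S × Param d) × ℝ => (F q.2).eval q.1) ((univ ×ˢ disk d) ×ˢ univ)

theorem isSmoothPath_const (f : Family Ω d) : IsSmoothPath fun _ => f := by
  have h : ContMDiffOn (((𝓡 2).prod 𝓘(ℝ, Param d)).prod 𝓘(ℝ, ℝ)) ((𝓡 2).prod 𝓘(ℝ, Param d)) ∞
      (Prod.fst : (S × Param d) × ℝ → S × Param d) ((univ ×ˢ disk d) ×ˢ univ) := contMDiffOn_fst
  exact ContMDiffOn.comp (g := f.eval) f.smooth h fun q hq => hq.1

theorem IsSmoothPath.continuousWithinAt_iteratedFDerivWithin {F : ℝ → Family Ω d}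
    (hF : IsSmoothPath F) {e e' : OpenPartialHomeomorph S Plane}
    (he : e ∈ IsManifold.maximalAtlas (𝓡 2) ∞ S) (he' : e' ∈ IsManifold.maximalAtlas (𝓡 2) ∞ S)
    {q₀ : S × Param d} (hq₀ : q₀ ∈ e.source ×ˢ disk d) {ε₀ : ℝ}
    (hq₀' : (F ε₀).eval q₀ ∈ e'.source) (k : ℕ) :
    ContinuousWithinAt (fun w : (S × Param d) × ℝ =>
      iteratedFDerivWithin ℝ k ((F w.2).coord e e') (e.target ×ˢ disk d) (e w.1.1, w.1.2))
      ((e.source ×ˢ disk d) ×ˢ univ) (q₀, ε₀) := by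
  have hA : UniqueDiffOn ℝ (e.target ×ˢ disk d) := e.open_target.uniqueDiffOn.prod
      (uniqueDiffOn_disk d)
  have hz₀ : (e q₀.1, q₀.2) ∈ e.target ×ˢ disk d := ⟨e.map_source hq₀.1, hq₀.2⟩
  set G : (Plane × Param d) × ℝ → Plane := fun w => (F w.2).coord e e' w.1 with hG
  have hGs : ContDiffWithinAt ℝ ∞ G ((e.target ×ˢ disk d) ×ˢ univ) ((e q₀.1, q₀.2), ε₀) := by
    rw [← contMDiffWithinAt_iff_contDiffWithinAt]
    have h1 : ContMDiffWithinAt 𝓘(ℝ, (Plane × Param d) × ℝ)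
        (((𝓡 2).prod 𝓘(ℝ, Param d)).prod 𝓘(ℝ, ℝ)) ∞
        (fun w : (Plane × Param d) × ℝ => ((e.symm w.1.1, w.1.2), w.2))
        ((e.target ×ˢ disk d) ×ˢ univ) ((e q₀.1, q₀.2), ε₀) := by
      have h2 : ContMDiffWithinAt 𝓘(ℝ, (Plane × Param d) × ℝ) 𝓘(ℝ, Plane) ∞
          (fun w : (Plane × Param d) × ℝ => w.1.1) ((e.target ×ˢ disk d) ×ˢ univ)
          ((e q₀.1, q₀.2), ε₀) :=
        (contDiff_fst.comp contDiff_fst).contMDiff.contMDiffAt.contMDiffWithinAt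
      have h3 : ContMDiffWithinAt 𝓘(ℝ, (Plane × Param d) × ℝ) 𝓘(ℝ, Param d) ∞
          (fun w : (Plane × Param d) × ℝ => w.1.2) ((e.target ×ˢ disk d) ×ˢ univ)
          ((e q₀.1, q₀.2), ε₀) :=
        (contDiff_snd.comp contDiff_fst).contMDiff.contMDiffAt.contMDiffWithinAt
      have h4 : ContMDiffWithinAt 𝓘(ℝ, (Plane × Param d) × ℝ) 𝓘(ℝ, ℝ) ∞
          (fun w : (Plane × Param d) × ℝ => w.2) ((e.target ×ˢ disk d) ×ˢ univ)
          ((e q₀.1, q₀.2), ε₀) :=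
        contDiff_snd.contMDiff.contMDiffAt.contMDiffWithinAt
      have h5 := (contMDiffOn_symm_of_mem_maximalAtlas he) (e q₀.1) hz₀.1
      exact ((ContMDiffWithinAt.comp (g := e.symm) ((e q₀.1, q₀.2), ε₀) h5 h2
        fun w hw => hw.1.1).prodMk h3).prodMk h4
    have hval : (e.symm (e q₀.1), q₀.2) = q₀ := Prod.ext (e.left_inv hq₀.1) rfl
    have h6 := hF ((e.symm (e q₀.1), q₀.2), ε₀) ⟨⟨trivial, hq₀.2⟩, trivial⟩
    have hm : MapsTo (fun w : (Plane × Param d) × ℝ => ((e.symm w.1.1, w.1.2), w.2))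
        ((e.target ×ˢ disk d) ×ˢ univ) (((univ : Set S) ×ˢ disk d) ×ˢ (univ : Set ℝ)) :=
      fun w hw => ⟨⟨trivial, hw.1.2⟩, trivial⟩
    have h7 := ContMDiffWithinAt.comp (g := fun q : (S × Param d) × ℝ => (F q.2).eval q.1)
      ((e q₀.1, q₀.2), ε₀) h6 h1 hm
    have h8 : ContMDiffAt (𝓡 2) 𝓘(ℝ, Plane) ∞ e' ((F ε₀).eval (e.symm (e q₀.1), q₀.2)) := by
      rw [hval]
      exact contMDiffAt_of_mem_maximalAtlas he' hq₀'
    exact ContMDiffAt.comp_contMDiffWithinAt (g := e') ((e q₀.1, q₀.2), ε₀) h8 h7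
  have h9 := (contDiffWithinAt_iteratedFDerivWithin_param hA hz₀ hGs k).continuousWithinAt
  have h10 : ContinuousWithinAt (fun w : (S × Param d) × ℝ => ((e w.1.1, w.1.2), w.2))
      ((e.source ×ˢ disk d) ×ˢ univ) (q₀, ε₀) := by
    have h11 : ContinuousWithinAt e e.source q₀.1 := e.continuousOn _ hq₀.1
    have h12 : ContinuousWithinAt (fun w : (S × Param d) × ℝ => e w.1.1)
        ((e.source ×ˢ disk d) ×ˢ univ) (q₀, ε₀) :=
      ContinuousWithinAt.comp (g := e) (t := e.source) h11 (by fun_prop) fun w hw => hw.1.1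
    exact (h12.prodMk (by fun_prop)).prodMk (by fun_prop)
  have hm : MapsTo (fun w : (S × Param d) × ℝ => ((e w.1.1, w.1.2), w.2))
      ((e.source ×ˢ disk d) ×ˢ univ) ((e.target ×ˢ disk d) ×ˢ (univ : Set ℝ)) :=
    fun w hw => ⟨⟨e.map_source hw.1.1, hw.1.2⟩, trivial⟩
  exact ContinuousWithinAt.comp (x := (q₀, ε₀)) h9 h10 hm

theorem IsSmoothPath.eventually_near {F : ℝ → Family Ω d} (hF : IsSmoothPath F) (ε₀ : ℝ)
    {f' : Family Ω d} {e e' : OpenPartialHomeomorph S Plane} {K : Set (S × Param d)} {r : ℕ} {δ : ℝ}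
    (he : e ∈ IsManifold.maximalAtlas (𝓡 2) ∞ S) (he' : e' ∈ IsManifold.maximalAtlas (𝓡 2) ∞ S)
    (hKe : K ⊆ e.source ×ˢ disk d) (hf' : ∀ q ∈ K, f'.eval q ∈ e'.source)
    {q : S × Param d} (hq : q ∈ K) (h1 : (F ε₀).eval q ∈ e'.source)
    (h2 : ∀ k ≤ r, ‖iteratedFDerivWithin ℝ k ((F ε₀).coord e e') (e.target ×ˢ disk d) (e q.1, q.2) -
      iteratedFDerivWithin ℝ k (f'.coord e e') (e.target ×ˢ disk d) (e q.1, q.2)‖ < δ) :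
    ∀ᶠ w in 𝓝[K ×ˢ univ] (q, ε₀), (F w.2).eval w.1 ∈ e'.source ∧ ∀ k ≤ r,
      ‖iteratedFDerivWithin ℝ k ((F w.2).coord e e') (e.target ×ˢ disk d) (e w.1.1, w.1.2) -
      iteratedFDerivWithin ℝ k (f'.coord e e') (e.target ×ˢ disk d) (e w.1.1, w.1.2)‖ < δ := by
  have hsub : K ×ˢ (univ : Set ℝ) ⊆ (e.source ×ˢ disk d) ×ˢ univ :=
    prod_mono hKe Subset.rfl
  have h3 : ∀ᶠ w in 𝓝[K ×ˢ univ] (q, ε₀), (F w.2).eval w.1 ∈ e'.source := by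
    have := (hF (q, ε₀) ⟨⟨trivial, (hKe hq).2⟩, trivial⟩).continuousWithinAt
    exact (this.mono fun w hw => ⟨⟨trivial, (hKe hw.1).2⟩, trivial⟩).eventually
      (e'.open_source.mem_nhds h1)
  refine h3.and ((finite_le_nat r).eventually_all.2 fun k hk => ?_)
  have h5 := (hF.continuousWithinAt_iteratedFDerivWithin he he' (hKe hq) h1 k).mono hsub
  have h6 := ((isSmoothPath_const f').continuousWithinAt_iteratedFDerivWithin he he'
    (hKe hq) (ε₀ := ε₀) (hf' q hq) k).mono hsub
  exact (h5.sub h6).norm.eventually (gt_mem_nhds (h2 k hk))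

/-- Near each point of `K` the finitely many strict inequalities of a basic neighbourhood persist
for nearby points and times, because the derivatives in charts are jointly continuous. Compactness
of `K` then gives one time interval valid on all of `K`. -/
theorem IsSmoothPath.tendsto {F : ℝ → Family Ω d} (hF : IsSmoothPath F) (ε₀ : ℝ) :
    Tendsto F (𝓝 ε₀) (𝓝 (F ε₀)) := by
  refine TopologicalSpace.tendsto_nhds_generateFrom_iff.2 ?_
  rintro U ⟨f', e, e', K, r, δ, he, he', hK, hKe, hf', hδ, rfl⟩ hU
  have hmem : {w : (S × Param d) × ℝ | w.1 ∈ K → (F w.2).eval w.1 ∈ e'.source ∧ ∀ k ≤ r,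
    ‖iteratedFDerivWithin ℝ k ((F w.2).coord e e') (e.target ×ˢ disk d) (e w.1.1, w.1.2) -
      iteratedFDerivWithin ℝ k (f'.coord e e') (e.target ×ˢ disk d) (e w.1.1, w.1.2)‖ < δ} ∈
      𝓝ˢ K ×ˢ 𝓝 ε₀ := by
    refine hK.mem_nhdsSet_prod_of_forall fun q hq => ?_
    rw [← nhds_prod_eq]
    have h5 := hF.eventually_near ε₀ he he' hKe hf' hq (hU q hq).1 (hU q hq).2
    filter_upwards [eventually_nhdsWithin_iff.1 h5] with w hw hwK
    exact hw ⟨hwK, trivial⟩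
  obtain ⟨t, ht, t', ht', htt⟩ := mem_prod_iff.1 hmem
  refine mem_of_superset ht' fun ε hε => ?_
  change F ε ∈ f'.basicNhd e e' K r δ
  intro q hq
  have hw : ((q, ε) : (S × Param d) × ℝ) ∈ t ×ˢ t' := ⟨subset_of_mem_nhdsSet ht hq, hε⟩
  exact (htt hw) hq

end KAMGrowth

/-! ### Transplanting strip flows to the surface. -/

namespace KAMGrowth

/-- The standard area form of the plane. -/
noncomputable def areaDet (v w : ℝ × ℝ) : ℝ := v.1 * w.2 - v.2 * w.1

/-- The universal cover of the open annulus of half-width `δ`. -/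
abbrev strip (δ : ℝ) : Set (ℝ × ℝ) := univ ×ˢ Ioo (-δ) δ

theorem isOpen_strip (δ : ℝ) : IsOpen (strip δ) := isOpen_univ.prod isOpen_Ioo

theorem mem_strip {δ : ℝ} {z : ℝ × ℝ} : z ∈ strip δ ↔ |z.2| < δ := by
  simp [strip, abs_lt]

variable {S : Type*} [TopologicalSpace S] [ChartedSpace Plane S] [IsManifold (𝓡 2) ∞ S]

/-- The value of an area form, with tangent vectors regarded as vectors of the model plane. -/
noncomputable def AreaForm.val (Ω : AreaForm S) (p : S) (v w : Plane) : ℝ := Ω.form p v w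

/-- The derivative of `z ↦ Ψ(z, μ)`. -/
noncomputable def sliceDeriv {d : ℕ} (Ψ : (ℝ × ℝ) × Param d → S) (μ : Param d) (z : ℝ × ℝ) :
    (ℝ × ℝ) →L[ℝ] Plane :=
  mfderiv 𝓘(ℝ, ℝ × ℝ) (𝓡 2) (fun z => Ψ (z, μ)) z

/-- A family of embedded annuli (read on the universal cover) in which the area form is a constant
multiple of the standard one. -/
structure IsAreaAnnulus (Ω : AreaForm S) {d : ℕ} (Ψ : (ℝ × ℝ) × Param d → S) (δ σ : ℝ) : Prop where
  pos : 0 < δ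
  ne_zero : σ ≠ 0
  smooth : ContMDiffOn 𝓘(ℝ, (ℝ × ℝ) × Param d) (𝓡 2) ∞ Ψ (strip δ ×ˢ disk d)
  eq_iff : ∀ μ ∈ disk d, ∀ z ∈ strip δ, ∀ z' ∈ strip δ,
    Ψ (z, μ) = Ψ (z', μ) ↔ ∃ k : ℤ, z' = (z.1 + k, z.2)
  area : ∀ μ ∈ disk d, ∀ z ∈ strip δ, ∀ v w,
    Ω.val (Ψ (z, μ)) (sliceDeriv Ψ μ z v) (sliceDeriv Ψ μ z w) = σ * areaDet v w

/-- A smooth one-parameter group of area-preserving maps of the plane that commute with the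
unit horizontal translation and are supported in a closed strip of half-width less than `δ`. -/
structure IsStripFlow (φ : ℝ → ℝ × ℝ → ℝ × ℝ) (δ : ℝ) : Prop where
  smooth : ContDiff ℝ ∞ (fun w : ℝ × (ℝ × ℝ) => φ w.1 w.2)
  zero : ∀ z, φ 0 z = z
  add : ∀ s t z, φ (s + t) z = φ s (φ t z)
  translate : ∀ t (z : ℝ × ℝ) (k : ℤ), φ t (z.1 + k, z.2) = ((φ t z).1 + k, (φ t z).2)
  support : ∃ δ' < δ, ∀ t (z : ℝ × ℝ), δ' ≤ |z.2| → φ t z = z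
  area : ∀ t z v w, areaDet (fderiv ℝ (φ t) z v) (fderiv ℝ (φ t) z w) = areaDet v w

/-- Points outside are fixed, so a point that left the strip could not come back under `φ (-t)`. -/
theorem IsStripFlow.mem_strip {φ : ℝ → ℝ × ℝ → ℝ × ℝ} {δ : ℝ} (hφ : IsStripFlow φ δ) (t : ℝ)
    {z : ℝ × ℝ} (hz : z ∈ strip δ) : φ t z ∈ strip δ := by
  obtain ⟨δ', hδ', h⟩ := hφ.support
  by_contra hn
  rw [KAMGrowth.mem_strip, not_lt] at hn
  have h1 := h (-t) (φ t z) (hδ'.le.trans hn)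
  rw [← hφ.add, neg_add_cancel, hφ.zero] at h1
  rw [← h1] at hn
  exact absurd (KAMGrowth.mem_strip.1 hz) (not_lt.2 hn)

theorem IsStripFlow.contDiff {φ : ℝ → ℝ × ℝ → ℝ × ℝ} {δ : ℝ} (hφ : IsStripFlow φ δ) (t : ℝ) :
    ContDiff ℝ ∞ (φ t) :=
  hφ.smooth.comp (contDiff_const.prodMk contDiff_id)

variable {Ω : AreaForm S} {d : ℕ} {Ψ : (ℝ × ℝ) × Param d → S} {δ σ : ℝ}

namespace IsAreaAnnulus

/-- A kernel vector would pair to zero with every vector under `σ • areaDet`, which is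
nondegenerate. -/
theorem injective_sliceDeriv (hΨ : IsAreaAnnulus Ω Ψ δ σ) {μ : Param d} (hμ : μ ∈ disk d)
    {z : ℝ × ℝ} (hz : z ∈ strip δ) : Function.Injective (sliceDeriv Ψ μ z) := by
  rw [injective_iff_map_eq_zero]
  intro v hv
  have h : ∀ w, areaDet v w = 0 := fun w => by
    have h1 := hΨ.area μ hμ z hz v w
    rw [hv] at h1
    have h2 : Ω.val (Ψ (z, μ)) 0 (sliceDeriv Ψ μ z w) = 0 := by
      simp only [AreaForm.val]
      exact congrArg (fun A : Plane →L[ℝ] ℝ => A (sliceDeriv Ψ μ z w))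
          (map_zero (Ω.form (Ψ (z, μ))))
    rw [h2] at h1
    exact (mul_eq_zero.1 h1.symm).resolve_left hΨ.ne_zero
  have h1 := h (0, 1)
  have h2 := h (1, 0)
  simp only [areaDet, mul_one, mul_zero, sub_zero, zero_sub, neg_eq_zero] at h1 h2
  exact Prod.ext h1 h2

theorem surjective_sliceDeriv (hΨ : IsAreaAnnulus Ω Ψ δ σ) {μ : Param d} (hμ : μ ∈ disk d)
    {z : ℝ × ℝ} (hz : z ∈ strip δ) : Function.Surjective (sliceDeriv Ψ μ z) :=
  (LinearMap.injective_iff_surjective_of_finrank_eq_finrank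
    (f := (sliceDeriv Ψ μ z : (ℝ × ℝ) →ₗ[ℝ] Plane)) (by simp)).1 (hΨ.injective_sliceDeriv hμ hz)

theorem hasMFDerivAt (hΨ : IsAreaAnnulus Ω Ψ δ σ) {μ : Param d} (hμ : μ ∈ disk d)
    {z : ℝ × ℝ} (hz : z ∈ strip δ) :
    HasMFDerivAt 𝓘(ℝ, ℝ × ℝ) (𝓡 2) (fun z => Ψ (z, μ)) z (sliceDeriv Ψ μ z) :=
  (((contMDiffOn_slice hΨ.smooth hμ z hz).contMDiffAt
    ((isOpen_strip δ).mem_nhds hz)).mdifferentiableAt (by simp)).hasMFDerivAt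

end IsAreaAnnulus

open Classical in
/-- The map of the surface which is `φ t` in the annulus `Ψ(·, μ)` and the identity outside. -/
noncomputable def transplant (Ψ : (ℝ × ℝ) × Param d → S) (δ : ℝ) (φ : ℝ → ℝ × ℝ → ℝ × ℝ) (t : ℝ)
    (μ : Param d)
    (p : S) : S :=
  if h : ∃ z ∈ strip δ, Ψ (z, μ) = p then Ψ (φ t h.choose, μ) else p

section Transplant

variable {φ : ℝ → ℝ × ℝ → ℝ × ℝ}

/-- The chosen preimage differs from `z` by an integer translation, with which the flow commutes. -/
theorem transplant_apply (hΨ : IsAreaAnnulus Ω Ψ δ σ) (hφ : IsStripFlow φ δ) (t : ℝ)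
    {μ : Param d} (hμ : μ ∈ disk d) {z : ℝ × ℝ} (hz : z ∈ strip δ) :
    transplant Ψ δ φ t μ (Ψ (z, μ)) = Ψ (φ t z, μ) := by
  have h : ∃ z' ∈ strip δ, Ψ (z', μ) = Ψ (z, μ) := ⟨z, hz, rfl⟩
  rw [transplant, dif_pos h]
  obtain ⟨h1, h2⟩ := h.choose_spec
  obtain ⟨k, hk⟩ := (hΨ.eq_iff μ hμ z hz _ h1).1 h2.symm
  rw [hk, hφ.translate]
  have h3 := hφ.mem_strip t hz
  exact ((hΨ.eq_iff μ hμ _ h3 ((φ t z).1 + k, (φ t z).2) ⟨trivial, h3.2⟩).2 ⟨k, rfl⟩).symm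

theorem transplant_of_not_mem {X : Type*} {Ψ : (ℝ × ℝ) × Param d → X} (t : ℝ) {μ : Param d} {p : X}
    (h : ¬ ∃ z ∈ strip δ, Ψ (z, μ) = p) : transplant Ψ δ φ t μ p = p := dif_neg h

theorem transplant_zero (hΨ : IsAreaAnnulus Ω Ψ δ σ) (hφ : IsStripFlow φ δ)
    {μ : Param d} (hμ : μ ∈ disk d) (p : S) : transplant Ψ δ φ 0 μ p = p := by
  by_cases h : ∃ z ∈ strip δ, Ψ (z, μ) = p
  · obtain ⟨z, hz, rfl⟩ := h
    rw [transplant_apply hΨ hφ 0 hμ hz, hφ.zero]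
  · exact transplant_of_not_mem 0 h

theorem transplant_add (hΨ : IsAreaAnnulus Ω Ψ δ σ) (hφ : IsStripFlow φ δ) (s t : ℝ)
    {μ : Param d} (hμ : μ ∈ disk d) (p : S) :
    transplant Ψ δ φ (s + t) μ p = transplant Ψ δ φ s μ (transplant Ψ δ φ t μ p) := by
  by_cases h : ∃ z ∈ strip δ, Ψ (z, μ) = p
  · obtain ⟨z, hz, rfl⟩ := h
    rw [transplant_apply hΨ hφ _ hμ hz, transplant_apply hΨ hφ _ hμ hz,
      transplant_apply hΨ hφ _ hμ (hφ.mem_strip t hz), hφ.add]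
  · rw [transplant_of_not_mem _ h, transplant_of_not_mem _ h, transplant_of_not_mem _ h]

/-- The flow moves only points of a closed narrower annulus. One period of it, times the parameter
disk, is compact, so its image in `S × Param d` is closed and misses a neighbourhood of `(p, μ)`.
This makes the extension by the identity smooth. -/
theorem eventually_transplant_eq_self [T2Space S] (hΨ : IsAreaAnnulus Ω Ψ δ σ)
    (hφ : IsStripFlow φ δ) {μ : Param d} {p : S}
    (h : ¬ ∃ z ∈ strip δ, Ψ (z, μ) = p) :
    ∀ᶠ q in 𝓝[univ ×ˢ disk d] (p, μ), ∀ t, transplant Ψ δ φ t q.2 q.1 = q.1 := by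
  obtain ⟨δ', hδ', hsupp⟩ := hφ.support
  set K : Set ((ℝ × ℝ) × Param d) := (Icc 0 1 ×ˢ Icc (-δ') δ') ×ˢ disk d with hK
  have hKs : K ⊆ strip δ ×ˢ disk d := by
    rintro ⟨z, ν⟩ ⟨⟨_, h1⟩, h2⟩
    exact ⟨⟨trivial, by dsimp only at h1; linarith [h1.1], by dsimp only at h1; linarith [h1.2]⟩,
        h2⟩
  have hKc : IsCompact K := (isCompact_Icc.prod isCompact_Icc).prod (isCompact_closedBall 0 1)
  have hC : IsCompact ((fun w : (ℝ × ℝ) × Param d => (Ψ w, w.2)) '' K) :=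
    hKc.image_of_continuousOn ((hΨ.smooth.continuousOn.mono hKs).prodMk continuousOn_snd)
  have hn : (p, μ) ∉ (fun w : (ℝ × ℝ) × Param d => (Ψ w, w.2)) '' K := by
    rintro ⟨w, hw, hw'⟩
    have h1 : Ψ w = p := congrArg Prod.fst hw'
    have h2 : w.2 = μ := congrArg Prod.snd hw'
    exact h ⟨w.1, (hKs hw).1, by rw [← h2]; exact h1⟩
  filter_upwards [self_mem_nhdsWithin, mem_nhdsWithin_of_mem_nhds
      (hC.isClosed.isOpen_compl.mem_nhds hn)]
    with q hqd hq t
  by_cases hq' : ∃ z ∈ strip δ, Ψ (z, q.2) = q.1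
  · obtain ⟨z, hz, hzq⟩ := hq'
    rw [← hzq, transplant_apply hΨ hφ t hqd.2 hz]
    rcases le_or_gt δ' |z.2| with h1 | h1
    · rw [hsupp t z h1]
    · exfalso
      have h2 : Ψ (z, q.2) = Ψ ((Int.fract z.1, z.2), q.2) :=
        (hΨ.eq_iff q.2 hqd.2 z hz (Int.fract z.1, z.2) ⟨trivial, hz.2⟩).2 ⟨-⌊z.1⌋,
          Prod.ext (by push_cast; exact sub_eq_add_neg _ _) rfl⟩
      refine hq ⟨((Int.fract z.1, z.2), q.2),
        ⟨⟨⟨Int.fract_nonneg _, (Int.fract_lt_one _).le⟩, abs_le.1 h1.le⟩, hqd.2⟩, ?_⟩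
      dsimp only
      rw [← h2, hzq]
  · exact transplant_of_not_mem t hq'

/-- Inside the annulus the map is locally `Ψ ∘ φ ∘ J` with `J` a smooth local inverse of `Ψ`; at
every other point it is locally the identity. -/
theorem contMDiffOn_transplant [T2Space S] (hΨ : IsAreaAnnulus Ω Ψ δ σ) (hφ : IsStripFlow φ δ) :
    ContMDiffOn (((𝓡 2).prod 𝓘(ℝ, Param d)).prod 𝓘(ℝ, ℝ)) (𝓡 2) ∞
      (fun q : (S × Param d) × ℝ => transplant Ψ δ φ q.2 q.1.2 q.1.1)
      ((univ ×ˢ disk d) ×ˢ univ) := by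
  rintro ⟨⟨p, μ⟩, t⟩ ⟨⟨_, hμ⟩, _⟩
  have hfst : Tendsto (Prod.fst : (S × Param d) × ℝ → S × Param d)
      (𝓝[(univ ×ˢ disk d) ×ˢ univ] ((p, μ), t)) (𝓝[univ ×ˢ disk d] (p, μ)) :=
    continuousWithinAt_fst.tendsto_nhdsWithin fun q hq => hq.1
  by_cases h : ∃ z ∈ strip δ, Ψ (z, μ) = p
  · obtain ⟨z, hz, rfl⟩ := h
    obtain ⟨J, hJ0, hJs, hJ⟩ := exists_local_inverse (isOpen_strip δ) hΨ.smooth hz hμ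
      (hΨ.injective_sliceDeriv hμ hz)
    have hJm : ∀ᶠ q in 𝓝[univ ×ˢ disk d] (Ψ (z, μ), μ), J q ∈ strip δ :=
      hJs.continuousWithinAt.eventually ((isOpen_strip δ).mem_nhds (by rwa [hJ0]))
    have hev : ∀ᶠ q in 𝓝[(univ ×ˢ disk d) ×ˢ univ] ((Ψ (z, μ), μ), t),
        transplant Ψ δ φ q.2 q.1.2 q.1.1 = Ψ (φ q.2 (J q.1), q.1.2) := by
      filter_upwards [hfst.eventually hJ, hfst.eventually hJm, self_mem_nhdsWithin] with q h1 h2 h3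
      conv_lhs => rw [← h1]
      rw [transplant_apply hΨ hφ _ h3.1.2 h2]
    refine ContMDiffWithinAt.congr_of_eventuallyEq ?_ hev
      (hev.self_of_nhdsWithin ⟨⟨trivial, hμ⟩, trivial⟩)
    have h1 : ContMDiffWithinAt (((𝓡 2).prod 𝓘(ℝ, Param d)).prod 𝓘(ℝ, ℝ)) 𝓘(ℝ, ℝ × ℝ) ∞
        (fun q : (S × Param d) × ℝ => J q.1) ((univ ×ˢ disk d) ×ˢ univ) ((Ψ (z, μ), μ), t) :=
      ContMDiffWithinAt.comp (g := J) ((Ψ (z, μ), μ), t) hJs contMDiffWithinAt_fst fun q hq => hq.1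
    have h2 : ContMDiffWithinAt (((𝓡 2).prod 𝓘(ℝ, Param d)).prod 𝓘(ℝ, ℝ)) 𝓘(ℝ, ℝ × (ℝ × ℝ)) ∞
        (fun q : (S × Param d) × ℝ => (q.2, J q.1)) ((univ ×ˢ disk d) ×ˢ univ)
        ((Ψ (z, μ), μ), t) :=
      contMDiffWithinAt_snd.prodMk_space h1
    have h3 : ContMDiffWithinAt (((𝓡 2).prod 𝓘(ℝ, Param d)).prod 𝓘(ℝ, ℝ)) 𝓘(ℝ, ℝ × ℝ) ∞
        (fun q : (S × Param d) × ℝ => φ q.2 (J q.1)) ((univ ×ˢ disk d) ×ˢ univ)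
        ((Ψ (z, μ), μ), t) :=
      ContMDiffAt.comp_contMDiffWithinAt (g := fun w : ℝ × (ℝ × ℝ) => φ w.1 w.2)
        ((Ψ (z, μ), μ), t) hφ.smooth.contMDiff.contMDiffAt h2
    have h4 : ContMDiffWithinAt (((𝓡 2).prod 𝓘(ℝ, Param d)).prod 𝓘(ℝ, ℝ)) 𝓘(ℝ, Param d) ∞
        (fun q : (S × Param d) × ℝ => q.1.2) ((univ ×ˢ disk d) ×ˢ univ)
        ((Ψ (z, μ), μ), t) :=
      ContMDiffWithinAt.comp (g := Prod.snd) (t := univ) ((Ψ (z, μ), μ), t) contMDiffWithinAt_snd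
        contMDiffWithinAt_fst fun q hq => trivial
    have h5 := h3.prodMk_space h4
    have h6 : ContMDiffWithinAt 𝓘(ℝ, (ℝ × ℝ) × Param d) (𝓡 2) ∞ Ψ (strip δ ×ˢ disk d)
        (φ t (J (Ψ (z, μ), μ)), μ) := by
      rw [hJ0]; exact hΨ.smooth _ ⟨hφ.mem_strip t hz, hμ⟩
    refine (ContMDiffWithinAt.comp' (g := Ψ) ((Ψ (z, μ), μ), t) h6 h5).mono_of_mem_nhdsWithin
      (inter_mem self_mem_nhdsWithin ?_)
    filter_upwards [hfst.eventually hJm, self_mem_nhdsWithin] with q h1 h2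
    exact ⟨hφ.mem_strip _ h1, h2.1.2⟩
  · have hev := hfst.eventually (eventually_transplant_eq_self hΨ hφ h)
    have h1 : ContMDiffWithinAt (((𝓡 2).prod 𝓘(ℝ, Param d)).prod 𝓘(ℝ, ℝ)) (𝓡 2) ∞
        (fun q : (S × Param d) × ℝ => q.1.1) ((univ ×ˢ disk d) ×ˢ univ) ((p, μ), t) :=
      ContMDiffWithinAt.comp (g := Prod.fst) (t := univ) ((p, μ), t) contMDiffWithinAt_fst
        contMDiffWithinAt_fst fun q hq => trivial
    exact h1.congr_of_eventuallyEq (hev.mono fun q hq => hq q.2) (transplant_of_not_mem t h)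

theorem contMDiff_transplant [T2Space S] (hΨ : IsAreaAnnulus Ω Ψ δ σ) (hφ : IsStripFlow φ δ)
    (t : ℝ) {μ : Param d} (hμ : μ ∈ disk d) :
    ContMDiff (𝓡 2) (𝓡 2) ∞ (transplant Ψ δ φ t μ) := by
  have h1 : ContMDiff (𝓡 2) (((𝓡 2).prod 𝓘(ℝ, Param d)).prod 𝓘(ℝ, ℝ)) ∞
      (fun p : S => ((p, μ), t)) :=
    (contMDiff_id.prodMk contMDiff_const).prodMk contMDiff_const
  exact (contMDiffOn_transplant hΨ hφ).comp_contMDiff h1 fun p => ⟨⟨trivial, hμ⟩, trivial⟩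

/-- The diffeomorphism of the surface which is `φ t` in the annulus `Ψ(·, μ)` and the identity
outside. -/
noncomputable def transplantDiffeo [T2Space S] (hΨ : IsAreaAnnulus Ω Ψ δ σ) (hφ : IsStripFlow φ δ)
    (t : ℝ)
    (μ : disk d) : S ≃ₘ⟮𝓡 2, 𝓡 2⟯ S where
  toFun := transplant Ψ δ φ t μ
  invFun := transplant Ψ δ φ (-t) μ
  left_inv p := by
    rw [← transplant_add hΨ hφ _ _ μ.2, neg_add_cancel, transplant_zero hΨ hφ μ.2]
  right_inv p := by
    rw [← transplant_add hΨ hφ _ _ μ.2, add_neg_cancel, transplant_zero hΨ hφ μ.2]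
  contMDiff_toFun := contMDiff_transplant hΨ hφ t μ.2
  contMDiff_invFun := contMDiff_transplant hΨ hφ (-t) μ.2

/-- Obtained by differentiating the conjugacy `transplant ∘ Ψ = Ψ ∘ φ`. -/
theorem mfderiv_transplant [T2Space S] (hΨ : IsAreaAnnulus Ω Ψ δ σ) (hφ : IsStripFlow φ δ) (t : ℝ)
    {μ : Param d} (hμ : μ ∈ disk d) {z : ℝ × ℝ} (hz : z ∈ strip δ) (v : ℝ × ℝ) :
    (mfderiv (𝓡 2) (𝓡 2) (transplant Ψ δ φ t μ) (Ψ (z, μ)) : Plane →L[ℝ] Plane)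
      (sliceDeriv Ψ μ z v) = sliceDeriv Ψ μ (φ t z) (fderiv ℝ (φ t) z v) := by
  have h1 : HasMFDerivAt (𝓡 2) (𝓡 2) (transplant Ψ δ φ t μ) (Ψ (z, μ)) _ :=
    ((contMDiff_transplant hΨ hφ t hμ).mdifferentiableAt (by simp)).hasMFDerivAt
  have h2 := HasMFDerivAt.comp z h1 (hΨ.hasMFDerivAt hμ hz)
  have h3 : HasMFDerivAt 𝓘(ℝ, ℝ × ℝ) 𝓘(ℝ, ℝ × ℝ) (φ t) z (fderiv ℝ (φ t) z) :=
    (((hφ.contDiff t).differentiable (by simp)) z).hasFDerivAt.hasMFDerivAt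
  have h4 := HasMFDerivAt.comp z (hΨ.hasMFDerivAt hμ (hφ.mem_strip t hz)) h3
  have h5 : (transplant Ψ δ φ t μ ∘ fun z => Ψ (z, μ)) =ᶠ[𝓝 z] ((fun z => Ψ (z, μ)) ∘ φ t) := by
    filter_upwards [(isOpen_strip δ).mem_nhds hz] with z' hz'
    exact transplant_apply hΨ hφ t hμ hz'
  have h6 := h2.congr_of_eventuallyEq h5.symm
  have h7 := hasMFDerivAt_unique h6 h4
  exact congrArg (fun A : (ℝ × ℝ) →L[ℝ] Plane => A v) h7

theorem preserves_transplantDiffeo [T2Space S] (hΨ : IsAreaAnnulus Ω Ψ δ σ)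
    (hφ : IsStripFlow φ δ) (t : ℝ) (μ : disk d) : Preserves Ω (transplantDiffeo hΨ hφ t μ) := by
  intro p v w
  change Ω.val (transplant Ψ δ φ t μ p)
    ((mfderiv (𝓡 2) (𝓡 2) (transplant Ψ δ φ t μ) p : Plane →L[ℝ] Plane) v)
    ((mfderiv (𝓡 2) (𝓡 2) (transplant Ψ δ φ t μ) p : Plane →L[ℝ] Plane) w) = Ω.val p v w
  by_cases h : ∃ z ∈ strip δ, Ψ (z, μ) = p
  · obtain ⟨z, hz, rfl⟩ := h
    obtain ⟨v', rfl⟩ := hΨ.surjective_sliceDeriv μ.2 hz v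
    obtain ⟨w', rfl⟩ := hΨ.surjective_sliceDeriv μ.2 hz w
    rw [mfderiv_transplant hΨ hφ t μ.2 hz, mfderiv_transplant hΨ hφ t μ.2 hz,
      transplant_apply hΨ hφ t μ.2 hz, hΨ.area μ μ.2 _ (hφ.mem_strip t hz),
      hΨ.area μ μ.2 z hz, hφ.area]
  · have h1 : ∀ᶠ q in 𝓝 p, transplant Ψ δ φ t μ q = id q := by
      have h2 : Tendsto (fun q : S => (q, (μ : Param d))) (𝓝 p)
          (𝓝[univ ×ˢ disk d] (p, (μ : Param d))) :=
        tendsto_nhdsWithin_iff.2 ⟨(Continuous.prodMk_left (μ : Param d)).tendsto p,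
          Eventually.of_forall fun q => ⟨trivial, μ.2⟩⟩
      exact (h2.eventually (eventually_transplant_eq_self hΨ hφ h)).mono fun q hq => hq t
    have h3 : HasMFDerivAt (𝓡 2) (𝓡 2) (transplant Ψ δ φ t μ) p (ContinuousLinearMap.id ℝ Plane) :=
      (hasMFDerivAt_id p).congr_of_eventuallyEq h1
    rw [h3.mfderiv, transplant_of_not_mem t h]
    rfl

end Transplant

theorem preserves_trans {f g : S ≃ₘ⟮𝓡 2, 𝓡 2⟯ S} (hf : Preserves Ω f) (hg : Preserves Ω g) :
    Preserves Ω (f.trans g) := by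
  intro p v w
  have h : mfderiv (𝓡 2) (𝓡 2) (f.trans g) p =
      (mfderiv (𝓡 2) (𝓡 2) g (f p)).comp (mfderiv (𝓡 2) (𝓡 2) f p) :=
    mfderiv_comp p (g.contMDiff.mdifferentiableAt (by simp))
        (f.contMDiff.mdifferentiableAt (by simp))
  rw [h]
  exact (hg (f p) _ _).trans (hf p v w)

theorem Family.eval_apply (f : Family Ω d) (p : S) (μ : disk d) : f.eval (p, μ) = f.map μ p := by
  rw [Family.eval, total, dif_pos μ.2]

section Perturb

variable {φ : ℝ → ℝ × ℝ → ℝ × ℝ} [T2Space S]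

theorem contMDiffOn_comp_transplant (hΨ : IsAreaAnnulus Ω Ψ δ σ) (hφ : IsStripFlow φ δ)
    (f : Family Ω d) :
    ContMDiffOn (((𝓡 2).prod 𝓘(ℝ, Param d)).prod 𝓘(ℝ, ℝ)) (𝓡 2) ∞
      (fun q : (S × Param d) × ℝ => f.eval (transplant Ψ δ φ q.2 q.1.2 q.1.1, q.1.2))
      ((univ ×ˢ disk d) ×ˢ univ) := by
  have h1 : ContMDiffOn (((𝓡 2).prod 𝓘(ℝ, Param d)).prod 𝓘(ℝ, ℝ)) 𝓘(ℝ, Param d) ∞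
      (fun q : (S × Param d) × ℝ => q.1.2) ((univ ×ˢ disk d) ×ˢ univ) :=
    (contMDiff_snd.comp contMDiff_fst).contMDiffOn
  exact ContMDiffOn.comp (g := f.eval) f.smooth ((contMDiffOn_transplant hΨ hφ).prodMk h1)
    fun q hq => ⟨trivial, hq.1.2⟩

/-- The family obtained by composing `f` with the transplanted maps `φ t`. -/
noncomputable def perturb (hΨ : IsAreaAnnulus Ω Ψ δ σ) (hφ : IsStripFlow φ δ) (f : Family Ω d)
    (t : ℝ) :
    Family Ω d where
  map μ := (transplantDiffeo hΨ hφ t μ).trans (f.map μ)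
  preserves μ := preserves_trans (preserves_transplantDiffeo hΨ hφ t μ) (f.preserves μ)
  smooth := by
    have h1 : ContMDiffOn ((𝓡 2).prod 𝓘(ℝ, Param d)) (((𝓡 2).prod 𝓘(ℝ, Param d)).prod 𝓘(ℝ, ℝ)) ∞
        (fun q : S × Param d => (q, t)) (univ ×ˢ disk d) :=
      (contMDiff_id.prodMk contMDiff_const).contMDiffOn
    refine ((contMDiffOn_comp_transplant hΨ hφ f).comp h1 fun q hq => ⟨hq, trivial⟩).congr ?_
    rintro ⟨p, μ⟩ ⟨_, hμ⟩
    rw [total, dif_pos hμ]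
    exact (f.eval_apply _ ⟨μ, hμ⟩).symm

theorem perturb_map (hΨ : IsAreaAnnulus Ω Ψ δ σ) (hφ : IsStripFlow φ δ) (f : Family Ω d) (t : ℝ)
    (μ : disk d) (p : S) :
    (perturb hΨ hφ f t).map μ p = f.map μ (transplant Ψ δ φ t μ p) := rfl

theorem isSmoothPath_perturb (hΨ : IsAreaAnnulus Ω Ψ δ σ) (hφ : IsStripFlow φ δ)
    (f : Family Ω d) : IsSmoothPath (perturb hΨ hφ f) := by
  refine (contMDiffOn_comp_transplant hΨ hφ f).congr ?_
  rintro ⟨⟨p, μ⟩, t⟩ ⟨⟨_, hμ⟩, _⟩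
  exact ((perturb hΨ hφ f t).eval_apply p ⟨μ, hμ⟩).trans (f.eval_apply _ ⟨μ, hμ⟩).symm

theorem perturb_zero (hΨ : IsAreaAnnulus Ω Ψ δ σ) (hφ : IsStripFlow φ δ)
    (f : Family Ω d) : perturb hΨ hφ f 0 = f := by
  have h : (perturb hΨ hφ f 0).map = f.map := by
    funext μ
    refine Diffeomorph.ext fun p => ?_
    rw [perturb_map, transplant_zero hΨ hφ μ.2]
  cases f
  cases hp : perturb hΨ hφ _ 0
  simp_all

/-- The only source of smallness in the proof: both perturbations are kept in the given
neighbourhood by a short flow time. -/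
theorem eventually_perturb_mem (hΨ : IsAreaAnnulus Ω Ψ δ σ) (hφ : IsStripFlow φ δ)
    (f : Family Ω d) {V : Set (Family Ω d)} (hV : V ∈ 𝓝 f) :
    ∀ᶠ t in 𝓝 (0 : ℝ), perturb hΨ hφ f t ∈ V := by
  have := (isSmoothPath_perturb hΨ hφ f).tendsto 0
  rw [perturb_zero] at this
  exact this hV

end Perturb

end KAMGrowth

/-! ### The two flows: horizontal twists and local rotations. -/

namespace KAMGrowth

/-- The horizontal twist with profile `χ`. -/
noncomputable def twistFlow (χ : ℝ → ℝ) (t : ℝ) (z : ℝ × ℝ) : ℝ × ℝ := (z.1 + t * χ z.2, z.2)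

theorem hasFDerivAt_twistFlow {χ : ℝ → ℝ} (hχ : ContDiff ℝ ∞ χ) (t : ℝ) (z : ℝ × ℝ) :
    HasFDerivAt (twistFlow χ t)
      ((ContinuousLinearMap.fst ℝ ℝ ℝ +
        t • (deriv χ z.2 • ContinuousLinearMap.snd ℝ ℝ ℝ)).prod (ContinuousLinearMap.snd ℝ ℝ ℝ))
            z := by
  have h1 : HasDerivAt χ (deriv χ z.2) z.2 := ((hχ.differentiable (by simp)) z.2).hasDerivAt
  have h2 : HasFDerivAt (fun z : ℝ × ℝ => χ z.2) (deriv χ z.2 • ContinuousLinearMap.snd ℝ ℝ ℝ) z :=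
    h1.comp_hasFDerivAt z hasFDerivAt_snd
  exact (hasFDerivAt_fst.add (h2.const_mul t)).prodMk hasFDerivAt_snd

theorem isStripFlow_twistFlow {χ : ℝ → ℝ} (hχ : ContDiff ℝ ∞ χ) {δ δ' : ℝ} (hδ : δ' < δ)
    (h0 : ∀ y, δ' ≤ |y| → χ y = 0) : IsStripFlow (twistFlow χ) δ where
  smooth := by unfold twistFlow; fun_prop
  zero z := by simp [twistFlow]
  add s t z := by simp only [twistFlow]; ext <;> simp; ring
  translate t z k := by simp only [twistFlow]; ext <;> simp; ring
  support := ⟨δ', hδ, fun t z hz => by simp [twistFlow, h0 z.2 hz]⟩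
  area t z v w := by
    rw [(hasFDerivAt_twistFlow hχ t z).fderiv]
    simp [areaDet]; ring

/-- The rotation of the plane whose angle is `t χ(|z|²)` at the point `z`. -/
noncomputable def spin (χ : ℝ → ℝ) (t : ℝ) (z : ℝ × ℝ) : ℝ × ℝ :=
  (Real.cos (t * χ (z.1 ^ 2 + z.2 ^ 2)) * z.1 - Real.sin (t * χ (z.1 ^ 2 + z.2 ^ 2)) * z.2,
    Real.sin (t * χ (z.1 ^ 2 + z.2 ^ 2)) * z.1 + Real.cos (t * χ (z.1 ^ 2 + z.2 ^ 2)) * z.2)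

theorem spin_zero (χ : ℝ → ℝ) (z : ℝ × ℝ) : spin χ 0 z = z := by simp [spin]

theorem spin_of_eq_zero {χ : ℝ → ℝ} {z : ℝ × ℝ} (h : χ (z.1 ^ 2 + z.2 ^ 2) = 0) (t : ℝ) :
    spin χ t z = z := by simp [spin, h]

theorem spin_normSq (χ : ℝ → ℝ) (t : ℝ) (z : ℝ × ℝ) :
    (spin χ t z).1 ^ 2 + (spin χ t z).2 ^ 2 = z.1 ^ 2 + z.2 ^ 2 := by
  simp only [spin]
  linear_combination (z.1 ^ 2 + z.2 ^ 2) * Real.sin_sq_add_cos_sq (t * χ (z.1 ^ 2 + z.2 ^ 2))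

/-- The angle depends only on `|z|²`, which is constant along the motion, so angles add. -/
theorem spin_add (χ : ℝ → ℝ) (s t : ℝ) (z : ℝ × ℝ) : spin χ (s + t) z = spin χ s (spin χ t z) := by
  have h := spin_normSq χ t z
  conv_rhs => rw [spin, h]
  simp only [spin, add_mul, Real.cos_add, Real.sin_add]
  ext <;> ring

theorem contDiff_spin {X : Type} [NormedAddCommGroup X] [NormedSpace ℝ X] {χ : ℝ → ℝ}
    (hχ : ContDiff ℝ ∞ χ) {a : X → ℝ} (ha : ContDiff ℝ ∞ a) {g : X → ℝ × ℝ}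
    (hg : ContDiff ℝ ∞ g) : ContDiff ℝ ∞ (fun w => spin χ (a w) (g w)) := by
  unfold spin
  fun_prop

/-- The derivative is the rotation composed with the shear `v ↦ v + b ⟨z, v⟩ z^⊥`, which comes from
the variation of the angle. Both factors have determinant `1`, and the shear disappears at `z = 0`.
-/
theorem fderiv_spin {χ : ℝ → ℝ} (hχ : ContDiff ℝ ∞ χ) (t : ℝ) (z : ℝ × ℝ) :
    ∃ b : ℝ, ∀ v : ℝ × ℝ, ∃ u : ℝ × ℝ,
      u = (v.1 - b * (z.1 * v.1 + z.2 * v.2) * z.2, v.2 + b * (z.1 * v.1 + z.2 * v.2) * z.1) ∧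
      fderiv ℝ (spin χ t) z v =
        (Real.cos (t * χ (z.1 ^ 2 + z.2 ^ 2)) * u.1 - Real.sin (t * χ (z.1 ^ 2 + z.2 ^ 2)) * u.2,
          Real.sin (t * χ (z.1 ^ 2 + z.2 ^ 2)) * u.1 + Real.cos (t * χ (z.1 ^ 2 + z.2 ^ 2)) *
              u.2) := by
  have h1 : HasFDerivAt (fun z : ℝ × ℝ => z.1) (ContinuousLinearMap.fst ℝ ℝ ℝ) z := hasFDerivAt_fst
  have h2 : HasFDerivAt (fun z : ℝ × ℝ => z.2) (ContinuousLinearMap.snd ℝ ℝ ℝ) z := hasFDerivAt_snd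
  have h3 := (h1.pow 2).add (h2.pow 2)
  have h4 : HasDerivAt χ (deriv χ (z.1 ^ 2 + z.2 ^ 2)) (z.1 ^ 2 + z.2 ^ 2) :=
    ((hχ.differentiable (by simp)) _).hasDerivAt
  have h5 := (HasDerivAt.comp_hasFDerivAt z h4 h3).const_mul t
  have h6 := h5.cos
  have h7 := h5.sin
  have h8 := ((h6.mul h1).sub (h7.mul h2)).prodMk ((h7.mul h1).add (h6.mul h2))
  refine ⟨2 * t * deriv χ (z.1 ^ 2 + z.2 ^ 2), fun v => ⟨_, rfl, ?_⟩⟩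
  have h9 : HasFDerivAt (spin χ t) _ z := h8
  rw [h9.fderiv]
  ext
  · simp; ring
  · simp; ring

theorem areaDet_fderiv_spin {χ : ℝ → ℝ} (hχ : ContDiff ℝ ∞ χ) (t : ℝ) (z v w : ℝ × ℝ) :
    areaDet (fderiv ℝ (spin χ t) z v) (fderiv ℝ (spin χ t) z w) = areaDet v w := by
  obtain ⟨b, hb⟩ := fderiv_spin hχ t z
  obtain ⟨u, hu, hv⟩ := hb v
  obtain ⟨u', hu', hw⟩ := hb w
  rw [hv, hw]
  have h1 : areaDet u u' = areaDet v w := by rw [hu, hu']; simp only [areaDet]; ring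
  rw [← h1]
  simp only [areaDet]
  linear_combination (u.1 * u'.2 - u.2 * u'.1) * Real.sin_sq_add_cos_sq (t * χ (z.1 ^ 2 + z.2 ^ 2))

theorem fderiv_spin_zero {χ : ℝ → ℝ} (hχ : ContDiff ℝ ∞ χ) (h1 : χ 0 = 1) (t : ℝ) (v : ℝ × ℝ) :
    fderiv ℝ (spin χ t) 0 v =
      (Real.cos t * v.1 - Real.sin t * v.2, Real.sin t * v.1 + Real.cos t * v.2) := by
  obtain ⟨b, hb⟩ := fderiv_spin hχ t 0
  obtain ⟨u, hu, hv⟩ := hb v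
  rw [hv, hu]
  simp [h1]

/-- The center of the `j`-th of the cells of width `1 / M`. -/
noncomputable def cellCenter (M : ℕ) (j : ℤ) : ℝ × ℝ := ((j + 1 / 2) / M, 0)

/-- The composition of the local rotations around the centers of the cells of width `1 / M`, with
speed `k j` in the `j`-th cell. -/
noncomputable def cellSpin (χ : ℝ → ℝ) (M : ℕ) (k : ℤ → ℝ) (t : ℝ) (z : ℝ × ℝ) : ℝ × ℝ :=
  cellCenter M ⌊M * z.1⌋ + spin χ (t * k ⌊M * z.1⌋) (z - cellCenter M ⌊M * z.1⌋)

section CellSpin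

variable {χ : ℝ → ℝ} {M : ℕ} {k : ℤ → ℝ} {r : ℝ}

theorem floor_eq_of_near (hM : 0 < M) (hrM : r < 1 / (2 * M)) {j : ℤ} {z : ℝ × ℝ}
    (hz : |z.1 - (cellCenter M j).1| ≤ r) : ⌊M * z.1⌋ = j := by
  have hM' : (0 : ℝ) < M := Nat.cast_pos.2 hM
  rw [Int.floor_eq_iff]
  have h1 : (M : ℝ) * (1 / (2 * M)) = 1 / 2 := by field_simp
  have h2 : (M : ℝ) * ((j + 1 / 2) / M) = j + 1 / 2 := by field_simp
  have h3 := abs_le.1 hz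
  simp only [cellCenter] at h3
  have h4 : (M : ℝ) * r < 1 / 2 := by rw [← h1]; exact mul_lt_mul_of_pos_left hrM hM'
  constructor <;> nlinarith

theorem cellSpin_of_far (hr : 0 ≤ r) (hχ0 : ∀ s, r ^ 2 ≤ s → χ s = 0) (t : ℝ) {z : ℝ × ℝ}
    (hz : r ≤ |z.1 - (cellCenter M ⌊M * z.1⌋).1|) : cellSpin χ M k t z = z := by
  rw [cellSpin, spin_of_eq_zero, add_sub_cancel]
  refine hχ0 _ ?_
  have := pow_le_pow_left₀ hr hz 2
  rw [sq_abs] at this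
  have h2 := sq_nonneg (z - cellCenter M ⌊M * z.1⌋).2
  simp only [Prod.fst_sub]
  linarith

/-- The floor jumps at cell boundaries, but the rotating disks have radius less than half a cell, so
the map is the identity there. Near any point it is therefore a single spin, and smoothness and area
preservation are inherited. -/
theorem cellSpin_local_form (hM : 0 < M) (hr : 0 < r) (hrM : r < 1 / (2 * M))
    (hχ0 : ∀ s, r ^ 2 ≤ s → χ s = 0) (z₀ : ℝ × ℝ) :
    ∃ (c : ℝ × ℝ) (l : ℝ), ∀ᶠ z in 𝓝 z₀, ∀ t, cellSpin χ M k t z = c + spin χ (t * l) (z - c) := by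
  have hM' : (0 : ℝ) < M := Nat.cast_pos.2 hM
  set j := ⌊M * z₀.1⌋ with hj
  have h1 : (j : ℝ) ≤ M * z₀.1 := Int.floor_le _
  have h2 : M * z₀.1 < j + 1 := Int.lt_floor_add_one _
  have hc : Continuous fun z : ℝ × ℝ => (M : ℝ) * z.1 := by fun_prop
  rcases h1.lt_or_eq with h3 | h3
  · refine ⟨cellCenter M j, k j, ?_⟩
    filter_upwards [hc.continuousAt.eventually (lt_mem_nhds h3),
      hc.continuousAt.eventually (gt_mem_nhds h2)] with z h4 h5 t
    have h6 : ⌊M * z.1⌋ = j := Int.floor_eq_iff.2 ⟨h4.le, h5⟩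
    rw [cellSpin, h6]
  -- On a cell boundary speed `0` gives the identity; the margin `1/2 - M r` keeps neighbouring
  -- points out of the disks on both sides.
  · refine ⟨0, 0, ?_⟩
    have h7 : (M : ℝ) * (1 / (2 * M)) = 1 / 2 := by field_simp
    have hη : 0 < 1 / 2 - M * r := by
      have := mul_lt_mul_of_pos_left hrM hM'
      rw [h7] at this; linarith
    filter_upwards [hc.continuousAt.eventually
        (lt_mem_nhds (show (j : ℝ) - (1 / 2 - M * r) < M * z₀.1 by linarith)),
      hc.continuousAt.eventually (gt_mem_nhds
          (show M * z₀.1 < (j : ℝ) + (1 / 2 - M * r) by linarith))]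
      with z h4 h5 t
    rw [mul_zero, spin_zero, add_sub_cancel]
    refine cellSpin_of_far hr.le hχ0 t ?_
    set i := ⌊M * z.1⌋ with hi
    have h8 : (M : ℝ) * ((i + 1 / 2) / M) = i + 1 / 2 := by field_simp
    have h9 : (i : ℝ) ≤ M * z.1 := Int.floor_le _
    have h10 : M * z.1 < i + 1 := Int.lt_floor_add_one _
    have hMr : 0 < M * r := mul_pos hM' hr
    have h11 : i = j ∨ i = j - 1 := by
      have h12 : (i : ℝ) < j + 1 := by linarith
      have h13 : (j : ℝ) < i + 2 := by linarith
      have h14 : i < j + 1 := by exact_mod_cast h12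
      have h15 : j < i + 2 := by exact_mod_cast h13
      omega
    refine le_of_mul_le_mul_left ?_ hM'
    rw [← abs_of_pos hM', ← abs_mul, abs_of_pos hM', mul_sub]
    simp only [cellCenter]
    rw [h8]
    rcases h11 with h | h
    · rw [h]
      exact le_trans (by linarith) (neg_le_abs _)
    · rw [h]; push_cast
      exact le_trans (by linarith) (le_abs_self _)

theorem contDiff_cellSpin (hχ : ContDiff ℝ ∞ χ) (hM : 0 < M) (hr : 0 < r)
    (hrM : r < 1 / (2 * M)) (hχ0 : ∀ s, r ^ 2 ≤ s → χ s = 0) :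
    ContDiff ℝ ∞ (fun w : ℝ × (ℝ × ℝ) => cellSpin χ M k w.1 w.2) := by
  rw [contDiff_iff_contDiffAt]
  rintro ⟨t, z₀⟩
  obtain ⟨c, l, h⟩ := cellSpin_local_form (k := k) hM hr hrM hχ0 z₀
  have h3 : ContDiff ℝ ∞ (fun w : ℝ × (ℝ × ℝ) => spin χ (w.1 * l) (w.2 - c)) :=
    contDiff_spin hχ (by fun_prop) (by fun_prop)
  have h1 : ContDiff ℝ ∞ (fun w : ℝ × (ℝ × ℝ) => c + spin χ (w.1 * l) (w.2 - c)) :=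
    contDiff_const.add h3
  refine h1.contDiffAt.congr_of_eventuallyEq ?_
  have h4 : Tendsto (Prod.snd : ℝ × (ℝ × ℝ) → ℝ × ℝ) (𝓝 (t, z₀)) (𝓝 z₀) := continuousAt_snd
  exact (h4.eventually h).mono fun w hw => hw w.1

/-- Periodicity of the speeds gives the commutation with integer translations. The group law holds
because each disk is invariant. -/
theorem isStripFlow_cellSpin (hχ : ContDiff ℝ ∞ χ) (hM : 0 < M) (hr : 0 < r)
    (hrM : r < 1 / (2 * M)) (hχ0 : ∀ s, r ^ 2 ≤ s → χ s = 0)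
    (hk : ∀ j i : ℤ, k (j + M * i) = k j) {δ : ℝ} (hrδ : r < δ) :
    IsStripFlow (cellSpin χ M k) δ where
  smooth := contDiff_cellSpin hχ hM hr hrM hχ0
  zero z := by rw [cellSpin, zero_mul, spin_zero, add_sub_cancel]
  add s t z := by
    rcases le_or_gt r |z.1 - (cellCenter M ⌊M * z.1⌋).1| with h | h
    · rw [cellSpin_of_far hr.le hχ0 t h, cellSpin_of_far hr.le hχ0 s h,
        cellSpin_of_far hr.le hχ0 _ h]
    · set j := ⌊M * z.1⌋ with hj
      set c := cellCenter M j with hc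
      by_cases h0 : χ ((z - c).1 ^ 2 + (z - c).2 ^ 2) = 0
      · have h1 : ∀ t, cellSpin χ M k t z = z := fun t => by
          rw [cellSpin, ← hj, ← hc, spin_of_eq_zero h0, add_sub_cancel]
        rw [h1, h1, h1]
      · have h1 : (z - c).1 ^ 2 + (z - c).2 ^ 2 < r ^ 2 := by
          by_contra hn
          exact h0 (hχ0 _ (not_lt.1 hn))
        have h2 : cellSpin χ M k t z = c + spin χ (t * k j) (z - c) := rfl
        -- The image is still in the disk of radius `r`, so the second rotation uses the same centre
        -- and speed.
        have h3 : ⌊M * (cellSpin χ M k t z).1⌋ = j := by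
          refine floor_eq_of_near hM hrM (abs_le_of_sq_le_sq ?_ hr.le)
          rw [h2, ← hc, Prod.fst_add, add_sub_cancel_left]
          have h4 := spin_normSq χ (t * k j) (z - c)
          have h5 := sq_nonneg (spin χ (t * k j) (z - c)).2
          linarith
        rw [cellSpin, cellSpin, h3, ← hj, ← hc, h2, add_sub_cancel_left, add_mul, spin_add]
  translate t z i := by
    have hM' : (M : ℝ) ≠ 0 := (Nat.cast_pos.2 hM).ne'
    have h1 : ⌊(M : ℝ) * (z.1 + i)⌋ = ⌊M * z.1⌋ + M * i := by
      rw [mul_add, ← Int.floor_add_intCast]; push_cast; rfl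
    have h2 : cellCenter M (⌊M * z.1⌋ + M * i) = cellCenter M ⌊M * z.1⌋ + ((i : ℝ), (0 : ℝ)) := by
      simp only [cellCenter]
      ext
      · push_cast
        simp only [Prod.fst_add]
        field_simp
        ring
      · simp
    have h3 : (z.1 + i, z.2) - (cellCenter M ⌊M * z.1⌋ + ((i : ℝ), (0 : ℝ))) =
        z - cellCenter M ⌊M * z.1⌋ := by
      ext <;> simp
    simp only [cellSpin]
    rw [h1, hk, h2, h3]
    ext <;> simp <;> ring
  support := ⟨r, hrδ, fun t z hz => by
    rw [cellSpin, spin_of_eq_zero, add_sub_cancel]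
    refine hχ0 _ ?_
    have := pow_le_pow_left₀ hr.le hz 2
    rw [sq_abs] at this
    have h2 := sq_nonneg (z - cellCenter M ⌊M * z.1⌋).1
    simp only [cellCenter, Prod.snd_sub, sub_zero] at h2 ⊢
    linarith⟩
  area t z v w := by
    obtain ⟨c, l, h⟩ := cellSpin_local_form (k := k) hM hr hrM hχ0 z
    have h1 : cellSpin χ M k t =ᶠ[𝓝 z] fun z => c + spin χ (t * l) (z - c) :=
      h.mono fun z hz => hz t
    rw [h1.fderiv_eq, fderiv_const_add, fderiv_comp_sub]
    exact areaDet_fderiv_spin hχ _ _ v w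

theorem floor_cellCenter (hM : 0 < M) (j : ℤ) : ⌊M * (cellCenter M j).1⌋ = j := by
  have hM' : (M : ℝ) ≠ 0 := (Nat.cast_pos.2 hM).ne'
  rw [Int.floor_eq_iff, cellCenter]
  have h2 : (M : ℝ) * ((j + 1 / 2) / M) = j + 1 / 2 := by field_simp
  dsimp only
  rw [h2]
  constructor <;> linarith

theorem cellSpin_cellCenter (hM : 0 < M) (j : ℤ) (t : ℝ) :
    cellSpin χ M k t (cellCenter M j) = cellCenter M j := by
  rw [cellSpin, floor_cellCenter hM, sub_self]
  simp [spin]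

theorem fderiv_cellSpin_cellCenter (hχ : ContDiff ℝ ∞ χ) (h1 : χ 0 = 1) (hM : 0 < M) (j : ℤ)
    (t : ℝ) (v : ℝ × ℝ) :
    fderiv ℝ (cellSpin χ M k t) (cellCenter M j) v =
      (Real.cos (t * k j) * v.1 - Real.sin (t * k j) * v.2,
        Real.sin (t * k j) * v.1 + Real.cos (t * k j) * v.2) := by
  have hM' : (0 : ℝ) < M := Nat.cast_pos.2 hM
  have hc : Continuous fun z : ℝ × ℝ => (M : ℝ) * z.1 := by fun_prop
  have h2 : (M : ℝ) * ((j + 1 / 2) / M) = j + 1 / 2 := by field_simp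
  have h3 : cellSpin χ M k t =ᶠ[𝓝 (cellCenter M j)]
      fun z => cellCenter M j + spin χ (t * k j) (z - cellCenter M j) := by
    filter_upwards [hc.continuousAt.eventually (lt_mem_nhds
      (show (j : ℝ) < M * (cellCenter M j).1 by rw [cellCenter]; linarith)),
      hc.continuousAt.eventually (gt_mem_nhds
      (show M * (cellCenter M j).1 < (j : ℝ) + 1 by rw [cellCenter]; linarith))] with z h4 h5
    have h6 : ⌊M * z.1⌋ = j := Int.floor_eq_iff.2 ⟨h4.le, h5⟩
    rw [cellSpin, h6]
  rw [h3.fderiv_eq, fderiv_const_add, fderiv_comp_sub, sub_self]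
  exact fderiv_spin_zero hχ h1 _ v

end CellSpin

end KAMGrowth

/-! ### Traces, eigenvalues and derivatives along an orbit. -/

namespace KAMGrowth

/-- The linear term `± A s` dominates the quadratic loss of `2 cos s`. The bound `s < lo / 2`
settles the first inequality; `s < 1` and `hi * s < 1` keep the second expression above `-2`. Only
`lo` and `hi` matter, so one `s` serves all parameters. -/
theorem eventually_trace_bounds {lo : ℝ} (hlo : 0 < lo) (hi : ℝ) :
    ∀ᶠ s in 𝓝[>] (0 : ℝ), ∀ A ∈ Icc lo hi,
      2 < 2 * Real.cos s + A * Real.sin s ∧ |2 * Real.cos s - A * Real.sin s| < 2 := by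
  have h1 : ∀ᶠ s in 𝓝[>] (0 : ℝ), s < min 1 (lo / 2) :=
    nhdsWithin_le_nhds (gt_mem_nhds (by positivity))
  have h2 : ∀ᶠ s in 𝓝[>] (0 : ℝ), hi * s < 1 := by
    have : Tendsto (fun s : ℝ => hi * s) (𝓝 0) (𝓝 0) := by
      simpa using (continuous_const_mul hi).tendsto 0
    exact nhdsWithin_le_nhds (this.eventually (gt_mem_nhds one_pos))
  filter_upwards [h1, h2, self_mem_nhdsWithin] with s hs1 hs2 hs0 A hA
  have hs0' : 0 < s := hs0
  have hs3 : s < 1 := hs1.trans_le (min_le_left _ _)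
  have hs4 : s < lo / 2 := hs1.trans_le (min_le_right _ _)
  have hsin : s / 2 ≤ Real.sin s := by
    have h1 := Real.sin_gt_sub_cube hs0'
    have h2 : s ^ 3 ≤ s := by
      have := pow_le_of_le_one hs0'.le hs3.le (n := 3) (by norm_num)
      exact this
    linarith
  have hsin' : Real.sin s ≤ s := Real.sin_le hs0'.le
  have hcos : 1 - s ^ 2 / 2 ≤ Real.cos s := Real.one_sub_sq_div_two_le_cos
  have hcos' : Real.cos s ≤ 1 := Real.cos_le_one s
  have hA0 : 0 < A := hlo.trans_le hA.1
  have h5 : A * (s / 2) ≤ A * Real.sin s := mul_le_mul_of_nonneg_left hsin hA0.le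
  have h6 : A * Real.sin s ≤ hi * s :=
    (mul_le_mul_of_nonneg_left hsin' hA0.le).trans (mul_le_mul_of_nonneg_right hA.2 hs0'.le)
  have h7 : lo * (s / 2) ≤ A * (s / 2) := mul_le_mul_of_nonneg_right hA.1 (by positivity)
  have h8 : s * s < s * (lo / 2) := mul_lt_mul_of_pos_left hs4 hs0'
  have h9 : s * s < 1 := by nlinarith
  refine ⟨by nlinarith, abs_lt.2 ⟨by nlinarith, by nlinarith [mul_pos hA0 hs0']⟩⟩

theorem norm_ne_one_of_quadratic {τ : ℝ} (hτ : 2 < τ) {z : ℂ} (hz : z ^ 2 - τ * z + 1 = 0) :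
    ‖z‖ ≠ 1 := by
  intro h
  have h1 : z.re ^ 2 + z.im ^ 2 = 1 := by
    have := Complex.sq_norm z
    rw [h, Complex.normSq_apply] at this
    linarith
  have hre := congrArg Complex.re hz
  have him := congrArg Complex.im hz
  simp [pow_two] at hre him
  have h2 : z.im * (2 * z.re - τ) = 0 := by linarith
  have h3 : z.re ≤ 1 := by nlinarith [sq_nonneg z.im]
  rcases mul_eq_zero.1 h2 with h4 | h4
  · rw [h4] at hre h1
    nlinarith
  · linarith

/-- Negative discriminant: the roots are non-real and conjugate, with product `1`. -/
theorem norm_eq_one_of_quadratic {τ : ℝ} (hτ : |τ| < 2) {z : ℂ} (hz : z ^ 2 - τ * z + 1 = 0) :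
    ‖z‖ = 1 ∧ z.im ≠ 0 := by
  have hre := congrArg Complex.re hz
  have him := congrArg Complex.im hz
  simp [pow_two] at hre him
  have h2 : z.im * (2 * z.re - τ) = 0 := by linarith
  have hτ2 : τ ^ 2 < 4 := by
    have := abs_lt.1 hτ
    nlinarith
  have h0 : z.im ≠ 0 := by
    intro h
    rw [h] at hre
    nlinarith [sq_nonneg (z.re - τ / 2)]
  refine ⟨?_, h0⟩
  have h4 : 2 * z.re - τ = 0 := (mul_eq_zero.1 h2).resolve_left h0
  have h5 : ‖z‖ ^ 2 = 1 := by
    rw [Complex.sq_norm, Complex.normSq_apply]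
    rw [show τ = 2 * z.re by linarith] at hre
    linarith
  exact (pow_eq_one_iff_of_nonneg (norm_nonneg z) two_ne_zero).1 h5

/-- The characteristic polynomial is invariant under conjugation, so it may be computed in any
linear frame `ι` of the tangent plane. -/
theorem quadratic_of_isComplexEigenvalue {A : Plane →L[ℝ] Plane} {ι : (ℝ × ℝ) →L[ℝ] Plane}
    (hι : Function.Bijective ι) {a b c d : ℝ}
    (hA : ∀ v, A (ι v) = ι (a * v.1 + b * v.2, c * v.1 + d * v.2)) {z : ℂ}
    (hz : IsComplexEigenvalue A z) : z ^ 2 - (a + d : ℝ) * z + (a * d - b * c : ℝ) = 0 := by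
  set B := Module.Basis.finTwoProd ℝ
  set T : (ℝ × ℝ) →ₗ[ℝ] (ℝ × ℝ) := Matrix.toLin B B !![a, b; c, d] with hT
  have hTv : ∀ v, T v = (a * v.1 + b * v.2, c * v.1 + d * v.2) := fun v => by
    rw [hT, Matrix.toLin_finTwoProd_apply]
  set e : (ℝ × ℝ) ≃ₗ[ℝ] Plane := LinearEquiv.ofBijective (ι : (ℝ × ℝ) →ₗ[ℝ] Plane) hι with he
  have h1 : (A : Plane →ₗ[ℝ] Plane) = e.conj T := by
    refine LinearMap.ext fun w => ?_
    obtain ⟨v, rfl⟩ := e.surjective w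
    rw [LinearEquiv.conj_apply_apply, e.symm_apply_apply, hTv]
    exact hA v
  have h2 : T.charpoly = (!![a, b; c, d] : Matrix (Fin 2) (Fin 2) ℝ).charpoly := by
    rw [← LinearMap.charpoly_toMatrix T B, hT, LinearMap.toMatrix_toLin]
  rw [IsComplexEigenvalue, h1, LinearEquiv.charpoly_conj, h2, Matrix.charpoly_fin_two,
    Matrix.trace_fin_two_of, Matrix.det_fin_two_of] at hz
  simpa using hz

/-- If `g` maps the points `Ψ(z i)` to one another and its derivative is known along this orbit,
then so is that of its iterates. -/
theorem mfderiv_iterate_of_orbit {S : Type*} [TopologicalSpace S] [ChartedSpace Plane S]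
    {g : S → S} (hg : ContMDiff (𝓡 2) (𝓡 2) ∞ g) {x : ℕ → S}
    (hx : ∀ i, g (x i) = x (i + 1)) {ι : ℕ → (ℝ × ℝ) →L[ℝ] Plane} {a : ℕ → ℝ}
    {R : ℝ × ℝ → ℝ × ℝ} {n : ℕ}
    (h0 : ∀ v, (mfderiv (𝓡 2) (𝓡 2) g (x 0) : Plane →L[ℝ] Plane) (ι 0 v) =
      ι 1 ((R v).1 + a 0 * (R v).2, (R v).2))
    (hi : ∀ i, 0 < i → i < n → ∀ v, (mfderiv (𝓡 2) (𝓡 2) g (x i) : Plane →L[ℝ] Plane) (ι i v) =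
      ι (i + 1) (v.1 + a i * v.2, v.2)) (i : ℕ) (hin : i < n) (v : ℝ × ℝ) :
    iterDeriv g (i + 1) (x 0) (ι 0 v) =
      ι (i + 1) ((R v).1 + (∑ l ∈ Finset.range (i + 1), a l) * (R v).2, (R v).2) := by
  have hit : ∀ i, g^[i] (x 0) = x i := fun i => by
    induction i with
    | zero => rfl
    | succ i ih => rw [Function.iterate_succ_apply', ih, hx]
  have hgi : ∀ i, MDifferentiable (𝓡 2) (𝓡 2) (g^[i]) := fun i => by
    induction i with
    | zero => exact mdifferentiable_id
    | succ i ih =>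
      rw [Function.iterate_succ']
      exact (hg.mdifferentiable (by simp)).comp ih
  have hstep : ∀ i (w : Plane), iterDeriv g (i + 1) (x 0) w =
      (mfderiv (𝓡 2) (𝓡 2) g (x i) : Plane →L[ℝ] Plane) (iterDeriv g i (x 0) w) := by
    intro i w
    have h1 : HasMFDerivAt (𝓡 2) (𝓡 2) g (g^[i] (x 0)) _ :=
      (hg.mdifferentiable (by simp) _).hasMFDerivAt
    have h2 := HasMFDerivAt.comp (x 0) h1 (hgi i (x 0)).hasMFDerivAt
    rw [← Function.iterate_succ'] at h2
    rw [iterDeriv, h2.mfderiv, ← hit i]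
    rfl
  induction i with
  | zero =>
    have h1 : iterDeriv g 0 (x 0) (ι 0 v) = ι 0 v := by
      have : HasMFDerivAt (𝓡 2) (𝓡 2) (g^[0]) (x 0) (ContinuousLinearMap.id ℝ Plane) :=
        hasMFDerivAt_id (x 0)
      rw [iterDeriv, this.mfderiv]; rfl
    rw [hstep, h1, h0]
    simp
  | succ i ih =>
    rw [hstep, ih (by omega), hi (i + 1) (by omega) hin, Finset.sum_range_succ _ (i + 1)]
    congr 2
    simp only
    ring

/-! ### Twist annuli and the change of rotation number. -/

variable {S : Type*} [TopologicalSpace S] [ChartedSpace Plane S] [IsManifold (𝓡 2) ∞ S]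
  {Ω : AreaForm S} {d : ℕ} {Ψ : (ℝ × ℝ) × Param d → S} {δ σ θ : ℝ}

/-- A family of annuli with area-preserving coordinates whose cores are invariant under the members
of `f`, which act on them as the rotation by `θ` and twist their neighbourhoods positively, with
uniform bounds. -/
structure IsTwistAnnulus (f : Family Ω d) (Ψ : (ℝ × ℝ) × Param d → S) (δ σ θ : ℝ) : Prop where
  annulus : IsAreaAnnulus Ω Ψ δ σ
  rotation : ∀ (μ : disk d) (x : ℝ), f.map μ (Ψ ((x, 0), μ)) = Ψ ((x + θ, 0), μ)
  twist : ∀ x : ℝ, ∃ lo > 0, ∃ hi, ∀ μ : disk d, ∃ a ∈ Icc lo hi, ∀ v : ℝ × ℝ,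
    (mfderiv (𝓡 2) (𝓡 2) (f.map μ) (Ψ ((x, 0), μ)) : Plane →L[ℝ] Plane)
      (sliceDeriv Ψ μ (x, 0) v) = sliceDeriv Ψ μ (x + θ, 0) (v.1 + a * v.2, v.2)

theorem IsAreaAnnulus.core_mem (hΨ : IsAreaAnnulus Ω Ψ δ σ) (x : ℝ) : (x, (0 : ℝ)) ∈ strip δ :=
  ⟨trivial, neg_lt_zero.2 hΨ.pos, hΨ.pos⟩

theorem IsAreaAnnulus.cellCenter_mem (hΨ : IsAreaAnnulus Ω Ψ δ σ) (M : ℕ) (j : ℤ) :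
    cellCenter M j ∈ strip δ := hΨ.core_mem _

theorem IsAreaAnnulus.sliceDeriv_translate (hΨ : IsAreaAnnulus Ω Ψ δ σ) {μ : Param d}
    (hμ : μ ∈ disk d) {z : ℝ × ℝ} (hz : z ∈ strip δ) (k : ℤ) :
    sliceDeriv Ψ μ (z.1 + k, z.2) = sliceDeriv Ψ μ z := by
  have h1 : HasFDerivAt (fun z : ℝ × ℝ => (z.1 + (k : ℝ), z.2)) (ContinuousLinearMap.id ℝ (ℝ × ℝ))
      z := by
    have h0 : HasFDerivAt (fun z : ℝ × ℝ => z.1 + (k : ℝ)) (ContinuousLinearMap.fst ℝ ℝ ℝ) z :=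
      hasFDerivAt_fst.add_const (k : ℝ)
    exact h0.prodMk hasFDerivAt_snd
  have h2 := HasMFDerivAt.comp z
    (hΨ.hasMFDerivAt hμ (z := (z.1 + k, z.2)) ⟨trivial, hz.2⟩) h1.hasMFDerivAt
  have h3 : (fun z : ℝ × ℝ => Ψ (z, μ)) =ᶠ[𝓝 z]
      (fun z => Ψ (z, μ)) ∘ fun z : ℝ × ℝ => (z.1 + (k : ℝ), z.2) := by
    filter_upwards [(isOpen_strip δ).mem_nhds hz] with z' hz'
    exact (hΨ.eq_iff μ hμ z' hz' (z'.1 + k, z'.2) ⟨trivial, hz'.2⟩).2 ⟨k, rfl⟩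
  exact (hasMFDerivAt_unique (h2.congr_of_eventuallyEq h3) (hΨ.hasMFDerivAt hμ hz))

section Perturb

variable [T2Space S] {φ : ℝ → ℝ × ℝ → ℝ × ℝ}

theorem mfderiv_perturb (hΨ : IsAreaAnnulus Ω Ψ δ σ) (hφ : IsStripFlow φ δ) (f : Family Ω d)
    (t : ℝ) (μ : disk d) {z : ℝ × ℝ} (hz : z ∈ strip δ) (v : ℝ × ℝ) :
    (mfderiv (𝓡 2) (𝓡 2) ((perturb hΨ hφ f t).map μ) (Ψ (z, μ)) : Plane →L[ℝ] Plane)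
      (sliceDeriv Ψ μ z v) =
    (mfderiv (𝓡 2) (𝓡 2) (f.map μ) (Ψ (φ t z, μ)) : Plane →L[ℝ] Plane)
      (sliceDeriv Ψ μ (φ t z) (fderiv ℝ (φ t) z v)) := by
  have h1 : HasMFDerivAt (𝓡 2) (𝓡 2) (transplant Ψ δ φ t μ) (Ψ (z, μ)) _ :=
    ((contMDiff_transplant hΨ hφ t μ.2).mdifferentiableAt (by simp)).hasMFDerivAt
  have h2 : HasMFDerivAt (𝓡 2) (𝓡 2) (f.map μ) (transplant Ψ δ φ t μ (Ψ (z, μ))) _ :=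
    ((f.map μ).contMDiff.mdifferentiableAt (by simp)).hasMFDerivAt
  have h3 : HasMFDerivAt (𝓡 2) (𝓡 2) (f.map μ ∘ transplant Ψ δ φ t μ) (Ψ (z, μ)) _ :=
    HasMFDerivAt.comp (Ψ (z, μ)) h2 h1
  rw [show ((perturb hΨ hφ f t).map μ : S → S) = f.map μ ∘ transplant Ψ δ φ t μ from rfl,
    h3.mfderiv, ← mfderiv_transplant hΨ hφ t μ.2 hz, ← transplant_apply hΨ hφ t μ.2 hz]
  rfl

/-- With `χ 0 = 1` and `χ' 0 = 0` the twist translates the core by `t` and has identity derivative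
there. The new shear at `x` is thus the old one at `x + t`, with the same bounds. -/
theorem IsTwistAnnulus.perturb_twistFlow {f : Family Ω d} (h : IsTwistAnnulus f Ψ δ σ θ)
    {χ : ℝ → ℝ} (hχ : ContDiff ℝ ∞ χ) (hφ : IsStripFlow (twistFlow χ) δ) (h1 : χ 0 = 1)
    (h2 : deriv χ 0 = 0) (t : ℝ) :
    IsTwistAnnulus (perturb h.annulus hφ f t) Ψ δ σ (θ + t) where
  annulus := h.annulus
  rotation μ x := by
    rw [perturb_map, transplant_apply h.annulus hφ t μ.2 (h.annulus.core_mem x), twistFlow, h1,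
      mul_one, h.rotation, add_assoc, add_comm t]
  twist x := by
    obtain ⟨lo, hlo, hi, hb⟩ := h.twist (x + t)
    refine ⟨lo, hlo, hi, fun μ => ?_⟩
    obtain ⟨a, ha, hv⟩ := hb μ
    refine ⟨a, ha, fun v => ?_⟩
    rw [mfderiv_perturb h.annulus hφ f t μ (h.annulus.core_mem x),
      (hasFDerivAt_twistFlow hχ t (x, 0)).fderiv]
    have h3 : twistFlow χ t (x, 0) = (x + t, 0) := by simp [twistFlow, h1]
    rw [h3, show x + (θ + t) = x + t + θ by ring, ← hv v]
    simp [h2]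
    rfl

end Perturb

theorem minimalPeriod_of_iterate_eq_iff {X : Type*} {g : X → X} {x : X} {n : ℕ}
    (h : ∀ i, g^[i] x = x ↔ n ∣ i) : Function.minimalPeriod g x = n :=
  Nat.dvd_antisymm (Function.IsPeriodicPt.minimalPeriod_dvd ((h n).2 dvd_rfl))
    ((h _).1 (Function.isPeriodicPt_minimalPeriod g x))

end KAMGrowth

/-! ### Periodic points created by the local rotations. -/

namespace KAMGrowth

/-- The speed `1` in the first `L` of every `2 L n` consecutive cells, `-1` in the next `L`, and
`0` in the others. -/
def cellSign (L n : ℕ) (j : ℤ) : ℝ :=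
  if j % ((2 * L * n : ℕ) : ℤ) < L then 1 else if j % ((2 * L * n : ℕ) : ℤ) < 2 * L then -1 else 0

theorem cellSign_add_mul (L n : ℕ) (j i : ℤ) :
    cellSign L n (j + ((2 * L * n : ℕ) : ℤ) * i) = cellSign L n j := by
  simp only [cellSign, Int.add_mul_emod_self_left]

theorem cellSign_of_lt {L n j : ℕ} (hn : 0 < n) (hj : j < L) : cellSign L n j = 1 := by
  have h : (j : ℤ) % ((2 * L * n : ℕ) : ℤ) = j :=
    Int.emod_eq_of_lt (by positivity) (by exact_mod_cast (by nlinarith : j < 2 * L * n))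
  rw [cellSign, h, if_pos (by exact_mod_cast hj)]

theorem cellSign_add_of_lt {L n j : ℕ} (hn : 0 < n) (hj : j < L) :
    cellSign L n (L + j : ℕ) = -1 := by
  have h : ((L + j : ℕ) : ℤ) % ((2 * L * n : ℕ) : ℤ) = (L + j : ℕ) :=
    Int.emod_eq_of_lt (by positivity) (by exact_mod_cast (by nlinarith : L + j < 2 * L * n))
  rw [cellSign, h, if_neg (by push_cast; omega), if_pos (by push_cast; omega)]

/-- For `0 < i < n` the residue `m` of `i p` modulo `n` is nonzero, so modulo `2Ln` the index is `j
+ 2Lm ≥ 2L`, where the speed vanishes. An orbit is thus rotated only once per period. -/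
theorem cellSign_orbit {L n : ℕ} {p : ℤ} (hpn : IsCoprime p (n : ℤ)) {j : ℕ} (hj : j < 2 * L)
    {i : ℕ}
    (hi : 0 < i) (hin : i < n) : cellSign L n (j + 2 * L * (i * p)) = 0 := by
  have hn : (0 : ℤ) < n := by omega
  set m := ((i : ℤ) * p) % n with hm
  have hm0 : 0 ≤ m := Int.emod_nonneg _ hn.ne'
  have hmn : m < n := Int.emod_lt_of_pos _ hn
  have hm1 : m ≠ 0 := fun h => by
    have h1 : (n : ℤ) ∣ i * p := Int.dvd_of_emod_eq_zero h
    have h2 : (n : ℤ) ∣ i := hpn.symm.dvd_of_dvd_mul_right h1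
    exact absurd (Int.le_of_dvd (by omega) h2) (by omega)
  have h3 : (i : ℤ) * p = m + n * (((i : ℤ) * p) / n) := (Int.emod_add_mul_ediv _ _).symm
  have h4 : (j : ℤ) + 2 * L * (i * p) =
      (j + 2 * L * m) + ((2 * L * n : ℕ) : ℤ) * (((i : ℤ) * p) / n) := by
    conv_lhs => rw [h3]
    push_cast; ring
  have hL : (0 : ℤ) < 2 * L := by omega
  have h5 : (j + 2 * L * m : ℤ) % ((2 * L * n : ℕ) : ℤ) = j + 2 * L * m := by
    refine Int.emod_eq_of_lt (by positivity) ?_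
    push_cast
    nlinarith
  have h6 : 2 * (L : ℤ) ≤ 2 * L * m := by nlinarith [show 1 ≤ m by omega]
  rw [h4, cellSign_add_mul, cellSign, h5, if_neg (by omega), if_neg (by omega)]

variable {S : Type*} [TopologicalSpace S] [ChartedSpace Plane S] [IsManifold (𝓡 2) ∞ S] [T2Space S]
  {Ω : AreaForm S} {d : ℕ} {Ψ : (ℝ × ℝ) × Param d → S} {δ σ θ : ℝ}

section Orbit

variable {f : Family Ω d} {χ : ℝ → ℝ} {L n : ℕ} {p : ℤ}

theorem cellCenter_add {M : ℕ} (j i : ℤ) (x : ℝ) (hx : (i : ℝ) / M = x) :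
    cellCenter M (j + i) = ((cellCenter M j).1 + x, 0) := by
  simp only [cellCenter, ← hx]
  ext <;> simp
  ring

/-- The number of cells is chosen for this: `2Lp` cells of width `1 / (2Ln)` make up the rotation by
`p / n`. -/
theorem cellCenter_orbit (hL : 0 < L) (hn : 0 < n) (j : ℤ) (i : ℕ) :
    cellCenter (2 * L * n) (j + 2 * L * ((i + 1 : ℕ) * p)) =
      ((cellCenter (2 * L * n) (j + 2 * L * (i * p))).1 + (p : ℝ) / n, 0) := by
  have h : j + 2 * L * ((i + 1 : ℕ) * p) = (j + 2 * L * (i * p)) + 2 * L * p := by push_cast; ring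
  rw [h]
  refine cellCenter_add _ _ _ ?_
  have h1 : (L : ℝ) ≠ 0 := by positivity
  have h2 : (n : ℝ) ≠ 0 := by positivity
  push_cast
  field_simp

theorem map_orbit (h : IsTwistAnnulus f Ψ δ σ ((p : ℝ) / n)) (hL : 0 < L) (hn : 0 < n)
    (hφ : IsStripFlow (cellSpin χ (2 * L * n) (cellSign L n)) δ) (s : ℝ) (μ : disk d) (j : ℤ)
    (i : ℕ) :
    (perturb h.annulus hφ f s).map μ (Ψ (cellCenter (2 * L * n) (j + 2 * L * (i * p)), μ)) =
      Ψ (cellCenter (2 * L * n) (j + 2 * L * ((i + 1 : ℕ) * p)), μ) := by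
  have hM : 0 < 2 * L * n := by positivity
  rw [perturb_map, transplant_apply h.annulus hφ s μ.2 (h.annulus.cellCenter_mem _ _),
    cellSpin_cellCenter hM, cellCenter_orbit hL hn]
  exact h.rotation μ _

theorem mfderiv_orbit (h : IsTwistAnnulus f Ψ δ σ ((p : ℝ) / n)) (hχ : ContDiff ℝ ∞ χ)
    (hχ1 : χ 0 = 1) (hL : 0 < L) (hn : 0 < n)
    (hφ : IsStripFlow (cellSpin χ (2 * L * n) (cellSign L n)) δ) (s : ℝ) (μ : disk d) (j : ℤ)
    (i : ℕ) {a : ℝ}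
    (ha : ∀ v : ℝ × ℝ, (mfderiv (𝓡 2) (𝓡 2) (f.map μ)
      (Ψ (((cellCenter (2 * L * n) (j + 2 * L * (i * p))).1, 0), μ)) : Plane →L[ℝ] Plane)
      (sliceDeriv Ψ μ ((cellCenter (2 * L * n) (j + 2 * L * (i * p))).1, 0) v) =
      sliceDeriv Ψ μ ((cellCenter (2 * L * n) (j + 2 * L * (i * p))).1 + (p : ℝ) / n, 0)
        (v.1 + a * v.2, v.2)) {c : ℝ} (hc : cellSign L n (j + 2 * L * (i * p)) = c) (v : ℝ × ℝ) :
    (mfderiv (𝓡 2) (𝓡 2) ((perturb h.annulus hφ f s).map μ)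
      (Ψ (cellCenter (2 * L * n) (j + 2 * L * (i * p)), μ)) : Plane →L[ℝ] Plane)
      (sliceDeriv Ψ μ (cellCenter (2 * L * n) (j + 2 * L * (i * p))) v) =
    sliceDeriv Ψ μ (cellCenter (2 * L * n) (j + 2 * L * ((i + 1 : ℕ) * p)))
      (Real.cos (s * c) * v.1 - Real.sin (s * c) * v.2 +
        a * (Real.sin (s * c) * v.1 + Real.cos (s * c) * v.2),
        Real.sin (s * c) * v.1 + Real.cos (s * c) * v.2) := by
  have hM : 0 < 2 * L * n := by positivity
  rw [mfderiv_perturb h.annulus hφ f s μ (h.annulus.cellCenter_mem _ _), cellSpin_cellCenter hM,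
    fderiv_cellSpin_cellCenter hχ hχ1 hM, hc, cellCenter_orbit hL hn]
  exact ha _

theorem eq_of_cellCenter_eq_add {M : ℕ} (hM : 0 < M) {j j' : ℤ} {k : ℤ}
    (h : cellCenter M j' = ((cellCenter M j).1 + k, (cellCenter M j).2)) : j' = j + M * k := by
  have hM' : (M : ℝ) ≠ 0 := by positivity
  have h1 := congrArg Prod.fst h
  simp only [cellCenter] at h1
  field_simp at h1
  have h2 : (j' : ℝ) = j + M * k := by linarith
  exact_mod_cast h2

/-- The centres are fixed by the local rotations, so they follow the rigid rotation; a return at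
time `i` means `n ∣ i p`, that is `n ∣ i`. -/
theorem minimalPeriod_orbit (h : IsTwistAnnulus f Ψ δ σ ((p : ℝ) / n)) (hL : 0 < L) (hn : 0 < n)
    (hpn : IsCoprime p (n : ℤ))
    (hφ : IsStripFlow (cellSpin χ (2 * L * n) (cellSign L n)) δ) (s : ℝ) (μ : disk d) (j : ℤ) :
    Function.minimalPeriod ((perturb h.annulus hφ f s).map μ)
      (Ψ (cellCenter (2 * L * n) j, μ)) = n := by
  have hM : 0 < 2 * L * n := by positivity
  have hit : ∀ i : ℕ, ((perturb h.annulus hφ f s).map μ)^[i] (Ψ (cellCenter (2 * L * n) j, μ)) =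
      Ψ (cellCenter (2 * L * n) (j + 2 * L * (i * p)), μ) := fun i => by
    induction i with
    | zero => simp
    | succ i ih => rw [Function.iterate_succ_apply', ih, map_orbit h hL hn]
  refine minimalPeriod_of_iterate_eq_iff fun i => ?_
  rw [hit, eq_comm, h.annulus.eq_iff μ μ.2 _ (h.annulus.cellCenter_mem _ _) _
      (h.annulus.cellCenter_mem _ _)]
  constructor
  · rintro ⟨k, hk⟩
    have h1 := eq_of_cellCenter_eq_add hM hk
    have h2 : (2 * L : ℤ) * (i * p) = 2 * L * (n * k) := by push_cast at h1; linarith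
    have h3 : (i : ℤ) * p = n * k := mul_left_cancel₀ (by positivity) h2
    have h4 : (n : ℤ) ∣ i := hpn.symm.dvd_of_dvd_mul_right ⟨k, h3⟩
    exact_mod_cast h4
  · rintro ⟨k, rfl⟩
    refine ⟨k * p, ?_⟩
    refine cellCenter_add _ _ _ ?_
    have h1 : (L : ℝ) ≠ 0 := by positivity
    have h2 : (n : ℝ) ≠ 0 := by positivity
    push_cast
    field_simp

/-- Along the orbit the shears add up to a shear by `A = ∑ a i`, preceded by the single rotation by
`α`. Their product has determinant `1` and trace `2 cos α + A sin α`. The bounds on `A` are sums of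
those on the `a i`, hence independent of `μ` and `s`. -/
theorem trace_orbit (h : IsTwistAnnulus f Ψ δ σ ((p : ℝ) / n)) (hχ : ContDiff ℝ ∞ χ)
    (hχ1 : χ 0 = 1) (hL : 0 < L) (hn : 0 < n) (hpn : IsCoprime p (n : ℤ))
    (hφ : IsStripFlow (cellSpin χ (2 * L * n) (cellSign L n)) δ) {j : ℕ} (hj : j < 2 * L) :
    ∃ lo > 0, ∃ hi, ∀ (μ : disk d) (s : ℝ), ∃ A ∈ Icc lo hi, ∀ z : ℂ,
      IsComplexEigenvalue (iterDeriv ((perturb h.annulus hφ f s).map μ) n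
        (Ψ (cellCenter (2 * L * n) j, μ))) z →
      z ^ 2 - (2 * Real.cos (s * cellSign L n j) + A * Real.sin (s * cellSign L n j) : ℝ) * z + 1
        = 0 := by
  have hM : 0 < 2 * L * n := by positivity
  set c : ℕ → ℝ × ℝ := fun i => cellCenter (2 * L * n) (j + 2 * L * (i * p)) with hc
  choose lo hlo hi hb using fun i => h.twist (c i).1
  refine ⟨∑ i ∈ Finset.range n, lo i, Finset.sum_pos (fun i _ => hlo i) ⟨0, by simpa using hn⟩,
    ∑ i ∈ Finset.range n, hi i, fun μ s => ?_⟩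
  choose a ha hv using fun i => hb i μ
  refine ⟨∑ i ∈ Finset.range n, a i,
    ⟨Finset.sum_le_sum fun i _ => (ha i).1, Finset.sum_le_sum fun i _ => (ha i).2⟩, fun z hz => ?_⟩
  set g := (perturb h.annulus hφ f s).map μ with hg
  set α := s * cellSign L n j with hα
  have hc0 : c 0 = cellCenter (2 * L * n) j := by simp [hc]
  have hcn : c n = ((c 0).1 + (p : ℤ), (c 0).2) := by
    rw [hc0]
    refine cellCenter_add _ _ _ ?_
    have h1 : (L : ℝ) ≠ 0 := by positivity
    have h2 : (n : ℝ) ≠ 0 := by positivity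
    push_cast
    field_simp
  obtain ⟨m, rfl⟩ : ∃ m, n = m + 1 := ⟨n - 1, by omega⟩
  have key := mfderiv_iterate_of_orbit (g := g) g.contMDiff (x := fun i => Ψ (c i, μ))
    (fun i => map_orbit h hL hn hφ s μ j i) (ι := fun i => sliceDeriv Ψ μ (c i)) (a := a)
    (R := fun v => (Real.cos α * v.1 - Real.sin α * v.2, Real.sin α * v.1 + Real.cos α * v.2))
    (n := m + 1)
    (fun v => mfderiv_orbit h hχ hχ1 hL hn hφ s μ j 0 (hv 0) (by simp) v)
    (fun i hi hin v => by
      refine (mfderiv_orbit h hχ hχ1 hL hn hφ s μ j i (hv i) (cellSign_orbit hpn hj hi hin)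
          v).trans ?_
      rw [mul_zero, Real.cos_zero, Real.sin_zero]
      simp only [one_mul, zero_mul, sub_zero, zero_add]
      rfl) m (by omega)
  -- On the universal cover the orbit ends at its start translated by `p`. The frames at both ends
  -- agree, so the derivative becomes a matrix in one frame.
  have hsd : sliceDeriv Ψ μ (c (m + 1)) = sliceDeriv Ψ μ (c 0) := by
    rw [hcn]
    exact h.annulus.sliceDeriv_translate μ.2 (h.annulus.core_mem _) p
  simp only [hsd] at key
  set A := ∑ i ∈ Finset.range (m + 1), a i with hA
  have h3 := quadratic_of_isComplexEigenvalue (A := iterDeriv g (m + 1) (Ψ (c 0, μ)))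
    (ι := sliceDeriv Ψ μ (c 0))
    ⟨h.annulus.injective_sliceDeriv μ.2 (h.annulus.core_mem _),
      h.annulus.surjective_sliceDeriv μ.2 (h.annulus.core_mem _)⟩
    (a := Real.cos α + A * Real.sin α) (b := A * Real.cos α - Real.sin α) (c := Real.sin α)
    (d := Real.cos α) (fun v => by
      rw [key v]
      congr 1
      ext <;> simp
      ring) (z := z) (by rw [hc0]; exact hz)
  rw [show (Real.cos α + A * Real.sin α) * Real.cos α -
    (A * Real.cos α - Real.sin α) * Real.sin α = 1 by
      linear_combination Real.sin_sq_add_cos_sq α] at h3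
  rw [show 2 * Real.cos α + A * Real.sin α = Real.cos α + A * Real.sin α + Real.cos α by ring]
  simpa using h3

end Orbit

theorem encard_ge_of_injOn {X : Type*} {s : Set X} {L : ℕ} {x : ℕ → X}
    (hx : ∀ j < L, ∀ j' < L, x j = x j' → j = j') (hs : ∀ j < L, x j ∈ s) :
    ((L : ℕ) : ℕ∞) ≤ s.encard := by
  have h1 : InjOn x (Finset.range L : Set ℕ) := fun j hj j' hj' hjj =>
    hx j (by simpa using hj) j' (by simpa using hj') hjj
  have h2 : (x '' (Finset.range L : Set ℕ)).encard = L := by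
    rw [h1.encard_image, encard_coe_eq_coe_finsetCard, Finset.card_range]
  rw [← h2]
  refine encard_le_encard ?_
  rintro _ ⟨j, hj, rfl⟩
  exact hs j (by simpa using hj)

/-- One point per orbit is counted: the centres of the first `L` cells are hyperbolic, those of the
next `L` elliptic. Finitely many indices are involved and the trace bounds are uniform in `μ`, so a
single small `s` works. -/
theorem exists_many_periodic_points {f : Family Ω d} {n : ℕ} {p : ℤ}
    (h : IsTwistAnnulus f Ψ δ σ ((p : ℝ) / n)) (hn : 0 < n) (hpn : IsCoprime p (n : ℤ)) {L : ℕ}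
    (hL : 0 < L) {V : Set (Family Ω d)} (hV : V ∈ 𝓝 f) :
    ∃ g ∈ V, ∀ μ : disk d,
      (L : ℕ∞) ≤ min (hypPer (g.map μ) n).encard (ellPer (g.map μ) n).encard := by
  have hM : 0 < 2 * L * n := by positivity
  have hδ := h.annulus.pos
  obtain ⟨r, hr0, hr⟩ : ∃ r : ℝ, 0 < r ∧ r < min (1 / (2 * ((2 * L * n : ℕ) : ℝ))) δ :=
    exists_between (lt_min (by positivity) hδ)
  have hrM := hr.trans_le (min_le_left _ _)
  have hrδ := hr.trans_le (min_le_right _ _)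
  obtain ⟨χ, hχ, hχ1, hχ0⟩ : ∃ χ : ℝ → ℝ, ContDiff ℝ ∞ χ ∧ χ 0 = 1 ∧ ∀ s, r ^ 2 ≤ s → χ s = 0 := by
    -- The profile is a function of the squared radius, hence the radii `r ^ 2 / 2` and `r ^ 2`.
    let b : ContDiffBump (0 : ℝ) := ⟨r ^ 2 / 2, r ^ 2, by positivity, half_lt_self (by positivity)⟩
    refine ⟨b, b.contDiff, b.one_of_mem_closedBall (Metric.mem_closedBall_self b.rIn_pos.le),
      fun s hs => b.zero_of_le_dist ?_⟩
    rw [Real.dist_eq, sub_zero]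
    exact hs.trans (le_abs_self s)
  have hφ : IsStripFlow (cellSpin χ (2 * L * n) (cellSign L n)) δ :=
    isStripFlow_cellSpin hχ hM hr0 hrM hχ0 (cellSign_add_mul L n) hrδ
  have hinj : ∀ (μ : disk d) (j j' : ℕ), j < 2 * L → j' < 2 * L →
      Ψ (cellCenter (2 * L * n) j, μ) = Ψ (cellCenter (2 * L * n) j', μ) → j = j' := by
    intro μ j j' hj hj' hjj
    obtain ⟨k, hk⟩ := (h.annulus.eq_iff μ μ.2 _ (h.annulus.cellCenter_mem _ _) _
      (h.annulus.cellCenter_mem _ _)).1 hjj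
    have h1 := eq_of_cellCenter_eq_add hM hk
    have h2 : (2 * L : ℤ) ≤ (2 * L * n : ℕ) := by
      exact_mod_cast Nat.le_mul_of_pos_right (2 * L) hn
    -- Both indices lie in `[0, 2L)`, so they cannot differ by a nonzero multiple of `2Ln`.
    have h3 : k = 0 := by
      by_contra hk0
      rcases lt_or_gt_of_ne hk0 with h4 | h4
      · nlinarith [show k ≤ -1 by omega]
      · nlinarith [show 1 ≤ k by omega]
    rw [h3] at h1
    omega
  have hev : ∀ᶠ s in 𝓝[>] (0 : ℝ), ∀ j ∈ Finset.range (2 * L), ∀ μ : disk d, ∃ A : ℝ,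
      (2 < 2 * Real.cos s + A * Real.sin s ∧ |2 * Real.cos s - A * Real.sin s| < 2) ∧
      ∀ z : ℂ, IsComplexEigenvalue (iterDeriv ((perturb h.annulus hφ f s).map μ) n
        (Ψ (cellCenter (2 * L * n) j, μ))) z →
      z ^ 2 - (2 * Real.cos (s * cellSign L n j) + A * Real.sin (s * cellSign L n j) : ℝ) * z + 1
        = 0 := by
    rw [Finset.eventually_all]
    intro j hj
    obtain ⟨lo, hlo, hi, hA⟩ := trace_orbit h hχ hχ1 hL hn hpn hφ (Finset.mem_range.1 hj)
    filter_upwards [eventually_trace_bounds hlo hi] with s hs μ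
    obtain ⟨A, hA1, hA2⟩ := hA μ s
    exact ⟨A, hs A hA1, hA2⟩
  obtain ⟨s, hs, hsV⟩ := (hev.and (nhdsWithin_le_nhds
    (eventually_perturb_mem h.annulus hφ f hV))).exists
  refine ⟨perturb h.annulus hφ f s, hsV, fun μ => le_min ?_ ?_⟩
  · refine encard_ge_of_injOn (x := fun j => Ψ (cellCenter (2 * L * n) j, μ))
      (fun j hj j' hj' => hinj μ j j' (by omega) (by omega)) fun j hj => ?_
    have hper := minimalPeriod_orbit h hL hn hpn hφ s μ j
    refine ⟨Function.minimalPeriod_pos_iff_mem_periodicPts.1 (by rw [hper]; exact hn), hper, ?_⟩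
    intro z hz
    obtain ⟨A, hA1, hA2⟩ := hs j (Finset.mem_range.2 (by omega)) μ
    have h1 := hA2 z hz
    rw [cellSign_of_lt hn hj, mul_one] at h1
    exact norm_ne_one_of_quadratic hA1.1 h1
  · refine encard_ge_of_injOn (x := fun j => Ψ (cellCenter (2 * L * n) (L + j : ℕ), μ))
      (fun j hj j' hj' hjj => by
        have := hinj μ (L + j) (L + j') (by omega) (by omega) hjj
        omega) fun j hj => ?_
    have hper := minimalPeriod_orbit h hL hn hpn hφ s μ (L + j : ℕ)
    refine ⟨Function.minimalPeriod_pos_iff_mem_periodicPts.1 (by rw [hper]; exact hn), hper, ?_⟩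
    intro z hz
    obtain ⟨A, hA1, hA2⟩ := hs (L + j) (Finset.mem_range.2 (by omega)) μ
    have h1 := hA2 z hz
    rw [cellSign_add_of_lt hn hj, mul_neg, mul_one, Real.cos_neg, Real.sin_neg] at h1
    refine norm_eq_one_of_quadratic (τ := 2 * Real.cos s - A * Real.sin s) hA1.2 ?_
    rw [sub_eq_add_neg (2 * Real.cos s), ← mul_neg]
    exact h1

/-- For a prime `n`, coprimality to `n` only means non-divisibility, and of the two consecutive
integers `⌊nθ⌋`, `⌊nθ⌋ + 1` at least one is not divisible by `n`. -/
theorem exists_rational_near (θ : ℝ) {η : ℝ} (hη : 0 < η) (n₀ : ℕ) :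
    ∃ (n : ℕ) (p : ℤ), n₀ ≤ n ∧ 0 < n ∧ IsCoprime p (n : ℤ) ∧ |(p : ℝ) / n - θ| < η := by
  obtain ⟨m, hm⟩ := exists_nat_gt (1 / η)
  obtain ⟨n, hn, hprime⟩ := Nat.exists_infinite_primes (max n₀ (m + 1))
  have hn0 : (0 : ℝ) < n := Nat.cast_pos.2 hprime.pos
  have hmn : 1 / η < n := hm.trans_le (by
    exact_mod_cast (Nat.le_succ m).trans ((le_max_right _ _).trans hn))
  have hnη : 1 / (n : ℝ) < η := by
    rw [div_lt_iff₀ hn0]; rwa [div_lt_iff₀ hη, mul_comm] at hmn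
  have hint : Prime (n : ℤ) := Nat.prime_iff_prime_int.1 hprime
  obtain ⟨p, hp1, hp2, hpn⟩ : ∃ p : ℤ, n * θ - 1 ≤ p ∧ (p : ℝ) ≤ n * θ + 1 ∧ ¬ (n : ℤ) ∣ p := by
    have h1 := Int.floor_le (n * θ)
    have h2 := Int.lt_floor_add_one (n * θ)
    by_cases h : (n : ℤ) ∣ ⌊n * θ⌋
    · refine ⟨⌊n * θ⌋ + 1, by push_cast; linarith, by push_cast; linarith, fun h3 => ?_⟩
      have h4 : (n : ℤ) ∣ 1 := by simpa using dvd_sub h3 h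
      exact hint.not_dvd_one h4
    · exact ⟨⌊n * θ⌋, by linarith, by linarith, h⟩
  refine ⟨n, p, (le_max_left _ _).trans hn, hprime.pos,
    ((Prime.coprime_iff_not_dvd hint).2 hpn).symm, lt_of_le_of_lt ?_ hnη⟩
  have h3 : (p : ℝ) / n - θ = (p - n * θ) / n := by field_simp
  rw [h3, abs_div, abs_of_pos hn0]
  exact div_le_div_of_nonneg_right (abs_le.2 ⟨by linarith, by linarith⟩) hn0.le

theorem IsTwistAnnulus.exists_many_periodic_points {f : Family Ω d}
    (h : IsTwistAnnulus f Ψ δ σ θ) {V : Set (Family Ω d)} (hV : V ∈ 𝓝 f)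
    {γ : ℕ → ℕ} (hγ : ∀ n, 1 ≤ n → 0 < γ n) (n₀ : ℕ) :
    ∃ g ∈ V, ∃ n : ℕ, n₀ ≤ n ∧ ∀ μ : disk d,
      ((n * γ n : ℕ) : ℕ∞) ≤ min (hypPer (g.map μ) n).encard (ellPer (g.map μ) n).encard := by
  have hδ := h.annulus.pos
  let b : ContDiffBump (0 : ℝ) := ⟨δ / 4, δ / 2, by positivity, by linarith⟩
  have hb : ContDiff ℝ ∞ b := b.contDiff
  have hb0 : ∀ y, δ / 2 ≤ |y| → b y = 0 := fun y hy =>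
    b.zero_of_le_dist (by rwa [Real.dist_eq, sub_zero])
  have hb1 : (b : ℝ → ℝ) =ᶠ[𝓝 0] fun _ => 1 := b.eventuallyEq_one
  have hφ : IsStripFlow (twistFlow b) δ := isStripFlow_twistFlow hb (by linarith) hb0
  -- The first perturbation must land in an open set, to leave room for the second.
  have hV' : interior V ∈ 𝓝 f := interior_mem_nhds.2 hV
  obtain ⟨η, hη, hball⟩ := Metric.eventually_nhds_iff_ball.1
    (eventually_perturb_mem h.annulus hφ f hV')
  obtain ⟨n, p, hn, hn0, hpn, hpθ⟩ := exists_rational_near θ hη n₀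
  have h1 := h.perturb_twistFlow hb hφ hb1.self_of_nhds (by rw [hb1.deriv_eq]; simp)
      ((p : ℝ) / n - θ)
  rw [add_sub_cancel] at h1
  have h2 := hball ((p : ℝ) / n - θ) (by rwa [Metric.mem_ball, Real.dist_eq, sub_zero])
  obtain ⟨g, hg, hg'⟩ := KAMGrowth.exists_many_periodic_points h1 hn0 hpn
    -- The number of cells is free once `n` is fixed, which is why `γ` may grow arbitrarily fast.
    (L := n * γ n) (Nat.mul_pos hn0 (hγ n hn0)) (isOpen_interior.mem_nhds h2)
  exact ⟨g, interior_subset hg, n, hn, hg'⟩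

end KAMGrowth

/-! ### Smoothness of the area form along families of annuli. -/

namespace KAMGrowth

variable {S : Type*} [TopologicalSpace S] [ChartedSpace Plane S] [IsManifold (𝓡 2) ∞ S]

theorem contDiffOn_val (Ω : AreaForm S) {X : Type} [NormedAddCommGroup X] [NormedSpace ℝ X]
    {s : Set X} {b : X → S} {v w : X → Plane}
    (hv : ContMDiffOn 𝓘(ℝ, X) (𝓡 2).tangent ∞
      (fun x => (⟨b x, v x⟩ : TangentBundle (𝓡 2) S)) s)
    (hw : ContMDiffOn 𝓘(ℝ, X) (𝓡 2).tangent ∞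
      (fun x => (⟨b x, w x⟩ : TangentBundle (𝓡 2) S)) s) :
    ContDiffOn ℝ ∞ (fun x => Ω.val (b x) (v x) (w x)) s := by
  rw [← contMDiffOn_iff_contDiffOn]
  intro x hx
  have hb : ContMDiffWithinAt 𝓘(ℝ, X) (𝓡 2) ∞ b s x :=
    (Bundle.contMDiffWithinAt_totalSpace.1 (hv x hx)).1
  have h : ContMDiffWithinAt 𝓘(ℝ, X) ((𝓡 2).prod 𝓘(ℝ)) ∞
      (fun m => Bundle.TotalSpace.mk' ℝ (E := Bundle.Trivial S ℝ) (b m)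
        (Ω.form (b m) (v m) (w m))) s x := by
    apply ContMDiffWithinAt.clm_bundle_apply₂ (F₁ := Plane) (F₂ := Plane)
      (E₁ := fun p : S => TangentSpace (𝓡 2) p) (E₂ := fun p : S => TangentSpace (𝓡 2) p)
    · exact ContMDiffAt.comp_contMDiffWithinAt x Ω.contMDiff.contMDiffAt hb
    · exact hv x hx
    · exact hw x hx
  exact (Bundle.contMDiffWithinAt_totalSpace.1 h).2

variable {d : ℕ} {Φ : (ℝ × ℝ) × Param d → S} {U : Set (ℝ × ℝ)}

theorem uniqueDiffOn_prod_disk (hU : IsOpen U) : UniqueDiffOn ℝ (U ×ˢ disk d) :=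
  hU.uniqueDiffOn.prod (uniqueDiffOn_disk d)

theorem hasMFDerivAt_slice (hU : IsOpen U)
    (hΦ : ContMDiffOn 𝓘(ℝ, (ℝ × ℝ) × Param d) (𝓡 2) ∞ Φ (U ×ˢ disk d)) {μ : Param d}
    (hμ : μ ∈ disk d) {z : ℝ × ℝ} (hz : z ∈ U) :
    HasMFDerivAt 𝓘(ℝ, ℝ × ℝ) (𝓡 2) (fun z => Φ (z, μ)) z (sliceDeriv Φ μ z) :=
  (((contMDiffOn_slice hΦ hμ z hz).contMDiffAt (hU.mem_nhds hz)).mdifferentiableAt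
    (by simp)).hasMFDerivAt

theorem mfderivWithin_eq_sliceDeriv (hU : IsOpen U)
    (hΦ : ContMDiffOn 𝓘(ℝ, (ℝ × ℝ) × Param d) (𝓡 2) ∞ Φ (U ×ˢ disk d)) {w : (ℝ × ℝ) × Param d}
    (hw : w ∈ U ×ˢ disk d) (v : ℝ × ℝ) :
    (mfderivWithin 𝓘(ℝ, (ℝ × ℝ) × Param d) (𝓡 2) Φ (U ×ˢ disk d) w :
      (ℝ × ℝ) × Param d →L[ℝ] Plane) (v, 0) = sliceDeriv Φ w.2 w.1 v := by
  have h1 : HasMFDerivWithinAt 𝓘(ℝ, (ℝ × ℝ) × Param d) (𝓡 2) Φ (U ×ˢ disk d) w _ :=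
    ((hΦ w hw).mdifferentiableWithinAt (by simp)).hasMFDerivWithinAt
  have h2 : HasFDerivAt (fun z : ℝ × ℝ => (z, w.2)) (ContinuousLinearMap.inl ℝ (ℝ × ℝ) (Param d))
      w.1 :=
    (hasFDerivAt_id _).prodMk (hasFDerivAt_const _ _)
  have h3 : HasMFDerivWithinAt 𝓘(ℝ, ℝ × ℝ) (𝓡 2) (Φ ∘ fun z : ℝ × ℝ => (z, w.2)) U w.1 _ :=
    HasMFDerivWithinAt.comp w.1 h1 h2.hasMFDerivAt.hasMFDerivWithinAt fun z hz => ⟨hz, hw.2⟩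
  have h4 := hasMFDerivAt_unique (h3.hasMFDerivAt (hU.mem_nhds hw.1))
      (hasMFDerivAt_slice hU hΦ hw.2 hw.1)
  exact congrArg (fun A : (ℝ × ℝ) →L[ℝ] Plane => A v) h4

/-- The slice derivative is the full tangent map within `U ×ˢ disk d`, evaluated on vectors `(v, 0)`
with no parameter component. This gives smoothness in the parameter up to the boundary of the disk.
-/
theorem contMDiffOn_sliceDeriv (hU : IsOpen U)
    (hΦ : ContMDiffOn 𝓘(ℝ, (ℝ × ℝ) × Param d) (𝓡 2) ∞ Φ (U ×ˢ disk d)) (v : ℝ × ℝ) :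
    ContMDiffOn 𝓘(ℝ, (ℝ × ℝ) × Param d) (𝓡 2).tangent ∞
      (fun w => (⟨Φ w, sliceDeriv Φ w.2 w.1 v⟩ : TangentBundle (𝓡 2) S)) (U ×ˢ disk d) := by
  have h1 := hΦ.contMDiffOn_tangentMapWithin (m := ∞) (by simp)
    (uniqueDiffOn_prod_disk hU).uniqueMDiffOn
  have h2 : ContMDiffOn 𝓘(ℝ, (ℝ × ℝ) × Param d) 𝓘(ℝ, (ℝ × ℝ) × Param d).tangent ∞
      (fun w => (⟨w, (v, 0)⟩ : TangentBundle 𝓘(ℝ, (ℝ × ℝ) × Param d) ((ℝ × ℝ) × Param d)))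
      (U ×ˢ disk d) := fun w _ =>
    contMDiffWithinAt_vectorSpace_iff_contDiffWithinAt.2
      (contDiffWithinAt_const (c := ((v, 0) : (ℝ × ℝ) × Param d)))
  refine (h1.comp h2 fun w hw => hw).congr fun w hw => ?_
  exact congrArg (fun u : Plane => (⟨Φ w, u⟩ : TangentBundle (𝓡 2) S))
    (mfderivWithin_eq_sliceDeriv hU hΦ hw v).symm

end KAMGrowth

/-! ### Area-preserving coordinates on the annuli. -/

namespace KAMGrowth

section

variable {S : Type*} [TopologicalSpace S] [ChartedSpace Plane S] {d : ℕ}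

/-- A smooth family of embedded annuli, read on the universal cover. -/
structure IsAnnulus (Φ : (ℝ × ℝ) × Param d → S) : Prop where
  smooth : ContMDiffOn 𝓘(ℝ, (ℝ × ℝ) × Param d) (𝓡 2) ∞ Φ (strip 1 ×ˢ disk d)
  eq_iff : ∀ μ ∈ disk d, ∀ z ∈ strip 1, ∀ z' ∈ strip 1,
    Φ (z, μ) = Φ (z', μ) ↔ ∃ k : ℤ, z' = (z.1 + k, z.2)
  injective : ∀ μ ∈ disk d, ∀ z ∈ strip 1, Function.Injective (sliceDeriv Φ μ z)

namespace IsAnnulus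

variable {Φ : (ℝ × ℝ) × Param d → S}

theorem surjective_sliceDeriv (hΦ : IsAnnulus Φ) {μ : Param d} (hμ : μ ∈ disk d)
    {z : ℝ × ℝ} (hz : z ∈ strip 1) : Function.Surjective (sliceDeriv Φ μ z) :=
  (LinearMap.injective_iff_surjective_of_finrank_eq_finrank
    (f := (sliceDeriv Φ μ z : (ℝ × ℝ) →ₗ[ℝ] Plane)) (by simp)).1 (hΦ.injective μ hμ z hz)

end IsAnnulus

end

variable {S : Type*} [TopologicalSpace S] [ChartedSpace Plane S] [IsManifold (𝓡 2) ∞ S]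

/-- Alternating forms on a plane are multiples of the determinant. -/
theorem AreaForm.val_apply (Ω : AreaForm S) (p : S) (A : (ℝ × ℝ) →L[ℝ] Plane) (v w : ℝ × ℝ) :
    Ω.val p (A v) (A w) = Ω.val p (A (1, 0)) (A (0, 1)) * areaDet v w := by
  obtain ⟨B, hB⟩ : ∃ B : Plane →L[ℝ] Plane →L[ℝ] ℝ, ∀ x y, Ω.val p x y = B x y :=
    ⟨Ω.form p, fun _ _ => rfl⟩
  have halt : ∀ x, B x x = 0 := fun x => by rw [← hB]; exact Ω.alternating p x
  have hsymm : B (A (0, 1)) (A (1, 0)) = -B (A (1, 0)) (A (0, 1)) := by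
    have := halt (A (1, 0) + A (0, 1))
    simp only [map_add, add_apply, halt] at this
    linarith
  have hdec : ∀ u : ℝ × ℝ, A u = u.1 • A (1, 0) + u.2 • A (0, 1) := fun u => by
    rw [← map_smul, ← map_smul, ← map_add]; simp
  rw [hB, hB, hdec v, hdec w]
  simp only [map_add, map_smul, add_apply, smul_apply,
    smul_eq_mul, halt, hsymm, areaDet]
  ring

theorem AreaForm.val_ne_zero (Ω : AreaForm S) (p : S) {A : (ℝ × ℝ) →L[ℝ] Plane}
    (hA : Function.Surjective A) : Ω.val p (A (1, 0)) (A (0, 1)) ≠ 0 := by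
  intro h
  refine Ω.nonvanishing p (ContinuousLinearMap.ext fun x => ContinuousLinearMap.ext fun y => ?_)
  obtain ⟨v, rfl⟩ := hA x
  obtain ⟨w, rfl⟩ := hA y
  have := Ω.val_apply p A v w
  rw [h, zero_mul] at this
  exact this

variable {d : ℕ}

namespace IsAnnulus

variable {Φ : (ℝ × ℝ) × Param d → S}

theorem sliceDeriv_translate (hΦ : IsAnnulus Φ) {μ : Param d} (hμ : μ ∈ disk d) {z : ℝ × ℝ}
    (hz : z ∈ strip 1) (k : ℤ) : sliceDeriv Φ μ (z.1 + k, z.2) = sliceDeriv Φ μ z := by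
  have h1 : HasFDerivAt (fun z : ℝ × ℝ => (z.1 + (k : ℝ), z.2)) (ContinuousLinearMap.id ℝ (ℝ × ℝ))
      z := by
    have h0 : HasFDerivAt (fun z : ℝ × ℝ => z.1 + (k : ℝ)) (ContinuousLinearMap.fst ℝ ℝ ℝ) z :=
      hasFDerivAt_fst.add_const (k : ℝ)
    exact h0.prodMk hasFDerivAt_snd
  have h2 := HasMFDerivAt.comp z
    (hasMFDerivAt_slice (isOpen_strip 1) hΦ.smooth hμ (z := (z.1 + k, z.2)) ⟨trivial, hz.2⟩)
    h1.hasMFDerivAt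
  have h3 : (fun z : ℝ × ℝ => Φ (z, μ)) =ᶠ[𝓝 z]
      (fun z => Φ (z, μ)) ∘ fun z : ℝ × ℝ => (z.1 + (k : ℝ), z.2) := by
    filter_upwards [(isOpen_strip 1).mem_nhds hz] with z' hz'
    exact (hΦ.eq_iff μ hμ z' hz' (z'.1 + k, z'.2) ⟨trivial, hz'.2⟩).2 ⟨k, rfl⟩
  exact hasMFDerivAt_unique (h2.congr_of_eventuallyEq h3)
    (hasMFDerivAt_slice (isOpen_strip 1) hΦ.smooth hμ hz)

end IsAnnulus

/-- The density of the area form in the coordinates `Φ`. -/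
noncomputable def density (Ω : AreaForm S) (Φ : (ℝ × ℝ) × Param d → S) (w : (ℝ × ℝ) × Param d) :
    ℝ :=
  Ω.val (Φ w) (sliceDeriv Φ w.2 w.1 (1, 0)) (sliceDeriv Φ w.2 w.1 (0, 1))

section Density

variable {Φ : (ℝ × ℝ) × Param d → S} (Ω : AreaForm S)

theorem contDiffOn_density (hΦ : IsAnnulus Φ) :
    ContDiffOn ℝ ∞ (density Ω Φ) (strip 1 ×ˢ disk d) :=
  contDiffOn_val Ω (contMDiffOn_sliceDeriv (isOpen_strip 1) hΦ.smooth (1, 0))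
    (contMDiffOn_sliceDeriv (isOpen_strip 1) hΦ.smooth (0, 1))

theorem density_ne_zero (hΦ : IsAnnulus Φ) {w : (ℝ × ℝ) × Param d}
    (hw : w ∈ strip 1 ×ˢ disk d) : density Ω Φ w ≠ 0 :=
  Ω.val_ne_zero _ (hΦ.surjective_sliceDeriv hw.2 hw.1)

theorem density_translate (hΦ : IsAnnulus Φ) {μ : Param d} (hμ : μ ∈ disk d) {z : ℝ × ℝ}
    (hz : z ∈ strip 1) (k : ℤ) : density Ω Φ ((z.1 + k, z.2), μ) = density Ω Φ (z, μ) := by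
  have h1 : Φ ((z.1 + k, z.2), μ) = Φ (z, μ) :=
    ((hΦ.eq_iff μ hμ z hz (z.1 + k, z.2) ⟨trivial, hz.2⟩).2 ⟨k, rfl⟩).symm
  simp only [density]
  rw [h1, hΦ.sliceDeriv_translate hμ hz]

theorem convex_strip_prod_disk (δ : ℝ) : Convex ℝ (strip δ ×ˢ disk d) :=
  (convex_univ.prod (convex_Ioo _ _)).prod (convex_closedBall _ _)

/-- A nonvanishing continuous function on a convex set has constant sign. The sign becomes the
constant `σ` of the new coordinates. -/
theorem exists_density_sign (hΦ : IsAnnulus Φ) :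
    ∃ σ : ℝ, σ * σ = 1 ∧ ∀ w ∈ strip 1 ×ˢ disk d, 0 < σ * density Ω Φ w := by
  have hpre := (convex_strip_prod_disk (d := d) 1).isPreconnected.image _
    (contDiffOn_density Ω hΦ).continuousOn
  have hord := hpre.ordConnected
  set w₀ : (ℝ × ℝ) × Param d := ((0, 0), 0) with hw₀
  have hw₀m : w₀ ∈ strip 1 ×ˢ disk d :=
    ⟨⟨trivial, by norm_num, by norm_num⟩, Metric.mem_closedBall_self zero_le_one⟩
  have hzero : ∀ a ∈ strip 1 ×ˢ disk d, ∀ b ∈ strip 1 ×ˢ disk d,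
      density Ω Φ a < 0 → 0 < density Ω Φ b → False := by
    intro a ha b hb h1 h2
    obtain ⟨c, hc, hc'⟩ := hord.out (mem_image_of_mem _ ha) (mem_image_of_mem _ hb) ⟨h1.le, h2.le⟩
    exact density_ne_zero Ω hΦ hc hc'
  rcases lt_or_gt_of_ne (density_ne_zero Ω hΦ hw₀m) with h | h
  · refine ⟨-1, by norm_num, fun w hw => ?_⟩
    rcases lt_or_gt_of_ne (density_ne_zero Ω hΦ hw) with h' | h'
    · linarith
    · exact (hzero _ hw₀m _ hw h h').elim
  · refine ⟨1, by norm_num, fun w hw => ?_⟩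
    rcases lt_or_gt_of_ne (density_ne_zero Ω hΦ hw) with h' | h'
    · exact (hzero _ hw _ hw₀m h' h).elim
    · linarith

end Density

/-- The integral of `ρ` over the vertical segment from `(x, 0)` to `(x, y)`. -/
noncomputable def verticalIntegral (ρ : (ℝ × ℝ) × Param d → ℝ) (w : (ℝ × ℝ) × Param d) : ℝ :=
  -- Rescaling to the fixed interval `[0, 1]` makes `contDiffOn_integral_zero_one` applicable.
  ∫ t in (0 : ℝ)..1, w.1.2 * ρ ((w.1.1, t * w.1.2), w.2)

section VerticalIntegral

variable {ρ : (ℝ × ℝ) × Param d → ℝ}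

theorem contDiffOn_verticalIntegral (hρ : ContDiffOn ℝ ∞ ρ (strip 1 ×ˢ disk d)) :
    ContDiffOn ℝ ∞ (verticalIntegral ρ) (strip 1 ×ˢ disk d) := by
  refine contDiffOn_integral_zero_one (convex_strip_prod_disk 1)
    (uniqueDiffOn_prod_disk (isOpen_strip 1))
    (F := fun q : ((ℝ × ℝ) × Param d) × ℝ => q.1.1.2 * ρ ((q.1.1.1, q.2 * q.1.1.2), q.1.2)) ?_
  have h1 : ContDiff ℝ ∞ (fun q : ((ℝ × ℝ) × Param d) × ℝ =>
      ((q.1.1.1, q.2 * q.1.1.2), q.1.2)) := by fun_prop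
  have h2 : ContDiff ℝ ∞ (fun q : ((ℝ × ℝ) × Param d) × ℝ => q.1.1.2) := by fun_prop
  have hm : MapsTo (fun q : ((ℝ × ℝ) × Param d) × ℝ => ((q.1.1.1, q.2 * q.1.1.2), q.1.2))
      ((strip 1 ×ˢ disk d) ×ˢ Icc 0 1) (strip 1 ×ˢ disk d) := by
    rintro ⟨⟨z, μ⟩, t⟩ ⟨⟨hz, hμ⟩, ht⟩
    refine ⟨mem_strip.2 ?_, hμ⟩
    dsimp only
    rw [abs_mul, abs_of_nonneg ht.1]
    exact (mul_le_of_le_one_left (abs_nonneg _) ht.2).trans_lt (mem_strip.1 hz)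
  exact h2.contDiffOn.mul (hρ.comp h1.contDiffOn hm)

theorem verticalIntegral_eq (x y : ℝ) (μ : Param d) :
    verticalIntegral ρ ((x, y), μ) = ∫ u in (0 : ℝ)..y, ρ ((x, u), μ) := by
  simp only [verticalIntegral]
  rw [intervalIntegral.integral_const_mul, intervalIntegral.mul_integral_comp_mul_right
    (f := fun u => ρ ((x, u), μ))]
  simp

theorem hasDerivAt_verticalIntegral (hρ : ContDiffOn ℝ ∞ ρ (strip 1 ×ˢ disk d)) (x : ℝ) {y : ℝ}
    (hy : y ∈ Ioo (-1 : ℝ) 1) {μ : Param d} (hμ : μ ∈ disk d) :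
    HasDerivAt (fun y => verticalIntegral ρ ((x, y), μ)) (ρ ((x, y), μ)) y := by
  simp only [verticalIntegral_eq]
  have hc : ContinuousOn (fun u : ℝ => ρ ((x, u), μ)) (Ioo (-1) 1) :=
    hρ.continuousOn.comp (by fun_prop) fun u hu => ⟨⟨trivial, hu⟩, hμ⟩
  have hsub : uIcc 0 y ⊆ Ioo (-1 : ℝ) 1 :=
    (ordConnected_Ioo).uIcc_subset (by norm_num) hy
  exact intervalIntegral.integral_hasDerivAt_right ((hc.mono hsub).intervalIntegrable)
    (hc.stronglyMeasurableAtFilter isOpen_Ioo y hy) (hc.continuousAt (isOpen_Ioo.mem_nhds hy))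

theorem verticalIntegral_zero (x : ℝ) (μ : Param d) : verticalIntegral ρ ((x, 0), μ) = 0 := by
  rw [verticalIntegral_eq, intervalIntegral.integral_same]

theorem verticalIntegral_translate
    (hρk : ∀ μ ∈ disk d, ∀ z ∈ strip 1, ∀ k : ℤ, ρ ((z.1 + k, z.2), μ) = ρ (z, μ))
    {μ : Param d} (hμ : μ ∈ disk d) {z : ℝ × ℝ} (hz : z ∈ strip 1) (k : ℤ) :
    verticalIntegral ρ ((z.1 + k, z.2), μ) = verticalIntegral ρ (z, μ) := by
  simp only [verticalIntegral]
  refine intervalIntegral.integral_congr fun t ht => ?_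
  rw [uIcc_of_le zero_le_one] at ht
  rw [hρk μ hμ (z.1, t * z.2) ?_ k]
  refine mem_strip.2 ?_
  rw [abs_mul, abs_of_nonneg ht.1]
  exact (mul_le_of_le_one_left (abs_nonneg _) ht.2).trans_lt (mem_strip.1 hz)

theorem strictMonoOn_verticalIntegral (hρ : ContDiffOn ℝ ∞ ρ (strip 1 ×ˢ disk d))
    (hpos : ∀ w ∈ strip 1 ×ˢ disk d, 0 < ρ w) (x : ℝ) {μ : Param d} (hμ : μ ∈ disk d) :
    StrictMonoOn (fun y => verticalIntegral ρ ((x, y), μ)) (Ioo (-1) 1) := by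
  refine strictMonoOn_of_deriv_pos (convex_Ioo _ _)
    (fun y hy => (hasDerivAt_verticalIntegral hρ x hy hμ).continuousAt.continuousWithinAt)
    fun y hy => ?_
  rw [interior_Ioo] at hy
  rw [(hasDerivAt_verticalIntegral hρ x hy hμ).deriv]
  exact hpos _ ⟨⟨trivial, hy⟩, hμ⟩

/-- The map that replaces the vertical coordinate by the vertical integral of `ρ`. -/
noncomputable def straighten (ρ : (ℝ × ℝ) × Param d → ℝ) (w : (ℝ × ℝ) × Param d) : ℝ × ℝ :=
  (w.1.1, verticalIntegral ρ w)

/-- The derivative is triangular with determinant `ρ`. On the core the off-diagonal entry vanishes,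
since the vertical integral is identically zero there. -/
theorem hasFDerivAt_straighten (hρ : ContDiffOn ℝ ∞ ρ (strip 1 ×ˢ disk d)) {μ : Param d}
    (hμ : μ ∈ disk d) {z : ℝ × ℝ} (hz : z ∈ strip 1) :
    ∃ (A : (ℝ × ℝ) →L[ℝ] (ℝ × ℝ)) (b : ℝ),
      HasFDerivAt (fun z => straighten ρ (z, μ)) A z ∧
      (∀ v : ℝ × ℝ, A v = (v.1, b * v.1 + ρ (z, μ) * v.2)) ∧ (z.2 = 0 → b = 0) := by
  have h1 : ContDiffOn ℝ ∞ (fun z => verticalIntegral ρ (z, μ)) (strip 1) :=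
    (contDiffOn_verticalIntegral hρ).comp (by fun_prop) fun z hz => ⟨hz, hμ⟩
  have h2 : HasFDerivAt (fun z => verticalIntegral ρ (z, μ)) _ z :=
    ((h1.contDiffAt ((isOpen_strip 1).mem_nhds hz)).differentiableAt (by simp)).hasFDerivAt
  set T := fderiv ℝ (fun z => verticalIntegral ρ (z, μ)) z with hT
  have h3 : T (0, 1) = ρ (z, μ) := by
    have h4 : HasDerivAt (fun y : ℝ => (z.1, y)) ((0 : ℝ), (1 : ℝ)) z.2 :=
      (hasDerivAt_const _ _).prodMk (hasDerivAt_id _)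
    have h5 : HasDerivAt (fun y => verticalIntegral ρ ((z.1, y), μ)) (T (0, 1)) z.2 :=
      HasFDerivAt.comp_hasDerivAt (f := fun y : ℝ => (z.1, y)) z.2 h2 h4
    exact h5.unique (hasDerivAt_verticalIntegral hρ z.1 hz.2 hμ)
  refine ⟨(ContinuousLinearMap.fst ℝ ℝ ℝ).prod T, T (1, 0), hasFDerivAt_fst.prodMk h2,
    fun v => Prod.ext rfl ?_, fun h0 => ?_⟩
  · have h5 : T v = v.1 • T (1, 0) + v.2 • T (0, 1) := by
      rw [← map_smul, ← map_smul, ← map_add]; simp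
    change T v = _
    rw [h5, h3, smul_eq_mul, smul_eq_mul]; ring
  · have h4 : HasDerivAt (fun x : ℝ => (x, z.2)) ((1 : ℝ), (0 : ℝ)) z.1 :=
      (hasDerivAt_id _).prodMk (hasDerivAt_const _ _)
    have h6 : (fun z => verticalIntegral ρ (z, μ)) ∘ (fun x : ℝ => (x, z.2)) = fun _ => 0 := by
      funext x
      simp only [Function.comp_apply]
      rw [h0]; exact verticalIntegral_zero x μ
    have h7 := HasFDerivAt.comp_hasDerivAt z.1 h2 h4
    rw [h6] at h7
    exact h7.unique (hasDerivAt_const _ _)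

theorem injOn_straighten (hρ : ContDiffOn ℝ ∞ ρ (strip 1 ×ˢ disk d))
    (hpos : ∀ w ∈ strip 1 ×ˢ disk d, 0 < ρ w) {μ : Param d} (hμ : μ ∈ disk d) :
    InjOn (fun z => straighten ρ (z, μ)) (strip 1) := by
  rintro ⟨x, y⟩ hz ⟨x', y'⟩ hz' h
  have h1 : x = x' := congrArg Prod.fst h
  subst h1
  exact Prod.ext rfl ((strictMonoOn_verticalIntegral hρ hpos x hμ).injOn hz.2 hz'.2
    (congrArg Prod.snd h))

/-- By periodicity and compactness the integral up to height `1/2` is bounded below by a positive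
constant, and that down to `-1/2` above by a negative one. The intermediate value theorem fills in
the heights between. -/
theorem exists_straighten_width (hρ : ContDiffOn ℝ ∞ ρ (strip 1 ×ˢ disk d))
    (hpos : ∀ w ∈ strip 1 ×ˢ disk d, 0 < ρ w)
    (hρk : ∀ μ ∈ disk d, ∀ z ∈ strip 1, ∀ k : ℤ, ρ ((z.1 + k, z.2), μ) = ρ (z, μ)) :
    ∃ δ > 0, ∀ z ∈ strip δ, ∀ μ ∈ disk d, ∃ z' ∈ strip 1, straighten ρ (z', μ) = z := by
  have hc := (contDiffOn_verticalIntegral hρ).continuousOn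
  have hK : IsCompact (Icc (0 : ℝ) 1 ×ˢ disk d) :=
    isCompact_Icc.prod (isCompact_closedBall 0 1)
  have hne : (Icc (0 : ℝ) 1 ×ˢ disk d).Nonempty :=
    ⟨(0, 0), by simp, Metric.mem_closedBall_self zero_le_one⟩
  have hcy : ∀ y ∈ Ioo (-1 : ℝ) 1, ContinuousOn
      (fun q : ℝ × Param d => verticalIntegral ρ ((q.1, y), q.2)) (Icc (0 : ℝ) 1 ×ˢ disk d) :=
    fun y hy => hc.comp (by fun_prop) fun q hq => ⟨⟨trivial, hy⟩, hq.2⟩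
  have hfract : ∀ (x : ℝ) (y : ℝ), y ∈ Ioo (-1 : ℝ) 1 → ∀ μ ∈ disk d,
      verticalIntegral ρ ((x, y), μ) = verticalIntegral ρ ((Int.fract x, y), μ) := by
    intro x y hy μ hμ
    have := verticalIntegral_translate hρk hμ (z := (Int.fract x, y)) ⟨trivial, hy⟩ ⌊x⌋
    rwa [Int.fract_add_floor] at this
  have hp : (1 / 2 : ℝ) ∈ Ioo (-1 : ℝ) 1 := by norm_num
  have hm : (-(1 / 2) : ℝ) ∈ Ioo (-1 : ℝ) 1 := by norm_num
  have h0 : (0 : ℝ) ∈ Ioo (-1 : ℝ) 1 := by norm_num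
  obtain ⟨q₁, hq₁, hmin₁⟩ := hK.exists_isMinOn hne (hcy _ hp)
  obtain ⟨q₂, hq₂, hmax₂⟩ := hK.exists_isMaxOn hne (hcy _ hm)
  have h1 : 0 < verticalIntegral ρ ((q₁.1, 1 / 2), q₁.2) := by
    rw [← verticalIntegral_zero q₁.1 q₁.2]
    exact strictMonoOn_verticalIntegral hρ hpos q₁.1 hq₁.2 h0 hp (by norm_num)
  have h2 : verticalIntegral ρ ((q₂.1, -(1 / 2)), q₂.2) < 0 := by
    rw [← verticalIntegral_zero q₂.1 q₂.2]
    exact strictMonoOn_verticalIntegral hρ hpos q₂.1 hq₂.2 hm h0 (by norm_num)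
  refine ⟨min (verticalIntegral ρ ((q₁.1, 1 / 2), q₁.2))
    (-verticalIntegral ρ ((q₂.1, -(1 / 2)), q₂.2)), lt_min h1 (neg_pos.2 h2), ?_⟩
  rintro ⟨x, s⟩ ⟨_, hs1, hs2⟩ μ hμ
  have hx : (Int.fract x, μ) ∈ Icc (0 : ℝ) 1 ×ˢ disk d :=
    ⟨⟨Int.fract_nonneg x, (Int.fract_lt_one x).le⟩, hμ⟩
  have h3 : s < verticalIntegral ρ ((x, 1 / 2), μ) := by
    rw [hfract x _ hp μ hμ]
    exact (hs2.trans_le (min_le_left _ _)).trans_le (hmin₁ hx)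
  have h4 : verticalIntegral ρ ((x, -(1 / 2)), μ) < s := by
    rw [hfract x _ hm μ hμ]
    refine lt_of_le_of_lt (hmax₂ hx) ?_
    have := min_le_right (verticalIntegral ρ ((q₁.1, 1 / 2), q₁.2))
      (-verticalIntegral ρ ((q₂.1, -(1 / 2)), q₂.2))
    dsimp only at hs1 ⊢
    linarith
  have hsub : Icc (-(1 / 2) : ℝ) (1 / 2) ⊆ Ioo (-1) 1 := Icc_subset_Ioo (by norm_num) (by norm_num)
  have hcont : ContinuousOn (fun y => verticalIntegral ρ ((x, y), μ)) (Icc (-(1 / 2)) (1 / 2)) :=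
    fun y hy => (hasDerivAt_verticalIntegral hρ x (hsub hy) hμ).continuousAt.continuousWithinAt
  obtain ⟨y, hy, hys⟩ := intermediate_value_Icc (by norm_num) hcont ⟨h4.le, h3.le⟩
  exact ⟨(x, y), ⟨trivial, hsub hy⟩, Prod.ext rfl hys⟩

/-- Injectivity of `straighten` forces `G` to coincide locally with the smooth inverse of
`exists_local_inverse_within`. -/
theorem contDiffOn_straighten_inverse (hρ : ContDiffOn ℝ ∞ ρ (strip 1 ×ˢ disk d))
    (hpos : ∀ w ∈ strip 1 ×ˢ disk d, 0 < ρ w) {δ : ℝ} {G : (ℝ × ℝ) × Param d → ℝ × ℝ}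
    (hG : ∀ w ∈ strip δ ×ˢ disk d, G w ∈ strip 1 ∧ straighten ρ (G w, w.2) = w.1) :
    ContDiffOn ℝ ∞ G (strip δ ×ˢ disk d) := by
  rintro ⟨z, μ⟩ hw
  obtain ⟨h1, h2⟩ := hG _ hw
  obtain ⟨A, b, hA, hAv, -⟩ := hasFDerivAt_straighten hρ hw.2 h1
  have hρ0 : ρ (G (z, μ), μ) ≠ 0 := (hpos (G (z, μ), μ) ⟨h1, hw.2⟩).ne'
  have hAinj : Function.Injective A := by
    rw [injective_iff_map_eq_zero]
    intro v hv
    rw [hAv] at hv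
    have h3 : v.1 = 0 := congrArg Prod.fst hv
    have h4 : b * v.1 + ρ (G (z, μ), μ) * v.2 = 0 := congrArg Prod.snd hv
    rw [h3, mul_zero, zero_add] at h4
    exact Prod.ext h3 ((mul_eq_zero.1 h4).resolve_left hρ0)
  set L : (ℝ × ℝ) ≃L[ℝ] (ℝ × ℝ) :=
    (LinearEquiv.ofInjectiveEndo (A : (ℝ × ℝ) →ₗ[ℝ] (ℝ × ℝ)) hAinj).toContinuousLinearEquiv with hL
  have hLA : (L : (ℝ × ℝ) →L[ℝ] (ℝ × ℝ)) = A := by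
    ext <;> rfl
  have hZ : ContDiffOn ℝ ∞ (straighten ρ) (strip 1 ×ˢ univ ∩ univ ×ˢ disk d) := by
    have h3 : strip 1 ×ˢ univ ∩ univ ×ˢ disk d = strip 1 ×ˢ disk d := by
      rw [prod_inter_prod, inter_univ, univ_inter]
    rw [h3]
    have h4 : ContDiffOn ℝ ∞ (fun w : (ℝ × ℝ) × Param d => w.1.1) (strip 1 ×ˢ disk d) := by fun_prop
    exact h4.prodMk (contDiffOn_verticalIntegral hρ)
  obtain ⟨J, hJ0, hJs, hJ⟩ := exists_local_inverse_within (uniqueDiffOn_disk d) hw.2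
    ((isOpen_strip 1).prod isOpen_univ) (u₀ := G (z, μ)) ⟨h1, trivial⟩ hZ L (by rw [hLA]; exact hA)
  dsimp only at h2
  rw [h2] at hJ0 hJs hJ
  have hsub : strip δ ×ˢ disk d ⊆ univ ×ˢ disk d := prod_mono (subset_univ _) Subset.rfl
  have hJm : ∀ᶠ q in 𝓝[univ ×ˢ disk d] (z, μ), J q ∈ strip 1 :=
    hJs.continuousWithinAt.eventually ((isOpen_strip 1).mem_nhds (by rwa [hJ0]))
  have hev : ∀ᶠ q in 𝓝[strip δ ×ˢ disk d] (z, μ), G q = J q := by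
    filter_upwards [nhdsWithin_mono _ hsub hJm, nhdsWithin_mono _ hsub hJ, self_mem_nhdsWithin]
      with q h3 h4 h5
    obtain ⟨h6, h7⟩ := hG q h5
    exact injOn_straighten hρ hpos h5.2 h6 h3 (h7.trans h4.symm)
  exact (hJs.mono hsub).congr_of_eventuallyEq hev hJ0.symm

end VerticalIntegral

/-- Precomposing `Φ` with the inverse `G` of `straighten` divides the density by `ρ = σ • density`,
leaving the constant `σ` because `σ² = 1`. The core is unchanged and the verticals there are only
rescaled by a positive factor, so the sign of the twist survives. -/
theorem exists_isAreaAnnulus (Ω : AreaForm S) {Φ : (ℝ × ℝ) × Param d → S} (hΦ : IsAnnulus Φ) :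
    ∃ (Ψ : (ℝ × ℝ) × Param d → S) (δ σ : ℝ), IsAreaAnnulus Ω Ψ δ σ ∧
      ∀ μ ∈ disk d, ∀ x : ℝ, Ψ ((x, 0), μ) = Φ ((x, 0), μ) ∧ ∃ c > 0, ∀ v : ℝ × ℝ,
        sliceDeriv Ψ μ (x, 0) (v.1, c * v.2) = sliceDeriv Φ μ (x, 0) v := by
  obtain ⟨σ, hσ, hpos⟩ := exists_density_sign Ω hΦ
  set ρ : (ℝ × ℝ) × Param d → ℝ := fun w => σ * density Ω Φ w with hρdef
  have hρ : ContDiffOn ℝ ∞ ρ (strip 1 ×ˢ disk d) := contDiffOn_const.mul (contDiffOn_density Ω hΦ)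
  have hρk : ∀ μ ∈ disk d, ∀ z ∈ strip 1, ∀ k : ℤ, ρ ((z.1 + k, z.2), μ) = ρ (z, μ) :=
    fun μ hμ z hz k => by rw [hρdef]; dsimp only; rw [density_translate Ω hΦ hμ hz]
  obtain ⟨δ, hδ, hex⟩ := exists_straighten_width hρ hpos hρk
  have hex' : ∀ w : (ℝ × ℝ) × Param d, ∃ z', w ∈ strip δ ×ˢ disk d →
      z' ∈ strip 1 ∧ straighten ρ (z', w.2) = w.1 := by
    intro w
    by_cases hw : w ∈ strip δ ×ˢ disk d
    · obtain ⟨z', h1, h2⟩ := hex w.1 hw.1 w.2 hw.2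
      exact ⟨z', fun _ => ⟨h1, h2⟩⟩
    · exact ⟨0, fun h => (hw h).elim⟩
  choose G hG using hex'
  have hGs := contDiffOn_straighten_inverse hρ hpos hG
  have hinj := fun {μ : Param d} (hμ : μ ∈ disk d) => injOn_straighten hρ hpos hμ
  have hZk : ∀ μ ∈ disk d, ∀ z ∈ strip 1, ∀ k : ℤ,
      straighten ρ ((z.1 + k, z.2), μ) = ((straighten ρ (z, μ)).1 + k, (straighten ρ (z, μ)).2) :=
    fun μ hμ z hz k => Prod.ext rfl (verticalIntegral_translate hρk hμ hz k)
  have hG0 : ∀ μ ∈ disk d, ∀ x : ℝ, G ((x, 0), μ) = (x, 0) := by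
    intro μ hμ x
    obtain ⟨h1, h2⟩ := hG ((x, 0), μ) ⟨⟨trivial, neg_lt_zero.2 hδ, hδ⟩, hμ⟩
    exact hinj hμ h1 ⟨trivial, by norm_num, by norm_num⟩
      (h2.trans (Prod.ext rfl (verticalIntegral_zero x μ).symm))
  -- `B` is the derivative of `G`; the second clause says that the triangular derivative of
  -- `straighten` inverts it.
  have hderiv : ∀ μ ∈ disk d, ∀ z ∈ strip δ, ∃ (B : (ℝ × ℝ) →L[ℝ] (ℝ × ℝ)) (b : ℝ),
      (∀ v, sliceDeriv (fun w => Φ (G w, w.2)) μ z v = sliceDeriv Φ μ (G (z, μ)) (B v)) ∧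
      (∀ v : ℝ × ℝ, v = ((B v).1, b * (B v).1 + ρ (G (z, μ), μ) * (B v).2)) ∧
      ((G (z, μ)).2 = 0 → b = 0) := by
    intro μ hμ z hz
    obtain ⟨h1, h2⟩ := hG (z, μ) ⟨hz, hμ⟩
    have hGμ : ContDiffOn ℝ ∞ (fun z => G (z, μ)) (strip δ) :=
      hGs.comp (by fun_prop) fun z hz => ⟨hz, hμ⟩
    have hB : HasFDerivAt (fun z => G (z, μ)) _ z :=
      ((hGμ.contDiffAt ((isOpen_strip δ).mem_nhds hz)).differentiableAt (by simp)).hasFDerivAt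
    obtain ⟨A, b, hA, hAv, hb⟩ := hasFDerivAt_straighten hρ hμ h1
    refine ⟨fderiv ℝ (fun z => G (z, μ)) z, b, fun v => ?_, fun v => ?_, hb⟩
    · have h3 := HasMFDerivAt.comp z
        (hasMFDerivAt_slice (isOpen_strip 1) hΦ.smooth hμ h1) hB.hasMFDerivAt
      have h4 : sliceDeriv (fun w => Φ (G w, w.2)) μ z = _ := h3.mfderiv
      rw [h4]; rfl
    · have h3 := hA.comp z hB
      have h4 : ((fun z => straighten ρ (z, μ)) ∘ fun z => G (z, μ)) =ᶠ[𝓝 z] id := by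
        filter_upwards [(isOpen_strip δ).mem_nhds hz] with z' hz'
        exact (hG (z', μ) ⟨hz', hμ⟩).2
      have h5 := (h3.congr_of_eventuallyEq h4.symm).unique (hasFDerivAt_id z)
      have h6 := congrArg (fun A : (ℝ × ℝ) →L[ℝ] (ℝ × ℝ) => A v) h5
      simp only [ContinuousLinearMap.comp_apply, hAv] at h6
      exact h6.symm
  refine ⟨fun w => Φ (G w, w.2), δ, σ, ⟨hδ, ?_, ?_, ?_, ?_⟩, fun μ hμ x => ⟨?_, ?_⟩⟩
  · rintro rfl
    norm_num at hσ
  · have h1 : ContDiffOn ℝ ∞ (fun w => (G w, w.2)) (strip δ ×ˢ disk d) :=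
      hGs.prodMk contDiffOn_snd
    exact hΦ.smooth.comp h1.contMDiffOn fun w hw => ⟨(hG w hw).1, hw.2⟩
  · intro μ hμ z hz z' hz'
    obtain ⟨h1, h2⟩ := hG (z, μ) ⟨hz, hμ⟩
    obtain ⟨h1', h2'⟩ := hG (z', μ) ⟨hz', hμ⟩
    dsimp only at h2 h2' ⊢
    rw [hΦ.eq_iff μ hμ _ h1 _ h1']
    refine exists_congr fun k => ⟨fun h => ?_, fun h => ?_⟩
    · rw [← h2', h, hZk μ hμ _ h1, h2]
    · refine hinj hμ h1' (show ((G (z, μ)).1 + (k : ℝ), (G (z, μ)).2) ∈ strip 1 from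
          ⟨trivial, h1.2⟩) ?_
      dsimp only
      rw [h2', hZk μ hμ _ h1, h2, h]
  · intro μ hμ z hz v w
    obtain ⟨h1, -⟩ := hG (z, μ) ⟨hz, hμ⟩
    obtain ⟨B, b, hB, hBv, -⟩ := hderiv μ hμ z hz
    rw [hB, hB]
    dsimp only
    rw [Ω.val_apply]
    change density Ω Φ (G (z, μ), μ) * areaDet (B v) (B w) = σ * areaDet v w
    have h2 : areaDet v w = ρ (G (z, μ), μ) * areaDet (B v) (B w) := by
      conv_lhs => rw [hBv v, hBv w]
      simp only [areaDet]; ring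
    rw [h2, hρdef]
    linear_combination (-(density Ω Φ (G (z, μ), μ)) * areaDet (B v) (B w)) * hσ
  · dsimp only
    rw [hG0 μ hμ]
  · have hz : (x, (0 : ℝ)) ∈ strip δ := ⟨trivial, neg_lt_zero.2 hδ, hδ⟩
    obtain ⟨h1, -⟩ := hG ((x, 0), μ) ⟨hz, hμ⟩
    obtain ⟨B, b, hB, hBv, hb⟩ := hderiv μ hμ (x, 0) hz
    have hb0 := hb (by rw [hG0 μ hμ])
    have hρ0 : 0 < ρ (G ((x, 0), μ), μ) := hpos _ ⟨h1, hμ⟩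
    refine ⟨ρ (G ((x, 0), μ), μ), hρ0, fun v => ?_⟩
    rw [hB, hG0 μ hμ]
    congr 1
    have h2 := hBv (v.1, ρ (G ((x, 0), μ), μ) * v.2)
    rw [hb0, zero_mul, zero_add] at h2
    obtain ⟨h3, h4⟩ := Prod.ext_iff.1 h2
    dsimp only at h3 h4
    rw [hG0 μ hμ] at h3 h4 hρ0
    exact Prod.ext h3.symm (mul_left_cancel₀ hρ0.ne' h4).symm

end KAMGrowth

/-! ### From KAM circles to annuli, and the shear along the core. -/

namespace KAMGrowth

variable {S : Type*} [TopologicalSpace S] [ChartedSpace Plane S] [IsManifold (𝓡 2) ∞ S]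
  {Ω : AreaForm S} {d : ℕ}

/-- The family of annuli around a family of circles, read on the universal cover. -/
def annulusLift (ψ : Param d → AddCircle (1 : ℝ) → ℝ → S) (w : (ℝ × ℝ) × Param d) : S :=
  ψ w.2 (w.1.1 : AddCircle (1 : ℝ)) w.1.2

theorem coe_addCircle_one_eq_iff {x y : ℝ} :
    (x : AddCircle (1 : ℝ)) = y ↔ ∃ k : ℤ, y = x + k := by
  rw [QuotientAddGroup.eq, AddSubgroup.mem_zmultiples_iff]
  refine exists_congr fun k => ⟨fun h => ?_, fun h => ?_⟩
  · simp only [zsmul_eq_mul, mul_one] at h; linarith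
  · simp only [zsmul_eq_mul, mul_one]; linarith

theorem strip_one_subset : strip 1 ⊆ (univ : Set ℝ) ×ˢ Icc (-1 : ℝ) 1 :=
  prod_mono Subset.rfl Ioo_subset_Icc_self

theorem core_mem_strip_one (x : ℝ) : (x, (0 : ℝ)) ∈ strip 1 :=
  ⟨trivial, by norm_num, by norm_num⟩

namespace IsKAMCircleFamily

variable {f : Family Ω d} {θ : ℝ} {ψ : Param d → AddCircle (1 : ℝ) → ℝ → S}

theorem annulusLift_eq_iff (h : IsKAMCircleFamily f θ ψ) {μ : Param d} (hμ : μ ∈ disk d)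
    {z z' : ℝ × ℝ} (hz : z.2 ∈ Icc (-1 : ℝ) 1) (hz' : z'.2 ∈ Icc (-1 : ℝ) 1) :
    annulusLift ψ (z, μ) = annulusLift ψ (z', μ) ↔ ∃ k : ℤ, z' = (z.1 + k, z.2) := by
  have h1 : annulusLift ψ (z, μ) = annulusLift ψ (z', μ) ↔
      ((z.1 : AddCircle (1 : ℝ)), z.2) = ((z'.1 : AddCircle (1 : ℝ)), z'.2) :=
    (h.injective μ hμ).eq_iff (x := ((z.1 : AddCircle (1 : ℝ)), z.2))
      (y := ((z'.1 : AddCircle (1 : ℝ)), z'.2)) ⟨trivial, hz⟩ ⟨trivial, hz'⟩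
  rw [h1, Prod.mk.injEq, coe_addCircle_one_eq_iff]
  refine ⟨fun ⟨⟨k, hk⟩, h2⟩ => ⟨k, Prod.ext hk h2.symm⟩, fun ⟨k, hk⟩ => ?_⟩
  rw [hk]
  exact ⟨⟨k, rfl⟩, rfl⟩

theorem isAnnulus (h : IsKAMCircleFamily f θ ψ) : IsAnnulus (annulusLift ψ) where
  smooth := h.smooth.mono (prod_mono strip_one_subset Subset.rfl)
  eq_iff μ hμ z hz z' hz' := h.annulusLift_eq_iff hμ (strip_one_subset hz).2
      (strip_one_subset hz').2
  injective μ hμ z hz := by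
    have h1 := h.immersion μ hμ z.1 z.2 (strip_one_subset hz).2
    rwa [mfderivWithin_of_mem_nhds (mem_of_superset ((isOpen_strip 1).mem_nhds hz)
      strip_one_subset)] at h1

end IsKAMCircleFamily

section CoreDerivative

variable {Ψ : (ℝ × ℝ) × Param d → S} {δ σ θ : ℝ}

/-- Differentiating the conjugacy to the rotation along the core. -/
theorem mfderiv_core (hΨ : IsAreaAnnulus Ω Ψ δ σ) (g : S ≃ₘ⟮𝓡 2, 𝓡 2⟯ S) {μ : Param d}
    (hμ : μ ∈ disk d) (hrot : ∀ x : ℝ, g (Ψ ((x, 0), μ)) = Ψ ((x + θ, 0), μ)) (x : ℝ) :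
    (mfderiv (𝓡 2) (𝓡 2) g (Ψ ((x, 0), μ)) : Plane →L[ℝ] Plane) (sliceDeriv Ψ μ (x, 0) (1, 0)) =
      sliceDeriv Ψ μ (x + θ, 0) (1, 0) := by
  have hι : ∀ c : ℝ, HasFDerivAt (fun t : ℝ => (t + c, (0 : ℝ)))
      (ContinuousLinearMap.inl ℝ ℝ ℝ) x := fun c =>
    ((hasFDerivAt_id x).add_const c).prodMk (hasFDerivAt_const (0 : ℝ) x)
  have h1 : HasMFDerivAt 𝓘(ℝ, ℝ) (𝓡 2) ((fun z => Ψ (z, μ)) ∘ fun t : ℝ => (t + θ, (0 : ℝ))) x _ :=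
    HasMFDerivAt.comp x (hΨ.hasMFDerivAt hμ (hΨ.core_mem (x + θ))) (hι θ).hasMFDerivAt
  have h2 : HasMFDerivAt 𝓘(ℝ, ℝ) (𝓡 2) ((fun z => Ψ (z, μ)) ∘ fun t : ℝ => (t + 0, (0 : ℝ))) x _ :=
    HasMFDerivAt.comp x (hΨ.hasMFDerivAt hμ (hΨ.core_mem (x + 0))) (hι 0).hasMFDerivAt
  have h3 : HasMFDerivAt (𝓡 2) (𝓡 2) g (Ψ ((x + 0, 0), μ)) _ :=
    (g.contMDiff.mdifferentiableAt (by simp)).hasMFDerivAt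
  have h4 := HasMFDerivAt.comp x h3 h2
  have h5 : (fun t : ℝ => g (Ψ ((t + 0, 0), μ))) = fun t : ℝ => Ψ ((t + θ, 0), μ) := by
    funext t; rw [hrot, add_zero]
  have h6 := hasMFDerivAt_unique (h4.congr_of_eventuallyEq (Eventually.of_forall fun t =>
    (congrFun h5 t).symm)) h1
  have h7 := congrArg (fun A : ℝ →L[ℝ] Plane => A 1) h6
  rw [add_zero] at h7
  exact h7

theorem preserves_val {g : S ≃ₘ⟮𝓡 2, 𝓡 2⟯ S} (hg : Preserves Ω g) (p : S) (v w : Plane) :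
    Ω.val (g p) ((mfderiv (𝓡 2) (𝓡 2) g p : Plane →L[ℝ] Plane) v)
      ((mfderiv (𝓡 2) (𝓡 2) g p : Plane →L[ℝ] Plane) w) = Ω.val p v w := hg p v w

/-- The horizontal vector is preserved by the conjugacy to the rotation, and the determinant is `1`
by preservation of area. The formula for `σ * a` serves to show that `a` is continuous in `μ`. -/
theorem exists_shear (hΨ : IsAreaAnnulus Ω Ψ δ σ) {g : S ≃ₘ⟮𝓡 2, 𝓡 2⟯ S} (hg : Preserves Ω g)
    {μ : Param d} (hμ : μ ∈ disk d) (hrot : ∀ x : ℝ, g (Ψ ((x, 0), μ)) = Ψ ((x + θ, 0), μ))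
        (x : ℝ) :
    ∃ a : ℝ, σ * a = Ω.val (Ψ ((x + θ, 0), μ))
        ((mfderiv (𝓡 2) (𝓡 2) g (Ψ ((x, 0), μ)) : Plane →L[ℝ] Plane) (sliceDeriv Ψ μ (x, 0) (0, 1)))
        (sliceDeriv Ψ μ (x + θ, 0) (0, 1)) ∧
      ∀ v : ℝ × ℝ, (mfderiv (𝓡 2) (𝓡 2) g (Ψ ((x, 0), μ)) : Plane →L[ℝ] Plane)
        (sliceDeriv Ψ μ (x, 0) v) = sliceDeriv Ψ μ (x + θ, 0) (v.1 + a * v.2, v.2) := by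
  obtain ⟨A, hA⟩ : ∃ A : Plane →L[ℝ] Plane, A = mfderiv (𝓡 2) (𝓡 2) g (Ψ ((x, 0), μ)) := ⟨_, rfl⟩
  obtain ⟨u, hu⟩ := hΨ.surjective_sliceDeriv hμ (hΨ.core_mem (x + θ))
      (A (sliceDeriv Ψ μ (x, 0) (0, 1)))
  have h1 : A (sliceDeriv Ψ μ (x, 0) (1, 0)) = sliceDeriv Ψ μ (x + θ, 0) (1, 0) :=
    (congrArg (fun B : Plane →L[ℝ] Plane => B (sliceDeriv Ψ μ (x, 0) (1, 0))) hA).trans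
      (mfderiv_core hΨ g hμ hrot x)
  have h2 : Ω.val (Ψ ((x + θ, 0), μ)) (A (sliceDeriv Ψ μ (x, 0) (1, 0)))
      (A (sliceDeriv Ψ μ (x, 0) (0, 1))) = Ω.val (Ψ ((x, 0), μ)) (sliceDeriv Ψ μ (x, 0) (1, 0))
      (sliceDeriv Ψ μ (x, 0) (0, 1)) := by
    rw [← hrot x, hA]
    exact preserves_val hg _ _ _
  rw [hΨ.area μ hμ _ (hΨ.core_mem x), h1, ← hu, hΨ.area μ hμ _ (hΨ.core_mem (x + θ))] at h2
  have h3 := mul_left_cancel₀ hΨ.ne_zero h2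
  simp only [areaDet, one_mul, zero_mul, sub_zero, mul_one] at h3
  suffices ∃ a : ℝ, σ * a = Ω.val (Ψ ((x + θ, 0), μ)) (A (sliceDeriv Ψ μ (x, 0) (0, 1)))
      (sliceDeriv Ψ μ (x + θ, 0) (0, 1)) ∧ ∀ v : ℝ × ℝ,
        A (sliceDeriv Ψ μ (x, 0) v) = sliceDeriv Ψ μ (x + θ, 0) (v.1 + a * v.2, v.2) by
    rwa [hA] at this
  refine ⟨u.1, ?_, fun v => ?_⟩
  · rw [← hu, hΨ.area μ hμ _ (hΨ.core_mem (x + θ))]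
    simp [areaDet]
  · have h4 : v = v.1 • ((1 : ℝ), (0 : ℝ)) + v.2 • ((0 : ℝ), (1 : ℝ)) := by simp
    have h5 : (v.1 + u.1 * v.2, v.2) = v.1 • ((1 : ℝ), (0 : ℝ)) + v.2 • u :=
      Prod.ext (by simp [mul_comm]) (by simp [h3])
    rw [h5]
    conv_lhs => rw [h4]
    rw [map_add, map_add, map_add, map_smul, map_smul, map_smul, map_smul, map_smul, map_smul, h1,
        ← hu]

theorem continuousOn_core_val (hΨ : IsAreaAnnulus Ω Ψ δ σ) (f : Family Ω d)
    (hrot : ∀ (μ : disk d) (x : ℝ), f.map μ (Ψ ((x, 0), μ)) = Ψ ((x + θ, 0), μ)) (x : ℝ) :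
    ContinuousOn (fun μ : Param d => Ω.val (Ψ ((x + θ, 0), μ))
      (sliceDeriv (fun w => f.eval (Ψ w, w.2)) μ (x, 0) (0, 1))
      (sliceDeriv Ψ μ (x + θ, 0) (0, 1))) (disk d) := by
  have hF : ContMDiffOn 𝓘(ℝ, (ℝ × ℝ) × Param d) (𝓡 2) ∞ (fun w => f.eval (Ψ w, w.2))
      (strip δ ×ˢ disk d) :=
    ContMDiffOn.comp (g := f.eval) f.smooth (hΨ.smooth.prodMk contDiff_snd.contMDiff.contMDiffOn)
      fun w hw => ⟨trivial, hw.2⟩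
  have hι : ∀ y : ℝ, ContMDiffOn 𝓘(ℝ, Param d) 𝓘(ℝ, (ℝ × ℝ) × Param d) ∞
      (fun μ : Param d => ((y, (0 : ℝ)), μ)) (disk d) := fun y =>
    (contDiff_const.prodMk contDiff_id).contMDiff.contMDiffOn
  have h1 := (contMDiffOn_sliceDeriv (isOpen_strip δ) hF (0, 1)).comp (hι x)
    fun μ hμ => ⟨hΨ.core_mem x, hμ⟩
  have h2 := (contMDiffOn_sliceDeriv (isOpen_strip δ) hΨ.smooth (0, 1)).comp (hι (x + θ))
    fun μ hμ => ⟨hΨ.core_mem (x + θ), hμ⟩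
  refine (contDiffOn_val Ω (b := fun μ : Param d => Ψ ((x + θ, 0), μ))
    (v := fun μ => sliceDeriv (fun w => f.eval (Ψ w, w.2)) μ (x, 0) (0, 1))
    (w := fun μ => sliceDeriv Ψ μ (x + θ, 0) (0, 1)) (h1.congr fun μ hμ => ?_) h2).continuousOn
  -- Both vectors must sit over the same base point before the area form is evaluated on them.
  have h3 : f.eval (Ψ ((x, 0), μ), μ) = Ψ ((x + θ, 0), μ) :=
    (f.eval_apply _ ⟨μ, hμ⟩).trans (hrot ⟨μ, hμ⟩ x)
  exact congrArg (fun p : S => (⟨p, sliceDeriv (fun w => f.eval (Ψ w, w.2)) μ (x, 0) (0, 1)⟩ :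
    Bundle.TotalSpace Plane (fun _ : S => Plane))) h3.symm

theorem sliceDeriv_eval (hΨ : IsAreaAnnulus Ω Ψ δ σ) (f : Family Ω d) (μ : disk d) {z : ℝ × ℝ}
    (hz : z ∈ strip δ) (v : ℝ × ℝ) :
    sliceDeriv (fun w => f.eval (Ψ w, w.2)) μ z v =
      (mfderiv (𝓡 2) (𝓡 2) (f.map μ) (Ψ (z, μ)) : Plane →L[ℝ] Plane) (sliceDeriv Ψ μ z v) := by
  have h1 : HasMFDerivAt (𝓡 2) (𝓡 2) (f.map μ) (Ψ (z, μ)) _ :=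
    ((f.map μ).contMDiff.mdifferentiableAt (by simp)).hasMFDerivAt
  have h2 := HasMFDerivAt.comp z h1 (hΨ.hasMFDerivAt μ.2 hz)
  have h3 : (fun z => f.eval (Ψ (z, (μ : Param d)), (μ : Param d))) =
      f.map μ ∘ fun z => Ψ (z, (μ : Param d)) := funext fun z => f.eval_apply _ μ
  rw [← h3] at h2
  exact congrArg (fun A : (ℝ × ℝ) →L[ℝ] Plane => A v) h2.mfderiv

/-- The shear coefficient is continuous in `μ` on the compact disk, so pointwise positivity yields
uniform bounds. -/
theorem isTwistAnnulus_of_pos (hΨ : IsAreaAnnulus Ω Ψ δ σ) (f : Family Ω d)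
    (hrot : ∀ (μ : disk d) (x : ℝ), f.map μ (Ψ ((x, 0), μ)) = Ψ ((x + θ, 0), μ))
    (hpos : ∀ (μ : disk d) (x a : ℝ), (mfderiv (𝓡 2) (𝓡 2) (f.map μ) (Ψ ((x, 0), μ)) :
      Plane →L[ℝ] Plane) (sliceDeriv Ψ μ (x, 0) (0, 1)) = sliceDeriv Ψ μ (x + θ, 0) (a, 1) → 0 <
          a) :
    IsTwistAnnulus f Ψ δ σ θ := by
  refine ⟨hΨ, hrot, fun x => ?_⟩
  choose a ha hav using fun μ : disk d => exists_shear hΨ (f.preserves μ) μ.2 (hrot μ) x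
  have hac : Continuous a := by
    have h1 := (continuousOn_iff_continuous_domRestrict.1 (continuousOn_core_val hΨ f hrot x))
    have h2 : a = fun μ : disk d => σ⁻¹ * Ω.val (Ψ ((x + θ, 0), μ))
        (sliceDeriv (fun w => f.eval (Ψ w, w.2)) μ (x, 0) (0, 1))
        (sliceDeriv Ψ μ (x + θ, 0) (0, 1)) := by
      funext μ
      rw [sliceDeriv_eval hΨ f μ (hΨ.core_mem x), ← ha μ, inv_mul_cancel_left₀ hΨ.ne_zero]
    rw [h2]
    exact continuous_const.mul h1
  have : CompactSpace (disk d) := isCompact_iff_compactSpace.1 (isCompact_closedBall _ _)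
  have : Nonempty (disk d) := ⟨⟨0, Metric.mem_closedBall_self zero_le_one⟩⟩
  obtain ⟨μ₁, -, h1⟩ := isCompact_univ.exists_isMinOn univ_nonempty hac.continuousOn
  obtain ⟨μ₂, -, h2⟩ := isCompact_univ.exists_isMaxOn univ_nonempty hac.continuousOn
  refine ⟨a μ₁, hpos μ₁ x (a μ₁) ?_, a μ₂, fun μ => ⟨a μ, ⟨h1 trivial, h2 trivial⟩, hav μ⟩⟩
  exact (hav μ₁ (0, 1)).trans (congrArg _ (Prod.ext (by simp) rfl))

end CoreDerivative

end KAMGrowth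

/-! ### The sign of the twist. -/

namespace KAMGrowth

variable {S : Type*} [TopologicalSpace S] [ChartedSpace Plane S] [IsManifold (𝓡 2) ∞ S]
  {Ω : AreaForm S} {d : ℕ} {f : Family Ω d} {θ : ℝ} {ψ : Param d → AddCircle (1 : ℝ) → ℝ → S}

namespace IsKAMCircleFamily

theorem map_core (h : IsKAMCircleFamily f θ ψ) (μ : disk d) (x : ℝ) :
    f.map μ (annulusLift ψ ((x, 0), μ)) = annulusLift ψ ((x + θ, 0), μ) := by
  have h1 := h.rotation μ (x : AddCircle (1 : ℝ))
  rw [← AddCircle.coe_add] at h1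
  exact h1

/-- The twist condition gives only a lift `X` differentiable at `0`, and no regularity of `Y`. A
local inverse of the annulus supplies a differentiable lift `K` of the image of the vertical
segment; its first coordinate agrees with `X` near `0`, so `c` is the horizontal component of its
velocity. -/
theorem exists_mfderiv_vertical (h : IsKAMCircleFamily f θ ψ) (μ : disk d) (x : ℝ) :
    ∃ c > 0, ∃ b, (mfderiv (𝓡 2) (𝓡 2) (f.map μ) (annulusLift ψ ((x, 0), μ)) : Plane →L[ℝ] Plane)
      (sliceDeriv (annulusLift ψ) μ (x, 0) (0, 1)) =
        sliceDeriv (annulusLift ψ) μ (x + θ, 0) (c, b) := by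
  obtain ⟨X, Y, c, hev, hX, hc⟩ := h.twist μ (x : AddCircle (1 : ℝ))
  set Φ := annulusLift ψ with hΦdef
  have hΦ : IsAnnulus Φ := h.isAnnulus
  obtain ⟨hY0, h0⟩ := hev.self_of_nhds
  obtain ⟨k, hk⟩ := (h.annulusLift_eq_iff μ.2 (z := (x + θ, 0)) (z' := (X 0, Y 0))
    (by norm_num) hY0).1 ((h.map_core μ x).symm.trans h0)
  have hz₀ : (x + θ + k, (0 : ℝ)) ∈ strip 1 := core_mem_strip_one _
  have hcore : Φ ((x + θ + k, 0), μ) = f.map μ (Φ ((x, 0), μ)) := by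
    rw [← hk]; exact h0.symm
  obtain ⟨J, hJ0, hJs, hJ⟩ := exists_local_inverse (isOpen_strip 1) hΦ.smooth hz₀ μ.2
    (hΦ.injective μ μ.2 _ hz₀)
  rw [hcore] at hJ0 hJs hJ
  have hι : ContMDiffAt (𝓡 2) ((𝓡 2).prod 𝓘(ℝ, Param d)) ∞ (fun p : S => (p, (μ : Param d)))
      (f.map μ (Φ ((x, 0), μ))) := contMDiffAt_id.prodMk contMDiffAt_const
  have hJμ : ContMDiffAt (𝓡 2) 𝓘(ℝ, ℝ × ℝ) ∞ (fun p : S => J (p, μ))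
      (f.map μ (Φ ((x, 0), μ))) := by
    rw [← contMDiffWithinAt_univ] at hι ⊢
    exact ContMDiffWithinAt.comp (f := fun p : S => (p, (μ : Param d))) _ hJs hι
      fun p _ => ⟨trivial, μ.2⟩
  have hJinv : ∀ᶠ p in 𝓝 (f.map μ (Φ ((x, 0), μ))), Φ (J (p, μ), μ) = p := by
    have h1 := hι.continuousAt.continuousWithinAt (s := univ)
    have h2 := (h1.tendsto_nhdsWithin (t := univ ×ˢ disk d) fun p _ => ⟨trivial, μ.2⟩).eventually hJ
    rwa [nhdsWithin_univ] at h2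
  have hvert : HasFDerivAt (fun y : ℝ => (x, y)) (ContinuousLinearMap.inr ℝ ℝ ℝ) (0 : ℝ) :=
    (hasFDerivAt_const x 0).prodMk (hasFDerivAt_id 0)
  have hΦv : HasMFDerivAt 𝓘(ℝ, ℝ) (𝓡 2) (fun y : ℝ => Φ ((x, y), μ)) 0 _ :=
    HasMFDerivAt.comp (0 : ℝ) (hasMFDerivAt_slice (isOpen_strip 1) hΦ.smooth μ.2
      (core_mem_strip_one x)) hvert.hasMFDerivAt
  have hfm : HasMFDerivAt (𝓡 2) (𝓡 2) (f.map μ) (Φ ((x, 0), μ)) _ :=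
    ((f.map μ).contMDiff.mdifferentiableAt (by simp)).hasMFDerivAt
  have hF : HasMFDerivAt 𝓘(ℝ, ℝ) (𝓡 2) (fun y : ℝ => f.map μ (Φ ((x, y), μ))) 0 _ :=
    HasMFDerivAt.comp (0 : ℝ) hfm hΦv
  set K : ℝ → ℝ × ℝ := fun y => J (f.map μ (Φ ((x, y), μ)), μ) with hK
  have hKd : HasMFDerivAt 𝓘(ℝ, ℝ) 𝓘(ℝ, ℝ × ℝ) K 0 _ :=
    HasMFDerivAt.comp (g := fun p : S => J (p, μ)) (0 : ℝ)
        (hJμ.mdifferentiableAt (by simp)).hasMFDerivAt hF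
  have hKf : HasFDerivAt K (fderiv ℝ K 0) 0 := hKd.hasFDerivAt.differentiableAt.hasFDerivAt
  have hK0 : K 0 = (x + θ + k, 0) := hJ0
  have hKm : ∀ᶠ y in 𝓝 (0 : ℝ), K y ∈ strip 1 :=
    hKf.continuousAt.eventually ((isOpen_strip 1).mem_nhds (by rwa [hK0]))
  have hKinv : ∀ᶠ y in 𝓝 (0 : ℝ), Φ (K y, μ) = f.map μ (Φ ((x, y), μ)) :=
    hF.continuousAt.eventually hJinv
  have hX0 : X 0 = x + θ + k := congrArg Prod.fst hk
  -- The two lifts differ by an integer, which this forces to be `0`.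
  have hdist : ∀ᶠ y in 𝓝 (0 : ℝ), |X y - (K y).1| < 1 := by
    have h1 : ContinuousAt (fun y => |X y - (K y).1|) 0 :=
      (hX.continuousAt.sub (continuous_fst.continuousAt.comp hKf.continuousAt)).abs
    have h2 : |X 0 - (K 0).1| < 1 := by rw [hX0, hK0]; simp
    exact h1.eventually_lt_const h2
  have hXK : X =ᶠ[𝓝 0] fun y => (K y).1 := by
    filter_upwards [hev, hKm, hKinv, hdist] with y ⟨h1, h2⟩ h3 h4 h5
    obtain ⟨j, hj⟩ := (h.annulusLift_eq_iff μ.2 (z := K y) (z' := (X y, Y y))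
      (strip_one_subset h3).2 h1).1 (h4.trans h2)
    have h6 : X y = (K y).1 + j := congrArg Prod.fst hj
    rw [h6, add_sub_cancel_left] at h5
    have h7 : j = 0 := by
      rw [← Int.abs_lt_one_iff]; exact_mod_cast h5
    rw [h6, h7, Int.cast_zero, add_zero]
  have hcK : c = (fderiv ℝ K 0 1).1 := by
    have h1 : HasDerivAt (fun y => (K y).1) (fderiv ℝ K 0 1).1 0 :=
      hKf.hasDerivAt.fst
    exact (hX.congr_of_eventuallyEq hXK.symm).unique h1
  have hΦK : HasMFDerivAt 𝓘(ℝ, ℝ) (𝓡 2) ((fun z => Φ (z, (μ : Param d))) ∘ K) 0 _ :=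
    HasMFDerivAt.comp (0 : ℝ) (hasMFDerivAt_slice (isOpen_strip 1) hΦ.smooth μ.2
      (z := K 0) (by rwa [hK0])) hKf.hasMFDerivAt
  have hEq := hasMFDerivAt_unique (hF.congr_of_eventuallyEq hKinv) hΦK
  have hEq1 := congrArg (fun A : ℝ →L[ℝ] Plane => A 1) hEq
  refine ⟨c, hc, (fderiv ℝ K 0 1).2, ?_⟩
  have hlast : sliceDeriv Φ μ (K 0) = sliceDeriv Φ μ (x + θ, 0) := by
    rw [hK0]
    exact hΦ.sliceDeriv_translate μ.2 (z := (x + θ, 0)) (core_mem_strip_one _) k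
  rw [hcK, ← hlast]
  exact hEq1

theorem exists_isTwistAnnulus (h : IsKAMCircleFamily f θ ψ) :
    ∃ (Ψ : (ℝ × ℝ) × Param d → S) (δ σ : ℝ), IsTwistAnnulus f Ψ δ σ θ := by
  obtain ⟨Ψ, δ, σ, hΨ, hcore⟩ := exists_isAreaAnnulus Ω h.isAnnulus
  refine ⟨Ψ, δ, σ, isTwistAnnulus_of_pos hΨ f (fun μ x => ?_) fun μ x a ha => ?_⟩
  · rw [(hcore μ μ.2 x).1, (hcore μ μ.2 (x + θ)).1]
    exact h.map_core μ x
  · obtain ⟨h0, c₁, hc₁, h1⟩ := hcore μ μ.2 x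
    obtain ⟨-, c₂, -, h2⟩ := hcore μ μ.2 (x + θ)
    obtain ⟨c, hc, b, hcb⟩ := h.exists_mfderiv_vertical μ x
    rw [h0] at ha
    obtain ⟨A, hA⟩ : ∃ A : Plane →L[ℝ] Plane,
      A = mfderiv (𝓡 2) (𝓡 2) (f.map μ) (annulusLift ψ ((x, 0), μ)) := ⟨_, rfl⟩
    replace ha : A (sliceDeriv Ψ μ (x, 0) (0, 1)) = sliceDeriv Ψ μ (x + θ, 0) (a, 1) := by
      rw [hA]; exact ha
    replace hcb : A (sliceDeriv (annulusLift ψ) μ (x, 0) (0, 1)) =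
        sliceDeriv (annulusLift ψ) μ (x + θ, 0) (c, b) := by
      rw [hA]; exact hcb
    have h3 : ((0 : ℝ), c₁ * 1) = c₁ • ((0 : ℝ), (1 : ℝ)) := by simp
    rw [← h1, ← h2, h3, map_smul, map_smul, ha, ← map_smul] at hcb
    -- Comparison of horizontal components; the rescaling `c₂` at the image point affects only the
    -- vertical one.
    have h4 : c₁ * a = c :=
      congrArg Prod.fst (hΨ.injective_sliceDeriv μ.2 (hΨ.core_mem (x + θ)) hcb)
    exact (mul_pos_iff_of_pos_left hc₁).1 (h4 ▸ hc)

end IsKAMCircleFamily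

end KAMGrowth

theorem proposition2p3 {S : Type*} [TopologicalSpace S] [T2Space S] [CompactSpace S]
    [ChartedSpace KAMGrowth.Plane S] [IsManifold (𝓡 2) ∞ S] (Ω : KAMGrowth.AreaForm S) (d : ℕ)
    (f : KAMGrowth.Family Ω d)
    (hf : ∃ (θ : ℝ) (ψ : KAMGrowth.Param d → AddCircle (1 : ℝ) → ℝ → S),
      KAMGrowth.IsKAMCircleFamily f θ ψ)
    (V : Set (KAMGrowth.Family Ω d)) (hV : V ∈ 𝓝 f)
    (γ : ℕ → ℕ) (hγ : ∀ n, 1 ≤ n → 0 < γ n) (n₀ : ℕ) (hn₀ : 1 ≤ n₀) :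
    ∃ g ∈ V, ∃ n : ℕ, n₀ ≤ n ∧ ∀ μ : KAMGrowth.disk d,
      ((n * γ n : ℕ) : ℕ∞) ≤
        min (KAMGrowth.hypPer (g.map μ) n).encard (KAMGrowth.ellPer (g.map μ) n).encard := by
  obtain ⟨θ, ψ, h⟩ := hf
  obtain ⟨Ψ, δ, σ, hΨ⟩ := h.exists_isTwistAnnulus
  exact hΨ.exists_many_periodic_points hV hγ n₀
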